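/- \textbf{Setting (the calculus lqCCS).} Fix denumerable sets of qubit names, tags, and, for each of the types boolean, natural number, qubit, of variables and channels of that type. Expressions $e$ are variables, booleans, naturals, qubit names, and $\neg e,\ e\lor e,\ e\le e,\ e=e$. Tagged processes are $$P ::= \mathbf 0_{\tilde e} \mid t{:}\tau.P \mid (t,t'){:}\tau.P \mid t{:}c?x.P \mid t{:}c!e.P \mid t{:}\mathcal E(\tilde e).P \mid t{:}\mathcal M(\tilde e\rhd x).P \mid \mathbf{if}\ e\ \mathbf{then}\ P\ \mathbf{else}\ P \mid P+P \mid P\parallel P \mid P\setminus c,$$ where $t,t'$ are tags, $\mathcal E$ is a trace-preserving superoperator on $n>0$ qubits and $\mathcal M=\{M_m\}$ a measurement ($\sum_m M_m^\dagger M_m=\mathbb I$). A linear type system assigns to a process at most one set $\Sigma_P$ of owned qubits ($\mathbf 0_{\tilde e}$ owns exactly $\tilde e$; operations and measurements act on owned, distinct qubits; sending a qubit gives it up, receiving one acquires it; parallel components own disjoint sets). Fix a finite set $\Sigma$ of qubits with state space $\mathcal H_\Sigma$. A closed process has type $(\Sigma,\Sigma')$ if $\Sigma_P=\Sigma'\subseteq\Sigma$;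 a distribution has type $(\Sigma,\Sigma')$ if $\Sigma'\subseteq\Sigma$ and all processes in its support have this type. A scheduler $s$ is a tag or a pair of tags; actions $\mu$ are $\tau,\ c!v,\ c?v$. A configuration $\langle\rho,P\rangle$, with $\rho$ a density operator on $\mathcal H_\Sigma$ of trace one, has transitions $\langle\rho,P\rangle\xrightarrow{\mu}_s\Delta$ to finitely supported probability distributions, given by the usual CCS rules: a prefix is executed by the scheduler that is its tag (or pair of tags); $\mathcal E(\tilde q)$ and $\mathcal M(\tilde q\rhd x)$ are $\tau$-moves acting on $\rho$, the latter leading to $\langle M_m\rho M_m^\dagger/p_m,P[m/x]\rangle$ with probability $p_m=\operatorname{tr}(M_m\rho M_m^\dagger)$; a received value has the type of the channel and, if it is a qubit, lies in $\Sigma$ and is not owned by the receiving process or by any process in parallel with it; a send with tag $t$ in the left and a reception with tag $t'$ in the right component of a parallel (or vice versa) synchronize under $(t,t')$; $P\setminus c$ blocks visible actions on $c$. On finitely supported distributions of mass at most one, $\Delta\xrightarrow{\mu}_s\Theta$ is the smallest left-linear relation containing $1\cdot C\xrightarrow{\mu}_s\Theta$ when $C\xrightarrow{\mu}_s\Theta$,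 and $1\cdot C\xrightarrow{\mu}_s\epsilon$ (the empty distribution) when $C$ has no transition for $\mu,s$. A process is \emph{deterministic} if it and every process reachable from it satisfy: two transitions from the same state with the same scheduler either coincide or are receptions $c?v\ne c?v'$ on the same channel. \emph{Scheduled saturated bisimilarity} $\sim_s$ is the largest relation $\mathcal R$ on distributions of configurations such that $\Delta\,\mathcal R\,\Theta$ implies that $\Delta,\Theta$ have a common type $(\Sigma,\Sigma')$ and equal mass, and that for every context $B=[\cdot]$ or $B=[\cdot]\parallel R$ ($R$ closed, deterministic, owning only qubits of $\Sigma\setminus\Sigma'$ where $(\Sigma,\Sigma')$ is a common type of $\Delta,\Theta$, and with no tag in common with $\Delta$ or $\Theta$) and every $s$: if $B[\Delta]\xrightarrow{\tau}_s\Delta'$ then $B[\Theta]\xrightarrow{\tau}_s\Theta'$ for some $\Theta'$ with $\Delta'\,\mathcal R\,\Theta'$, and symmetrically. A \emph{quantum distribution} $\mathfrak D$ assigns to finitely many processes positive semidefinite operators on $\mathcal H_\Sigma$ of total trace at most one; $\rho\bullet P$ has the single weight $\rho$ on $P$. Its transitions $\mathfrak D\Rightarrow^{\mu}_s\mathfrak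 D'$ are generated as follows: $\rho\bullet P$ moves by the same rules as configurations, a measurement leading to $\bigoplus_m (M_m\rho M_m^\dagger)\bullet P[m/x]$; $\rho\bullet P\Rightarrow^{\mu}_s\epsilon$ if no such rule applies; and $\mathfrak D\oplus\mathfrak T\Rightarrow^{\mu}_s\mathfrak D'\oplus\mathfrak T'$ if $\mathfrak D\Rightarrow^{\mu}_s\mathfrak D'$ and $\mathfrak T\Rightarrow^{\mu}_s\mathfrak T'$. \emph{Labelled ground scheduled bisimilarity} $\sim_g$ is the largest relation $\mathcal R$ on quantum distributions such that $\mathfrak D\,\mathcal R\,\mathfrak T$ implies that they have a common type $(\Sigma,\Sigma')$ and equal environments $\operatorname{tr}_{\Sigma'}\big(\sum_P\mathfrak D(P)\big)=\operatorname{tr}_{\Sigma'}\big(\sum_P\mathfrak T(P)\big)$, and that for all $\mu,s$: if $\mathfrak D\Rightarrow^{\mu}_s\mathfrak D'$ then $\mathfrak T\Rightarrow^{\mu}_s\mathfrak T'$ for some $\mathfrak T'$ with $\mathfrak D'\,\mathcal R\,\mathfrak T'$, and symmetrically. A process is \emph{input-restricted} if every input prefix $c?x$ on a channel $c$ of qubit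 type occurs under a restriction $\setminus c$. \textbf{Theorem.} Let $P,Q$ be deterministic input-restricted processes and $\rho,\sigma$ density operators of trace one on $\mathcal H_\Sigma$. Then $$1\cdot\langle\rho,P\rangle\sim_s 1\cdot\langle\sigma,Q\rangle\quad\Longleftrightarrow\quad \rho\bullet P\sim_g\sigma\bullet Q.$$ -/

import Mathlib

open scoped NNReal Matrix ComplexOrder

/-! The quantum process calculus lqCCS: syntax, linear type system, probabilistic semantics with
syntactic schedulers, density operator semantics, and the two bisimilarities. -/

namespace LqCCS

/-! ### Syntax -/

/-- Types of values: booleans, natural numbers and qubit names. -/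
inductive Ty
  | bool
  | nat
  | qubit
  deriving DecidableEq

/-- Variables, a denumerable supply for each type. -/
structure Var where
  ty : Ty
  id : ℕ
  deriving DecidableEq

/-- Channels, a denumerable supply for each type of transmitted values. -/
structure Chan where
  ty : Ty
  id : ℕ
  deriving DecidableEq

/-- Atomic values. Qubit names are natural numbers. -/
inductive Value
  | bool (b : Bool)
  | nat (n : ℕ)
  | qubit (q : ℕ)
  deriving DecidableEq

def Value.ty : Value → Ty
  | .bool _ => .bool
  | .nat _ => .nat
  | .qubit _ => .qubit

/-- Expressions. -/
inductive Expr
  | var (x : Var)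
  | bool (b : Bool)
  | nat (n : ℕ)
  | qubit (q : ℕ)
  | not (e : Expr)
  | or (e f : Expr)
  | le (e f : Expr)
  | eq (e f : Expr)

def Value.toExpr : Value → Expr
  | .bool b => .bool b
  | .nat n => .nat n
  | .qubit q => .qubit q

/-- Evaluation of expressions; free variables are not evaluated. -/
def Expr.eval : Expr → Option Value
  | .var _ => none
  | .bool b => some (.bool b)
  | .nat n => some (.nat n)
  | .qubit q => some (.qubit q)
  | .not e =>
    match e.eval with
    | some (.bool b) => some (.bool (!b))
    | _ => none
  | .or e f =>
    match e.eval, f.eval with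
    | some (.bool b), some (.bool b') => some (.bool (b || b'))
    | _, _ => none
  | .le e f =>
    match e.eval, f.eval with
    | some (.nat (m : ℕ)), some (.nat n) => some (.bool (decide (m ≤ n)))
    | _, _ => none
  | .eq e f =>
    match e.eval, f.eval with
    | some v, some w => some (.bool (decide (v = w)))
    | _, _ => none

/-- Typing of expressions; the expressions of type `qubit` are the qubit names and the qubit
variables. -/
inductive Expr.HasTy : Expr → Ty → Prop
  | var (x : Var) : HasTy (.var x) x.ty
  | bool (b : Bool) : HasTy (.bool b) .bool
  | nat (n : ℕ) : HasTy (.nat n) .nat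
  | qubit (q : ℕ) : HasTy (.qubit q) .qubit
  | not {e : Expr} : HasTy e .bool → HasTy (.not e) .bool
  | or {e f : Expr} : HasTy e .bool → HasTy f .bool → HasTy (.or e f) .bool
  | le {e f : Expr} : HasTy e .nat → HasTy f .nat → HasTy (.le e f) .bool
  | eq {e f : Expr} {T : Ty} : HasTy e T → HasTy f T → HasTy (.eq e f) .bool

def Expr.fv : Expr → Set Var
  | .var x => {x}
  | .bool _ => ∅
  | .nat _ => ∅
  | .qubit _ => ∅
  | .not e => e.fv
  | .or e f => e.fv ∪ f.fv
  | .le e f => e.fv ∪ f.fv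
  | .eq e f => e.fv ∪ f.fv

/-- `e.subst x v` is `e[v/x]`. -/
def Expr.subst (x : Var) (v : Value) : Expr → Expr
  | .var y => if y = x then v.toExpr else .var y
  | .bool b => .bool b
  | .nat n => .nat n
  | .qubit q => .qubit q
  | .not e => .not (e.subst x v)
  | .or e f => .or (e.subst x v) (f.subst x v)
  | .le e f => .le (e.subst x v) (f.subst x v)
  | .eq e f => .eq (e.subst x v) (f.subst x v)

/-- Linear operators on the state space of the qubits indexed by `ι`, in the computational
basis `ι → Fin 2`. -/
abbrev Op (ι : Type) [Fintype ι] := Matrix (ι → Fin 2) (ι → Fin 2) ℂ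

/-- Trace-preserving superoperators on `n > 0` qubits, given by a Kraus decomposition. -/
structure SuperOp (n : ℕ) where
  pos : 0 < n
  k : ℕ
  kraus : Fin k → Op (Fin n)
  complete : ∑ i, (kraus i)ᴴ * kraus i = 1

/-- Measurements on `n` qubits with `k` outcomes. -/
structure Measurement (n : ℕ) where
  k : ℕ
  op : Fin k → Op (Fin n)
  complete : ∑ m, (op m)ᴴ * op m = 1

/-- Tagged processes. Tags are natural numbers. -/
inductive Proc
  | nil (es : List Expr)
  | tau (t : ℕ) (P : Proc)
  | tauPair (t t' : ℕ) (P : Proc)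
  | recv (t : ℕ) (c : Chan) (x : Var) (P : Proc)
  | send (t : ℕ) (c : Chan) (e : Expr) (P : Proc)
  | sop (t : ℕ) {n : ℕ} (E : SuperOp n) (es : Fin n → Expr) (P : Proc)
  | meas (t : ℕ) {n : ℕ} (M : Measurement n) (es : Fin n → Expr) (x : Var) (P : Proc)
  | ite (e : Expr) (P Q : Proc)
  | sum (P Q : Proc)
  | par (P Q : Proc)
  | restr (P : Proc) (c : Chan)

/-- `P.subst x v` is `P[v/x]`, the substitution of the free occurrences of `x`. -/
def Proc.subst (x : Var) (v : Value) : Proc → Proc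
  | .nil es => .nil (es.map (Expr.subst x v))
  | .tau t P => .tau t (P.subst x v)
  | .tauPair t t' P => .tauPair t t' (P.subst x v)
  | .recv t c y P => .recv t c y (if y = x then P else P.subst x v)
  | .send t c e P => .send t c (e.subst x v) (P.subst x v)
  | .sop t E es P => .sop t E (fun i => (es i).subst x v) (P.subst x v)
  | .meas t M es y P =>
    .meas t M (fun i => (es i).subst x v) y (if y = x then P else P.subst x v)
  | .ite e P Q => .ite (e.subst x v) (P.subst x v) (Q.subst x v)
  | .sum P Q => .sum (P.subst x v) (Q.subst x v)
  | .par P Q => .par (P.subst x v) (Q.subst x v)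
  | .restr P c => .restr (P.subst x v) c

/-- Free variables; receptions and measurements are the binders. -/
def Proc.fv : Proc → Set Var
  | .nil es => {x | ∃ e ∈ es, x ∈ e.fv}
  | .tau _ P => P.fv
  | .tauPair _ _ P => P.fv
  | .recv _ _ x P => P.fv \ {x}
  | .send _ _ e P => e.fv ∪ P.fv
  | .sop _ _ es P => (⋃ i, (es i).fv) ∪ P.fv
  | .meas _ _ es x P => (⋃ i, (es i).fv) ∪ (P.fv \ {x})
  | .ite e P Q => e.fv ∪ P.fv ∪ Q.fv
  | .sum P Q => P.fv ∪ Q.fv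
  | .par P Q => P.fv ∪ Q.fv
  | .restr P _ => P.fv

/-- The tags occurring in a process. -/
def Proc.tags : Proc → Finset ℕ
  | .nil _ => ∅
  | .tau t P => insert t P.tags
  | .tauPair t t' P => insert t (insert t' P.tags)
  | .recv t _ _ P => insert t P.tags
  | .send t _ _ P => insert t P.tags
  | .sop t _ _ P => insert t P.tags
  | .meas t _ _ _ P => insert t P.tags
  | .ite _ P Q => P.tags ∪ Q.tags
  | .sum P Q => P.tags ∪ Q.tags
  | .par P Q => P.tags ∪ Q.tags
  | .restr P _ => P.tags

/-- Unrestricted input channels of qubit type. -/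
def Proc.uic : Proc → Set Chan
  | .nil _ => ∅
  | .tau _ P => P.uic
  | .tauPair _ _ P => P.uic
  | .recv _ c _ P => if c.ty = .qubit then {c} ∪ P.uic else P.uic
  | .send _ _ _ P => P.uic
  | .sop _ _ _ P => P.uic
  | .meas _ _ _ _ P => P.uic
  | .ite _ P Q => P.uic ∪ Q.uic
  | .sum P Q => P.uic ∪ Q.uic
  | .par P Q => P.uic ∪ Q.uic
  | .restr P c => P.uic \ {c}

/-- Input-restricted processes. -/
def Proc.InputRestricted (P : Proc) : Prop := P.uic = ∅

/-! ### Type system -/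

/-- The typing judgment `Γ ⊢ P`, where `Γ` is the set of the qubit names and qubit variables
owned by `P`. -/
inductive Typing : Set Expr → Proc → Prop
  | nil {es : List Expr} (nodup : es.Nodup) (qubits : ∀ e ∈ es, e.HasTy .qubit) :
      Typing {e | e ∈ es} (.nil es)
  | tau {Γ : Set Expr} {t : ℕ} {P : Proc} : Typing Γ P → Typing Γ (.tau t P)
  | tauPair {Γ : Set Expr} {t t' : ℕ} {P : Proc} : Typing Γ P → Typing Γ (.tauPair t t' P)
  | sop {Γ : Set Expr} {t n : ℕ} {E : SuperOp n} {es : Fin n → Expr} {P : Proc}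
      (inj : Function.Injective es) (sub : Set.range es ⊆ Γ) :
      Typing Γ P → Typing Γ (.sop t E es P)
  | meas {Γ : Set Expr} {t n : ℕ} {M : Measurement n} {es : Fin n → Expr} {x : Var} {P : Proc}
      (inj : Function.Injective es) (sub : Set.range es ⊆ Γ) (hx : x.ty = .nat) :
      Typing Γ P → Typing Γ (.meas t M es x P)
  | crecv {Γ : Set Expr} {t : ℕ} {c : Chan} {x : Var} {P : Proc}
      (hc : c.ty ≠ .qubit) (hx : x.ty = c.ty) :
      Typing Γ P → Typing Γ (.recv t c x P)
  | qrecv {Γ : Set Expr} {t : ℕ} {c : Chan} {x : Var} {P : Proc}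
      (hc : c.ty = .qubit) (hx : x.ty = .qubit) (fresh : Expr.var x ∉ Γ) :
      Typing (Γ ∪ {Expr.var x}) P → Typing Γ (.recv t c x P)
  | csend {Γ : Set Expr} {t : ℕ} {c : Chan} {e : Expr} {P : Proc}
      (hc : c.ty ≠ .qubit) (he : e.HasTy c.ty) :
      Typing Γ P → Typing Γ (.send t c e P)
  | qsend {Γ : Set Expr} {t : ℕ} {c : Chan} {e : Expr} {P : Proc}
      (hc : c.ty = .qubit) (he : e.HasTy .qubit) (mem : e ∈ Γ) :
      Typing (Γ \ {e}) P → Typing Γ (.send t c e P)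
  | ite {Γ : Set Expr} {e : Expr} {P Q : Proc} (he : e.HasTy .bool) :
      Typing Γ P → Typing Γ Q → Typing Γ (.ite e P Q)
  | sum {Γ : Set Expr} {P Q : Proc} : Typing Γ P → Typing Γ Q → Typing Γ (.sum P Q)
  | par {Γ₁ Γ₂ : Set Expr} {P Q : Proc} (disj : Γ₁ ∩ Γ₂ = ∅) :
      Typing Γ₁ P → Typing Γ₂ Q → Typing (Γ₁ ∪ Γ₂) (.par P Q)
  | restr {Γ : Set Expr} {P : Proc} {c : Chan} : Typing Γ P → Typing Γ (.restr P c)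

/-- `P` is a closed process that owns exactly the qubit names in `G`. -/
def Proc.HasType (P : Proc) (G : Finset ℕ) : Prop :=
  P.fv = ∅ ∧ Typing (Expr.qubit '' (G : Set ℕ)) P

/-- `P` does not own the qubit name `q`, i.e. `q` is not in the typing context of `P`. -/
def Proc.NotOwns (P : Proc) (q : ℕ) : Prop := ∀ Γ, Typing Γ P → Expr.qubit q ∉ Γ

/-! ### Quantum states -/

/-- Density operators (of trace one) on the qubits of the register `S`. -/
def Density (S : Finset ℕ) : Type := {ρ : Op S // ρ.PosSemidef ∧ ρ.trace = 1}

/-- The operator that acts as `K` on the qubits listed by `q` and as the identity on the others. -/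
def embed {S : Finset ℕ} {n : ℕ} (q : Fin n ↪ S) (K : Op (Fin n)) : Op S :=
  fun a b =>
    open Classical in
    if ∀ r, r ∉ Set.range q → a r = b r then K (a ∘ q) (b ∘ q) else 0

/-- `E.apply q ρ` is the superoperator `E` applied to the qubits `q` of `ρ`. -/
def SuperOp.apply {S : Finset ℕ} {n : ℕ} (E : SuperOp n) (q : Fin n ↪ S) (ρ : Op S) : Op S :=
  ∑ i, embed q (E.kraus i) * ρ * (embed q (E.kraus i))ᴴ

/-- The unnormalized state after outcome `m` of a measurement of the qubits `q` of `ρ`. -/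
def Measurement.apply {S : Finset ℕ} {n : ℕ} (M : Measurement n) (m : Fin M.k) (q : Fin n ↪ S)
    (ρ : Op S) : Op S :=
  embed q (M.op m) * ρ * (embed q (M.op m))ᴴ

/-- The partial trace over the qubits in `G`. -/
noncomputable def partialTrace {S : Finset ℕ} (G : Finset ℕ) (ρ : Op S) :
    Op {q : S // ¬ q.1 ∈ G} :=
  fun a b => ∑ c : {q : S // q.1 ∈ G} → Fin 2,
    ρ ((Equiv.piEquivPiSubtypeProd (fun q : S => q.1 ∈ G) (fun _ => Fin 2)).symm (c, a))
      ((Equiv.piEquivPiSubtypeProd (fun q : S => q.1 ∈ G) (fun _ => Fin 2)).symm (c, b))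

/-! ### Distributions -/

/-- The mass of a finitely supported weight function. -/
noncomputable def mass {A : Type} (Δ : A →₀ ℝ≥0) : ℝ≥0 := Δ.sum fun _ p => p

/-- Probability distributions with finite support and mass at most one. -/
def SDist (A : Type) : Type := {Δ : A →₀ ℝ≥0 // mass Δ ≤ 1}

/-- The point distribution of mass one. -/
noncomputable def SDist.point {A : Type} (a : A) : SDist A :=
  ⟨Finsupp.single a 1, by simp [mass]⟩

/-- The image of a distribution under a function. -/
noncomputable def SDist.map {A B : Type} (f : A → B) (Δ : SDist A) : SDist B :=
  ⟨Δ.1.mapDomain f, by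
    have h : mass (Δ.1.mapDomain f) = mass Δ.1 :=
      Finsupp.sum_mapDomain_index (fun _ => rfl) (fun _ _ _ => rfl)
    rw [h]
    exact Δ.2⟩

/-- The left-linear lifting: the smallest left-linear relation that contains `(1 • a, Θ)` whenever
`R a Θ`. -/
inductive Lift {A B : Type} (R : A → SDist B → Prop) : SDist A → SDist B → Prop
  | point {a : A} {Θ : SDist B} : R a Θ → Lift R (SDist.point a) Θ
  | linear {n : ℕ} (p : Fin n → ℝ≥0) (hp : ∀ i, p i ≤ 1) (Δ : Fin n → SDist A)
      (Θ : Fin n → SDist B) (Δ' : SDist A) (Θ' : SDist B)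
      (hΔ : Δ'.1 = ∑ i, p i • (Δ i).1) (hΘ : Θ'.1 = ∑ i, p i • (Θ i).1) :
      (∀ i, Lift R (Δ i) (Θ i)) → Lift R Δ' Θ'

/-! ### Probabilistic semantics -/

/-- Actions. -/
inductive Act
  | tau
  | send (c : Chan) (v : Value)
  | recv (c : Chan) (v : Value)

/-- The channel of a visible action. -/
def Act.chan : Act → Option Chan
  | .tau => none
  | .send c _ => some c
  | .recv c _ => some c

/-- Schedulers: a tag, or a pair of tags for a synchronization. -/
inductive Sched
  | one (t : ℕ)
  | two (t t' : ℕ)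

/-- Configurations over the quantum register `S`. -/
abbrev Conf (S : Finset ℕ) : Type := Density S × Proc

/-- The transitions of configurations over the register `S`: `CStep ρ P μ s Δ` is the transition
of `⟨ρ, P⟩` to `Δ` with action `μ` and scheduler `s`. In `meas`, `p m` is the probability of the
outcome `m` and `ρ' m` the normalized state after it. -/
inductive CStep {S : Finset ℕ} : Density S → Proc → Act → Sched → (Conf S →₀ ℝ≥0) → Prop
  | tau {ρ : Density S} {t : ℕ} {P : Proc} :
      CStep ρ (.tau t P) .tau (.one t) (Finsupp.single (ρ, P) 1)
  | tauSynch {ρ : Density S} {t t' : ℕ} {P : Proc} :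
      CStep ρ (.tauPair t t' P) .tau (.two t t') (Finsupp.single (ρ, P) 1)
  | sop {ρ : Density S} {t n : ℕ} {E : SuperOp n} {es : Fin n → Expr} {P : Proc}
      (q : Fin n ↪ S) (hq : ∀ i, es i = .qubit (q i))
      (ρ' : Density S) (hρ' : ρ'.1 = E.apply q ρ.1) :
      CStep ρ (.sop t E es P) .tau (.one t) (Finsupp.single (ρ', P) 1)
  | meas {ρ : Density S} {t n : ℕ} {M : Measurement n} {es : Fin n → Expr} {x : Var} {P : Proc}
      (q : Fin n ↪ S) (hq : ∀ i, es i = .qubit (q i))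
      (p : Fin M.k → ℝ≥0) (hp : ∀ m, ((p m : ℝ) : ℂ) = (M.apply m q ρ.1).trace)
      (ρ' : Fin M.k → Density S) (hρ' : ∀ m, ((p m : ℝ) : ℂ) • (ρ' m).1 = M.apply m q ρ.1) :
      CStep ρ (.meas t M es x P) .tau (.one t)
        (∑ m : Fin M.k, Finsupp.single (ρ' m, P.subst x (.nat (m : ℕ))) (p m))
  | send {ρ : Density S} {t : ℕ} {c : Chan} {e : Expr} {P : Proc} {v : Value}
      (he : e.eval = some v) :
      CStep ρ (.send t c e P) (.send c v) (.one t) (Finsupp.single (ρ, P) 1)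
  | recv {ρ : Density S} {t : ℕ} {c : Chan} {x : Var} {P : Proc} {v : Value}
      (hv : v.ty = c.ty)
      (hq : ∀ q, v = .qubit q → q ∈ S ∧ (Proc.recv t c x P).NotOwns q) :
      CStep ρ (.recv t c x P) (.recv c v) (.one t) (Finsupp.single (ρ, P.subst x v) 1)
  | iteT {ρ : Density S} {e : Expr} {P Q : Proc} {μ : Act} {s : Sched} {Δ : Conf S →₀ ℝ≥0}
      (he : e.eval = some (.bool true)) :
      CStep ρ P μ s Δ → CStep ρ (.ite e P Q) μ s Δ
  | iteF {ρ : Density S} {e : Expr} {P Q : Proc} {μ : Act} {s : Sched} {Δ : Conf S →₀ ℝ≥0}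
      (he : e.eval = some (.bool false)) :
      CStep ρ Q μ s Δ → CStep ρ (.ite e P Q) μ s Δ
  | sumL {ρ : Density S} {P Q : Proc} {μ : Act} {s : Sched} {Δ : Conf S →₀ ℝ≥0} :
      CStep ρ P μ s Δ → CStep ρ (.sum P Q) μ s Δ
  | sumR {ρ : Density S} {P Q : Proc} {μ : Act} {s : Sched} {Δ : Conf S →₀ ℝ≥0} :
      CStep ρ Q μ s Δ → CStep ρ (.sum P Q) μ s Δ
  | parL {ρ : Density S} {P Q : Proc} {μ : Act} {s : Sched} {Δ : Conf S →₀ ℝ≥0}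
      (hμ : ∀ c q, μ = .recv c (.qubit q) → Q.NotOwns q) :
      CStep ρ P μ s Δ →
      CStep ρ (.par P Q) μ s (Δ.mapDomain fun C => (C.1, .par C.2 Q))
  | parR {ρ : Density S} {P Q : Proc} {μ : Act} {s : Sched} {Δ : Conf S →₀ ℝ≥0}
      (hμ : ∀ c q, μ = .recv c (.qubit q) → P.NotOwns q) :
      CStep ρ Q μ s Δ →
      CStep ρ (.par P Q) μ s (Δ.mapDomain fun C => (C.1, .par P C.2))
  | synchL {ρ : Density S} {P Q P' Q' : Proc} {c : Chan} {v : Value} {t t' : ℕ} :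
      CStep ρ P (.send c v) (.one t) (Finsupp.single (ρ, P') 1) →
      CStep ρ Q (.recv c v) (.one t') (Finsupp.single (ρ, Q') 1) →
      CStep ρ (.par P Q) .tau (.two t t') (Finsupp.single (ρ, .par P' Q') 1)
  | synchR {ρ : Density S} {P Q P' Q' : Proc} {c : Chan} {v : Value} {t t' : ℕ} :
      CStep ρ P (.recv c v) (.one t) (Finsupp.single (ρ, P') 1) →
      CStep ρ Q (.send c v) (.one t') (Finsupp.single (ρ, Q') 1) →
      CStep ρ (.par P Q) .tau (.two t t') (Finsupp.single (ρ, .par P' Q') 1)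
  | restr {ρ : Density S} {P : Proc} {c : Chan} {μ : Act} {s : Sched} {Δ : Conf S →₀ ℝ≥0}
      (hμ : μ.chan ≠ some c) :
      CStep ρ P μ s Δ →
      CStep ρ (.restr P c) μ s (Δ.mapDomain fun C => (C.1, .restr C.2 c))

/-- Transitions of configurations, where a configuration that cannot move with the given action
and scheduler evolves to the empty distribution. -/
def CStepBot {S : Finset ℕ} (μ : Act) (s : Sched) (C : Conf S) (Θ : SDist (Conf S)) : Prop :=
  CStep C.1 C.2 μ s Θ.1 ∨ (Θ.1 = 0 ∧ ∀ Δ, ¬ CStep C.1 C.2 μ s Δ)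

/-- The scheduled transition relation between distributions of configurations. -/
def DStep {S : Finset ℕ} (Δ : SDist (Conf S)) (μ : Act) (s : Sched) (Θ : SDist (Conf S)) : Prop :=
  Lift (CStepBot μ s) Δ Θ

/-- In every state, and for every scheduler, `P` has at most one transition, up to the received
value. -/
def Proc.StepDeterministic (P : Proc) : Prop :=
  ∀ (S G : Finset ℕ) (ρ : Density S), P.HasType G → G ⊆ S →
    ∀ (s : Sched) (μ μ' : Act) (Δ Δ' : Conf S →₀ ℝ≥0),
      CStep ρ P μ s Δ → CStep ρ P μ' s Δ' →
      (μ = μ' ∧ Δ = Δ') ∨ (μ ≠ μ' ∧ ∃ c v v', μ = .recv c v ∧ μ' = .recv c v')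

/-- `P'` is reached from `P` in one transition, from some state of some register. -/
def Proc.Derivative (P P' : Proc) : Prop :=
  ∃ (S G : Finset ℕ) (ρ ρ' : Density S) (μ : Act) (s : Sched) (Δ : Conf S →₀ ℝ≥0),
    P.HasType G ∧ G ⊆ S ∧ CStep ρ P μ s Δ ∧ (ρ', P') ∈ Δ.support

/-- Deterministic tagging: `P` and all the processes it can evolve to have at most one transition
for each scheduler, up to the received value. -/
def Proc.Deterministic (P : Proc) : Prop :=
  ∀ P', Relation.ReflTransGen Proc.Derivative P P' → P'.StepDeterministic

/-! ### Scheduled saturated bisimilarity -/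

/-- `(S, G) ⊢ Δ`. -/
def DistTyped {S : Finset ℕ} (G : Finset ℕ) (Δ : SDist (Conf S)) : Prop :=
  G ⊆ S ∧ ∀ C ∈ Δ.1.support, C.2.HasType G

/-- Contexts: the hole, or the hole in parallel with a process. -/
inductive Context
  | hole
  | par (R : Proc)

def Context.fill : Context → Proc → Proc
  | .hole, P => P
  | .par R, P => .par P R

def Context.tags : Context → Finset ℕ
  | .hole => ∅
  | .par R => R.tags

/-- `B.HasType G G'` means that `B`, filled with a process of type `G`, has type `G'`. The process
in the context is deterministic, like all processes. -/
def Context.HasType : Context → Finset ℕ → Finset ℕ → Prop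
  | .hole, G, G' => G' = G
  | .par R, G, G' => G ⊆ G' ∧ R.HasType (G' \ G) ∧ R.Deterministic

/-- The context `B`, with input type `G` and output type `G'`, is compatible with `Δ`. -/
def Context.Compatible {S : Finset ℕ} (B : Context) (G G' : Finset ℕ) (Δ : SDist (Conf S)) :
    Prop :=
  B.HasType G G' ∧ DistTyped G Δ ∧ G' ⊆ S ∧ ∀ C ∈ Δ.1.support, Disjoint C.2.tags B.tags

/-- The application of a context to the processes of a distribution. -/
noncomputable def Context.apply {S : Finset ℕ} (B : Context) (Δ : SDist (Conf S)) :
    SDist (Conf S) :=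
  Δ.map fun C => (C.1, B.fill C.2)

structure IsScheduledSaturatedBisimulation {S : Finset ℕ}
    (R : SDist (Conf S) → SDist (Conf S) → Prop) : Prop where
  wellTyped : ∀ Δ Θ, R Δ Θ → ∃ G, DistTyped G Δ ∧ DistTyped G Θ
  mass_eq : ∀ Δ Θ, R Δ Θ → mass Δ.1 = mass Θ.1
  forth : ∀ Δ Θ, R Δ Θ → ∀ (B : Context) (G G' : Finset ℕ),
    B.Compatible G G' Δ → B.Compatible G G' Θ → ∀ (s : Sched) (Δ' : SDist (Conf S)),
    DStep (B.apply Δ) .tau s Δ' → ∃ Θ', DStep (B.apply Θ) .tau s Θ' ∧ R Δ' Θ'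
  back : ∀ Δ Θ, R Δ Θ → ∀ (B : Context) (G G' : Finset ℕ),
    B.Compatible G G' Δ → B.Compatible G G' Θ → ∀ (s : Sched) (Θ' : SDist (Conf S)),
    DStep (B.apply Θ) .tau s Θ' → ∃ Δ', DStep (B.apply Δ) .tau s Δ' ∧ R Δ' Θ'

/-- Scheduled saturated bisimilarity, the largest scheduled saturated bisimulation. -/
def ScheduledSaturatedBisimilar {S : Finset ℕ} (Δ Θ : SDist (Conf S)) : Prop :=
  ∃ R, IsScheduledSaturatedBisimulation R ∧ R Δ Θ

/-! ### Density operator semantics -/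

/-- Quantum distributions of processes over the register `S`: finitely many processes, weighted
by partial density operators of total trace at most one. -/
def QDist (S : Finset ℕ) : Type :=
  {D : Proc →₀ Op S // (∀ P, (D P).PosSemidef) ∧ ∑ P ∈ D.support, (D P).trace.re ≤ 1}

/-- The quantum distribution `ρ • P`. -/
noncomputable def QDist.point {S : Finset ℕ} (ρ : Density S) (P : Proc) : QDist S :=
  ⟨Finsupp.single P ρ.1, by
    classical
    refine ⟨fun Q => ?_, ?_⟩
    · rw [Finsupp.single_apply]
      split_ifs
      · exact ρ.2.1
      · exact Matrix.PosSemidef.zero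
    · refine le_trans (Finset.sum_le_sum_of_subset_of_nonneg Finsupp.support_single_subset ?_) ?_
      · intro Q hQ _
        rw [Finset.mem_singleton.1 hQ, Finsupp.single_eq_same, ρ.2.2]
        simp
      · rw [Finset.sum_singleton, Finsupp.single_eq_same, ρ.2.2]
        simp⟩

/-- The transitions of quantum distributions with a single process: `QCStep ρ P μ s D` is the
transition of `ρ • P` to `D` with action `μ` and scheduler `s`. -/
inductive QCStep {S : Finset ℕ} : Op S → Proc → Act → Sched → (Proc →₀ Op S) → Prop
  | tau {ρ : Op S} {t : ℕ} {P : Proc} :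
      QCStep ρ (.tau t P) .tau (.one t) (Finsupp.single P ρ)
  | tauSynch {ρ : Op S} {t t' : ℕ} {P : Proc} :
      QCStep ρ (.tauPair t t' P) .tau (.two t t') (Finsupp.single P ρ)
  | sop {ρ : Op S} {t n : ℕ} {E : SuperOp n} {es : Fin n → Expr} {P : Proc}
      (q : Fin n ↪ S) (hq : ∀ i, es i = .qubit (q i)) :
      QCStep ρ (.sop t E es P) .tau (.one t) (Finsupp.single P (E.apply q ρ))
  | meas {ρ : Op S} {t n : ℕ} {M : Measurement n} {es : Fin n → Expr} {x : Var} {P : Proc}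
      (q : Fin n ↪ S) (hq : ∀ i, es i = .qubit (q i)) :
      QCStep ρ (.meas t M es x P) .tau (.one t)
        (∑ m : Fin M.k, Finsupp.single (P.subst x (.nat (m : ℕ))) (M.apply m q ρ))
  | send {ρ : Op S} {t : ℕ} {c : Chan} {e : Expr} {P : Proc} {v : Value}
      (he : e.eval = some v) :
      QCStep ρ (.send t c e P) (.send c v) (.one t) (Finsupp.single P ρ)
  | recv {ρ : Op S} {t : ℕ} {c : Chan} {x : Var} {P : Proc} {v : Value}
      (hv : v.ty = c.ty)
      (hq : ∀ q, v = .qubit q → q ∈ S ∧ (Proc.recv t c x P).NotOwns q) :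
      QCStep ρ (.recv t c x P) (.recv c v) (.one t) (Finsupp.single (P.subst x v) ρ)
  | iteT {ρ : Op S} {e : Expr} {P Q : Proc} {μ : Act} {s : Sched} {D : Proc →₀ Op S}
      (he : e.eval = some (.bool true)) :
      QCStep ρ P μ s D → QCStep ρ (.ite e P Q) μ s D
  | iteF {ρ : Op S} {e : Expr} {P Q : Proc} {μ : Act} {s : Sched} {D : Proc →₀ Op S}
      (he : e.eval = some (.bool false)) :
      QCStep ρ Q μ s D → QCStep ρ (.ite e P Q) μ s D
  | sumL {ρ : Op S} {P Q : Proc} {μ : Act} {s : Sched} {D : Proc →₀ Op S} :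
      QCStep ρ P μ s D → QCStep ρ (.sum P Q) μ s D
  | sumR {ρ : Op S} {P Q : Proc} {μ : Act} {s : Sched} {D : Proc →₀ Op S} :
      QCStep ρ Q μ s D → QCStep ρ (.sum P Q) μ s D
  | parL {ρ : Op S} {P Q : Proc} {μ : Act} {s : Sched} {D : Proc →₀ Op S}
      (hμ : ∀ c q, μ = .recv c (.qubit q) → Q.NotOwns q) :
      QCStep ρ P μ s D → QCStep ρ (.par P Q) μ s (D.mapDomain fun P' => .par P' Q)
  | parR {ρ : Op S} {P Q : Proc} {μ : Act} {s : Sched} {D : Proc →₀ Op S}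
      (hμ : ∀ c q, μ = .recv c (.qubit q) → P.NotOwns q) :
      QCStep ρ Q μ s D → QCStep ρ (.par P Q) μ s (D.mapDomain fun Q' => .par P Q')
  | synchL {ρ : Op S} {P Q P' Q' : Proc} {c : Chan} {v : Value} {t t' : ℕ} :
      QCStep ρ P (.send c v) (.one t) (Finsupp.single P' ρ) →
      QCStep ρ Q (.recv c v) (.one t') (Finsupp.single Q' ρ) →
      QCStep ρ (.par P Q) .tau (.two t t') (Finsupp.single (.par P' Q') ρ)
  | synchR {ρ : Op S} {P Q P' Q' : Proc} {c : Chan} {v : Value} {t t' : ℕ} :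
      QCStep ρ P (.recv c v) (.one t) (Finsupp.single P' ρ) →
      QCStep ρ Q (.send c v) (.one t') (Finsupp.single Q' ρ) →
      QCStep ρ (.par P Q) .tau (.two t t') (Finsupp.single (.par P' Q') ρ)
  | restr {ρ : Op S} {P : Proc} {c : Chan} {μ : Act} {s : Sched} {D : Proc →₀ Op S}
      (hμ : μ.chan ≠ some c) :
      QCStep ρ P μ s D → QCStep ρ (.restr P c) μ s (D.mapDomain fun P' => .restr P' c)

/-- The transition relation of quantum distributions. The deadlock rule applies to distributions
`ρ • P` with a single process. -/
inductive QStep {S : Finset ℕ} : QDist S → Act → Sched → QDist S → Prop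
  | id {D D' : QDist S} {ρ : Op S} {P : Proc} {μ : Act} {s : Sched}
      (hD : D.1 = Finsupp.single P ρ) : QCStep ρ P μ s D'.1 → QStep D μ s D'
  | not {D D' : QDist S} {ρ : Op S} {P : Proc} {μ : Act} {s : Sched}
      (hD : D.1 = Finsupp.single P ρ) (hD' : D'.1 = 0) :
      (∀ T, ¬ QCStep ρ P μ s T) → QStep D μ s D'
  | conv {D T D' T' U U' : QDist S} {μ : Act} {s : Sched}
      (hU : U.1 = D.1 + T.1) (hU' : U'.1 = D'.1 + T'.1) :
      QStep D μ s D' → QStep T μ s T' → QStep U μ s U'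

/-! ### Labelled ground scheduled bisimilarity -/

/-- `(S, G) ⊢ D`. -/
def QTyped {S : Finset ℕ} (G : Finset ℕ) (D : QDist S) : Prop :=
  G ⊆ S ∧ ∀ P ∈ D.1.support, P.HasType G

/-- The environment of a quantum distribution of type `(S, G)`: the state of the qubits that its
processes do not own. It is zero for the empty distribution, whatever `G` is. -/
noncomputable def QDist.env {S : Finset ℕ} (G : Finset ℕ) (D : QDist S) :
    Op {q : S // ¬ q.1 ∈ G} :=
  partialTrace G (∑ P ∈ D.1.support, D.1 P)

structure IsGroundBisimulation {S : Finset ℕ} (R : QDist S → QDist S → Prop) : Prop where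
  wellTyped : ∀ D T, R D T → ∃ G, QTyped G D ∧ QTyped G T
  forth : ∀ D T, R D T → ∀ (μ : Act) (s : Sched) (D' : QDist S),
    QStep D μ s D' → ∃ T', QStep T μ s T' ∧ R D' T'
  back : ∀ D T, R D T → ∀ (μ : Act) (s : Sched) (T' : QDist S),
    QStep T μ s T' → ∃ D', QStep D μ s D' ∧ R D' T'
  env_eq : ∀ D T, R D T → ∀ G, QTyped G D → QTyped G T → D.env G = T.env G

/-- Labelled ground scheduled bisimilarity, the largest labelled ground scheduled bisimulation. -/
def GroundBisimilar {S : Finset ℕ} (D T : QDist S) : Prop :=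
  ∃ R, IsGroundBisimulation R ∧ R D T

end LqCCS

/-! Determinism turns both semantics into one linear dynamical system. A process has, for a fixed
action and scheduler, at most one transition, and the weights of its targets depend linearly on the
state. So transitions of finitely supported families of operators ("quantum vectors") are given by a
linear operator `stepV μ s`, which is zero where the process is stuck. `QStep.eq_stepV` and
`DStep.qC_eq` show that the transitions of quantum distributions and of distributions of
configurations are both this operator, the latter after `qC` has merged probabilities and density
operators. As stuck processes move to the empty distribution, a transition always exists.
Bisimilarity thus becomes a statement about what can be observed along sequences of steps, and the
difference of two vectors can be studied instead of the pair.

From ground to saturated: `groundFamily` consists of the differences whose environment vanishes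
after every sequence of labelled steps. It is stable under steps, and under operators on qubits that
the processes do not own, because these commute with all later steps (`nullAfter_conj`). Input
restriction matters here: the owned set can only shrink, so such an operator stays off it. Any
family of subspaces with these properties (`ClosedFamily`) generates another one by parallel
composition with processes R (`ClosedFamily.par`): a step of the composite is a step of the left
component, an operation of R on qubits outside the left one, or a synchronization. Hence having a
difference in a closed family is a scheduled saturated bisimulation.

From saturated to ground: only mass is directly observable, so observers must turn environments and
labels into mass. An observer that measures one qubit with a projection p and its complement, and
deadlocks on the wrong outcome, replaces the vector by its image under p. Products of such
projections span the operators on the environment (`partialTrace_eq_of_isProj`), so equal masses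
give equal environments. Observers with fresh tags that send a value, or receive one and compare it,
simulate labels. A finished observer remains as an inert `Frame` and keeps the qubit it measured, so
a qubit is measured only once. For this reason the invariant `Probed` quantifies over all product
projections in advance. Measurements made earlier commute with later steps, and a qubit that is sent
out is measured on arrival (`Framed.send_qubit`). -/

set_option linter.unusedSectionVars false

namespace LqCCS

/-! ### Local operators -/

section Local

variable {ι κ : Type} [Fintype ι] [DecidableEq ι] [Fintype κ] [DecidableEq κ]

/-- `embed`, for arbitrary index types. -/
def embedG (q : ι ↪ κ) (K : Op ι) : Op κ :=
  fun a b =>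
    open Classical in
    if ∀ r, r ∉ Set.range q → a r = b r then K (a ∘ q) (b ∘ q) else 0

theorem embed_eq_embedG {S : Finset ℕ} {n : ℕ} (q : Fin n ↪ S) (K : Op (Fin n)) :
    embed q K = embedG q K := rfl

/-- Splitting a basis vector into the part on the range of `q` and the rest. -/
noncomputable def splitEquiv (q : ι ↪ κ) :
    (κ → Fin 2) ≃ (ι → Fin 2) × ({r // r ∉ Set.range q} → Fin 2) :=
  Equiv.ofBijective (fun a => (a ∘ q, fun r => a r.1)) (by
    classical
    constructor
    · intro a b h
      simp only [Prod.mk.injEq] at h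
      funext r
      by_cases hr : r ∈ Set.range q
      · obtain ⟨i, rfl⟩ := hr
        exact congrFun h.1 i
      · exact congrFun h.2 ⟨r, hr⟩
    · rintro ⟨u, v⟩
      refine ⟨fun r => if h : r ∈ Set.range q then u h.choose else v ⟨r, h⟩, ?_⟩
      ext i
      · have h : q i ∈ Set.range q := ⟨i, rfl⟩
        have h2 : h.choose = i := q.injective h.choose_spec
        simp only [Function.comp, dif_pos h, h2]
      · simp only [dif_neg i.2])

/-- Up to reordering tensor factors, the embedding is K ⊗ 1. The algebraic rules for `embedG` are
thereby inherited from the Kronecker product. -/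
theorem embedG_eq (q : ι ↪ κ) (K : Op ι) :
    open Classical in
    embedG q K = (Matrix.kronecker K (1 : Matrix ({r // r ∉ Set.range q} → Fin 2) _ ℂ)).submatrix
      (splitEquiv q) (splitEquiv q) := by
  classical
  ext a b
  simp only [embedG, splitEquiv, Matrix.submatrix_apply, Matrix.kronecker,
    Matrix.kroneckerMap_apply, Matrix.one_apply, funext_iff,
    Subtype.forall, mul_ite, mul_one, mul_zero]
  rfl

theorem embedG_mul (q : ι ↪ κ) (K L : Op ι) : embedG q (K * L) = embedG q K * embedG q L := by
  classical
  rw [embedG_eq, embedG_eq, embedG_eq, Matrix.submatrix_mul_equiv]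
  simp only [Matrix.kronecker, ← Matrix.mul_kronecker_mul, mul_one]

theorem embedG_one (q : ι ↪ κ) : embedG q (1 : Op ι) = 1 := by
  classical
  rw [embedG_eq]
  simp [Matrix.kronecker]

theorem embedG_conjTranspose (q : ι ↪ κ) (K : Op ι) : embedG q Kᴴ = (embedG q K)ᴴ := by
  classical
  ext a b
  simp only [embedG, Matrix.conjTranspose_apply]
  by_cases h : ∀ r, r ∉ Set.range q → a r = b r
  · rw [if_pos h, if_pos (fun r hr => (h r hr).symm)]
  · rw [if_neg h, if_neg (fun h' => h fun r hr => (h' r hr).symm), star_zero]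

theorem embedG_zero (q : ι ↪ κ) : embedG q (0 : Op ι) = 0 := by
  ext a b
  simp [embedG]

theorem embedG_add (q : ι ↪ κ) (K L : Op ι) : embedG q (K + L) = embedG q K + embedG q L := by
  classical
  ext a b
  simp only [embedG, Matrix.add_apply]
  split_ifs <;> simp

theorem embedG_sum {α : Type*} (q : ι ↪ κ) (s : Finset α) (K : α → Op ι) :
    embedG q (∑ i ∈ s, K i) = ∑ i ∈ s, embedG q (K i) := by
  classical
  induction s using Finset.induction_on with
  | empty => simp [embedG_zero]
  | insert a s ha ih => rw [Finset.sum_insert ha, Finset.sum_insert ha, embedG_add, ih]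

theorem embedG_trans {θ : Type} [Fintype θ] [DecidableEq θ] (q : θ ↪ ι) (q' : ι ↪ κ) (K : Op θ) :
    embedG (q.trans q') K = embedG q' (embedG q K) := by
  classical
  ext a b
  simp only [embedG, Set.mem_range, Function.Embedding.trans_apply, not_exists, Function.comp]
  -- The indices missed by the composite are those missed by `q'` and the `q'`-images of those
  -- missed by `q`, so the two "identity elsewhere" conditions add up to one.
  have key : (∀ r, (∀ i, ¬ q' (q i) = r) → a r = b r) ↔
      (∀ r, (∀ i, ¬ q' i = r) → a r = b r) ∧ ∀ j, (∀ i, ¬ q i = j) → a (q' j) = b (q' j) := by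
    constructor
    · intro h
      exact ⟨fun r hr => h r fun i => hr (q i),
        fun j hj => h _ fun i hi => hj i (q'.injective hi)⟩
    · rintro ⟨h1, h2⟩ r hr
      by_cases hr' : ∀ i, ¬ q' i = r
      · exact h1 r hr'
      · push Not at hr'
        obtain ⟨j, rfl⟩ := hr'
        exact h2 j fun i hi => hr i (by rw [hi])
  by_cases h1 : ∀ r, (∀ i, ¬ q' i = r) → a r = b r
  · rw [if_pos h1]
    by_cases h2 : ∀ j, (∀ i, ¬ q i = j) → a (q' j) = b (q' j)
    · rw [if_pos h2, if_pos (key.2 ⟨h1, h2⟩)]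
      rfl
    · rw [if_neg h2, if_neg fun h => h2 (key.1 h).2]
  · rw [if_neg h1, if_neg fun h => h1 (key.1 h).1]

/-- `N` acts on the indices that satisfy `p`, and as the identity on the others. -/
def Acts (p : κ → Prop) [DecidablePred p] (N : Op κ) : Prop :=
  ∃ K : Op {r // p r}, N = embedG (Function.Embedding.subtype p) K

namespace Acts

variable {p : κ → Prop} [DecidablePred p]

theorem one : Acts p (1 : Op κ) := ⟨1, (embedG_one _).symm⟩

theorem mul {N N' : Op κ} : Acts p N → Acts p N' → Acts p (N * N') := by
  rintro ⟨K, rfl⟩ ⟨K', rfl⟩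
  exact ⟨K * K', (embedG_mul _ _ _).symm⟩

theorem star {N : Op κ} : Acts p N → Acts p Nᴴ := by
  rintro ⟨K, rfl⟩
  exact ⟨Kᴴ, (embedG_conjTranspose _ _).symm⟩

theorem of_embedG (q : ι ↪ κ) (hq : ∀ i, p (q i)) (K : Op ι) : Acts p (embedG q K) :=
  ⟨embedG ⟨fun i => ⟨q i, hq i⟩, fun i j h => q.injective (congrArg Subtype.val h)⟩ K, by
    rw [← embedG_trans]; rfl⟩

theorem mono {p' : κ → Prop} [DecidablePred p'] (h : ∀ r, p r → p' r) {N : Op κ} :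
    Acts p N → Acts p' N := by
  rintro ⟨K, rfl⟩
  exact of_embedG _ (fun i => h _ i.2) K

end Acts

/-- The splitting of basis vectors according to a predicate. -/
abbrev predEquiv (p : κ → Prop) [DecidablePred p] :
    (κ → Fin 2) ≃ ({r // p r} → Fin 2) × ({r // ¬ p r} → Fin 2) :=
  Equiv.piEquivPiSubtypeProd p (fun _ => Fin 2)

theorem embedG_subtype (p : κ → Prop) [DecidablePred p] (K : Op {r // p r}) :
    embedG (Function.Embedding.subtype p) K =
      (Matrix.kronecker K (1 : Op {r // ¬ p r})).submatrix (predEquiv p) (predEquiv p) := by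
  classical
  ext a b
  simp only [embedG, Matrix.submatrix_apply, Matrix.kronecker, Matrix.kroneckerMap_apply,
    Matrix.one_apply, funext_iff, Subtype.forall, mul_ite, mul_one, mul_zero, predEquiv,
    Equiv.piEquivPiSubtypeProd, Equiv.coe_fn_mk, Subtype.range_coe_subtype,
    Set.mem_ofPred_eq, Function.Embedding.coe_subtype]
  rfl

theorem embedG_subtype_not (p : κ → Prop) [DecidablePred p] (K : Op {r // ¬ p r}) :
    embedG (Function.Embedding.subtype fun r => ¬ p r) K =
      (Matrix.kronecker (1 : Op {r // p r}) K).submatrix (predEquiv p) (predEquiv p) := by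
  classical
  ext a b
  simp only [embedG, Matrix.submatrix_apply, Matrix.kronecker, Matrix.kroneckerMap_apply,
    Matrix.one_apply, funext_iff, Subtype.forall, ite_mul, one_mul, zero_mul, predEquiv,
    Equiv.piEquivPiSubtypeProd, Equiv.coe_fn_mk, Subtype.range_coe_subtype,
    Set.mem_ofPred_eq, Function.Embedding.coe_subtype, not_not]
  rfl

/-- Disjointness allows `p'` to be enlarged to the complement of `p`. The operators then read K ⊗ 1
and 1 ⊗ K', and both products are K ⊗ K'. -/
theorem Acts.commute {p p' : κ → Prop} [DecidablePred p] [DecidablePred p']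
    (h : ∀ r, p r → ¬ p' r) {N N' : Op κ} (hN : Acts p N) (hN' : Acts p' N') :
    N * N' = N' * N := by
  classical
  obtain ⟨K, rfl⟩ := hN
  obtain ⟨K', rfl⟩ := hN'.mono (p' := fun r => ¬ p r) fun r hr hp => h r hp hr
  rw [embedG_subtype, embedG_subtype_not, Matrix.submatrix_mul_equiv, Matrix.submatrix_mul_equiv]
  simp only [Matrix.kronecker, ← Matrix.mul_kronecker_mul, mul_one, one_mul]

end Local

/-! ### Environments -/

variable {S : Finset ℕ}

/-- Operators that act on the qubits in `G`. -/
abbrev On (G : Finset ℕ) (N : Op S) : Prop := Acts (fun r : S => r.1 ∈ G) N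

/-- Operators that act on the qubits that are not in `G`. -/
abbrev Off (G : Finset ℕ) (N : Op S) : Prop := Acts (fun r : S => ¬ r.1 ∈ G) N

/-- The partial trace is the adjoint of N ↦ 1 ⊗ N for the trace pairing. -/
theorem trace_embedG_mul (G : Finset ℕ) (N : Op {r : S // ¬ r.1 ∈ G}) (X : Op S) :
    (embedG (Function.Embedding.subtype fun r : S => ¬ r.1 ∈ G) N * X).trace =
      (N * partialTrace G X).trace := by
  classical
  set e := predEquiv (fun r : S => r.1 ∈ G) with he
  have hX : X = (X.submatrix e.symm e.symm).submatrix e e := by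
    simp [Matrix.submatrix_submatrix]
  rw [embedG_subtype_not]
  conv_lhs => rw [hX]
  rw [Matrix.submatrix_mul_equiv]
  simp only [Matrix.trace, Matrix.diag, Matrix.submatrix_apply, Matrix.mul_apply]
  rw [Equiv.sum_comp e (fun x => ∑ y, Matrix.kronecker 1 N x y * X (e.symm y) (e.symm x))]
  simp only [Fintype.sum_prod_type, Matrix.kronecker, Matrix.kroneckerMap_apply, Matrix.one_apply,
    ite_mul, one_mul, zero_mul, Finset.sum_ite_irrel, Finset.sum_const_zero, Finset.sum_ite_eq,
    Finset.mem_univ, if_true, partialTrace, Finset.mul_sum]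
  rw [Finset.sum_comm]
  refine Finset.sum_congr rfl fun a _ => ?_
  rw [Finset.sum_comm]

/-- Nondegeneracy of the trace pairing on the environment. Equality of environments becomes a family
of linear conditions, which can be imposed on differences of vectors. -/
theorem partialTrace_eq_iff {G : Finset ℕ} {X Y : Op S} :
    partialTrace G X = partialTrace G Y ↔
      ∀ N : Op S, Off G N → (N * X).trace = (N * Y).trace := by
  rw [Matrix.ext_iff_trace_mul_left]
  constructor
  · rintro h _ ⟨K, rfl⟩
    rw [trace_embedG_mul, trace_embedG_mul, h]
  · intro h K
    rw [← trace_embedG_mul, ← trace_embedG_mul, h _ ⟨K, rfl⟩]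

/-! ### Product operators and tomography -/

/-- The tensor product of one operator for each qubit. -/
def prodOp (p : S → Matrix (Fin 2) (Fin 2) ℂ) : Op S := fun a b => ∏ q, p q (a q) (b q)

theorem prodOp_mul (p p' : S → Matrix (Fin 2) (Fin 2) ℂ) :
    prodOp p * prodOp p' = prodOp fun q => p q * p' q := by
  ext a b
  simp only [Matrix.mul_apply, prodOp, ← Finset.prod_mul_distrib]
  exact (Fintype.prod_sum fun (q : S) (c : Fin 2) => p q (a q) c * p' q c (b q)).symm

theorem prodOp_conjTranspose (p : S → Matrix (Fin 2) (Fin 2) ℂ) :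
    (prodOp p)ᴴ = prodOp fun q => (p q)ᴴ := by
  ext a b
  simp [prodOp, Matrix.conjTranspose_apply]

theorem prodOp_one : prodOp (fun _ : S => 1) = (1 : Op S) := by
  ext a b
  simp only [prodOp, Matrix.one_apply]
  by_cases h : a = b
  · simp [h]
  · rw [if_neg h]
    obtain ⟨q, hq⟩ := Function.ne_iff.1 h
    exact Finset.prod_eq_zero (Finset.mem_univ q) (if_neg hq)

/-- Operators on one qubit, indexed by functions on `Fin 1`. -/
def single1 (m : Matrix (Fin 2) (Fin 2) ℂ) : Op (Fin 1) := fun a b => m (a 0) (b 0)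

theorem embed_single1 (q : Fin 1 ↪ S) (m : Matrix (Fin 2) (Fin 2) ℂ) :
    embed q (single1 m) = prodOp (Function.update (fun _ => 1) (q 0) m) := by
  classical
  ext a b
  have hr : ∀ r, r ∉ Set.range q ↔ r ≠ q 0 := by
    intro r
    constructor
    · rintro h rfl
      exact h ⟨0, rfl⟩
    · rintro h ⟨i, rfl⟩
      exact h (by rw [Fin.fin_one_eq_zero i])
  simp only [embed, prodOp, hr, single1, Function.comp]
  rw [← Finset.mul_prod_erase _ _ (Finset.mem_univ (q 0)), Function.update_self]
  split_ifs with h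
  · rw [Finset.prod_eq_one, mul_one]
    intro r hr'
    rw [Function.update_of_ne (Finset.ne_of_mem_erase hr'), h r (Finset.ne_of_mem_erase hr'),
      Matrix.one_apply_eq]
  · push Not at h
    obtain ⟨r, h1, h2⟩ := h
    rw [Finset.prod_eq_zero (Finset.mem_erase.2 ⟨h1, Finset.mem_univ r⟩), mul_zero]
    rw [Function.update_of_ne h1, Matrix.one_apply_ne h2]

/-- Product operators are built up one qubit at a time, which is how successive one-qubit observers
realize them. -/
theorem embed_single1_mul_prodOp (q : Fin 1 ↪ S) (m : Matrix (Fin 2) (Fin 2) ℂ)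
    (p : S → Matrix (Fin 2) (Fin 2) ℂ) (hp : p (q 0) = 1) :
    embed q (single1 m) * prodOp p = prodOp (Function.update p (q 0) m) := by
  rw [embed_single1, prodOp_mul]
  congr 1
  funext r
  by_cases hr : r = q 0
  · subst hr; simp [hp]
  · simp [hr]

theorem off_prodOp (G : Finset ℕ) (p : S → Matrix (Fin 2) (Fin 2) ℂ)
    (hp : ∀ q : S, q.1 ∈ G → p q = 1) : Off G (prodOp p) := by
  classical
  refine ⟨fun a b => ∏ q, p q.1 (a q) (b q), ?_⟩
  ext a b
  simp only [prodOp, embedG]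
  rw [← Fintype.prod_subtype_mul_prod_subtype (fun r : S => ¬ r.1 ∈ G)]
  split_ifs with h
  · rw [Finset.prod_eq_one (s := (Finset.univ : Finset {r : S // ¬ ¬ r.1 ∈ G})), mul_one]
    · rfl
    · rintro ⟨r, hr⟩ _
      rw [not_not] at hr
      simp only [hp r hr]
      rw [h r, Matrix.one_apply_eq]
      simpa using hr
  · push Not at h
    obtain ⟨r, h1, h2⟩ := h
    have hr : r.1 ∈ G := by simpa using h1
    rw [Finset.prod_eq_zero (s := (Finset.univ : Finset {r : S // ¬ ¬ r.1 ∈ G}))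
      (Finset.mem_univ ⟨r, not_not.2 hr⟩), mul_zero]
    simp only [hp r hr, Matrix.one_apply_ne h2]

/-- Orthogonal projections on one qubit. -/
def IsProj (p : Matrix (Fin 2) (Fin 2) ℂ) : Prop := pᴴ = p ∧ p * p = p

theorem isProj_one : IsProj 1 := ⟨by simp, by simp⟩

/-- The identity, the projection onto |0⟩ and the projections onto the +1 eigenvectors of the Pauli
matrices X and Y form a basis of the 2 × 2 matrices. -/
theorem span_isProj : Submodule.span ℂ {p | IsProj p} = ⊤ := by
  rw [eq_top_iff]
  rintro m -
  have h1 : IsProj 1 := isProj_one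
  have h2 : IsProj !![1, 0; 0, 0] := by
    constructor
    · ext i j; fin_cases i <;> fin_cases j <;> simp
    · ext i j; fin_cases i <;> fin_cases j <;> simp [Matrix.mul_apply]
  have h3 : IsProj !![1/2, 1/2; 1/2, 1/2] := by
    constructor
    · ext i j; fin_cases i <;> fin_cases j <;> simp
    · ext i j; fin_cases i <;> fin_cases j <;> norm_num [Matrix.mul_apply]
  have h4 : IsProj !![1/2, -Complex.I/2; Complex.I/2, 1/2] := by
    constructor
    · ext i j; fin_cases i <;> fin_cases j <;> simp
    · ext i j; fin_cases i <;> fin_cases j <;> simp [Matrix.mul_apply] <;> ring_nf <;> 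
        norm_num [Complex.I_sq]
  -- Subtracting 1/2 from the last two projections leaves X/2 and Y/2; these carry the symmetric and
  -- the antisymmetric off-diagonal part of m.
  have hm : m = (m 0 0 - m 1 1) • !![1, 0; 0, 0] + m 1 1 • 1
      + (m 0 1 + m 1 0) • (!![1/2, 1/2; 1/2, 1/2] - (1/2 : ℂ) • 1)
      + ((m 0 1 - m 1 0) * Complex.I) • (!![1/2, -Complex.I/2; Complex.I/2, 1/2] - (1/2 : ℂ) • 1) := by
    ext i j
    fin_cases i <;> fin_cases j <;> simp <;> ring_nf <;> simp only [Complex.I_sq] <;> ring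
  rw [hm]
  have s1 := Submodule.subset_span (R := ℂ) (s := {p | IsProj p}) h1
  have s2 := Submodule.subset_span (R := ℂ) (s := {p | IsProj p}) h2
  have s3 := Submodule.subset_span (R := ℂ) (s := {p | IsProj p}) h3
  have s4 := Submodule.subset_span (R := ℂ) (s := {p | IsProj p}) h4
  exact add_mem (add_mem (add_mem (Submodule.smul_mem _ _ s2) (Submodule.smul_mem _ _ s1))
    (Submodule.smul_mem _ _ (sub_mem s3 (Submodule.smul_mem _ _ s1))))
    (Submodule.smul_mem _ _ (sub_mem s4 (Submodule.smul_mem _ _ s1)))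

/-- Evaluation of the product operator, with the factor of `q` variable, against `X`. -/
def prodOpTrace (p : S → Matrix (Fin 2) (Fin 2) ℂ) (q : S) (X : Op S) :
    Matrix (Fin 2) (Fin 2) ℂ →ₗ[ℂ] ℂ where
  toFun m := (prodOp (Function.update p q m) * X).trace
  map_add' m m' := by
    rw [← Matrix.trace_add, ← add_mul]
    congr 2
    ext a b
    simp only [prodOp, Matrix.add_apply]
    rw [← Finset.mul_prod_erase _ _ (Finset.mem_univ q), ← Finset.mul_prod_erase _ _ (Finset.mem_univ q),
      ← Finset.mul_prod_erase _ _ (Finset.mem_univ q)]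
    simp only [Function.update_self, Matrix.add_apply, add_mul]
    congr 2 <;> refine Finset.prod_congr rfl fun r hr => ?_ <;>
      simp [Function.update_of_ne (Finset.ne_of_mem_erase hr)]
  map_smul' c m := by
    rw [RingHom.id_apply, ← Matrix.trace_smul, ← smul_mul_assoc]
    congr 2
    ext a b
    simp only [prodOp, Matrix.smul_apply]
    rw [← Finset.mul_prod_erase _ _ (Finset.mem_univ q), ← Finset.mul_prod_erase _ _ (Finset.mem_univ q)]
    simp only [Function.update_self, Matrix.smul_apply, smul_eq_mul, mul_assoc]
    congr 2
    refine Finset.prod_congr rfl fun r hr => ?_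
    simp [Function.update_of_ne (Finset.ne_of_mem_erase hr)]

/-- Local tomography. The trace against a product operator is linear in each factor, and projections
span the one-qubit matrices, so projections may be exchanged for arbitrary matrices at one qubit
after another. Products of matrix units then read off the entries of the partial trace. -/
theorem partialTrace_eq_of_isProj {G : Finset ℕ} {X Y : Op S}
    (h : ∀ p : S → Matrix (Fin 2) (Fin 2) ℂ, (∀ q, IsProj (p q)) → (∀ q : S, q.1 ∈ G → p q = 1) →
      (prodOp p * X).trace = (prodOp p * Y).trace) :
    partialTrace G X = partialTrace G Y := by
  classical
  -- `A` is the set of qubits whose factor has already been freed from being a projection.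
  have key : ∀ (A : Finset S) (p : S → Matrix (Fin 2) (Fin 2) ℂ), (∀ q ∉ A, IsProj (p q)) →
      (∀ q : S, q.1 ∈ G → p q = 1) → (prodOp p * X).trace = (prodOp p * Y).trace := by
    intro A
    induction A using Finset.induction_on with
    | empty => exact fun p hp hG => h p (fun q => hp q (Finset.notMem_empty q)) hG
    | insert q A hq ih =>
      intro p hp hG
      by_cases hqG : q.1 ∈ G
      · refine ih p (fun r hr => ?_) hG
        by_cases hrq : r = q
        · rw [hrq, hG q hqG]; exact isProj_one
        · exact hp r (by simp [hrq, hr])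
      · have h1 : ∀ m : Matrix (Fin 2) (Fin 2) ℂ, prodOpTrace p q X m = prodOpTrace p q Y m := by
          intro m
          have hm : m ∈ Submodule.span ℂ {p | IsProj p} := by rw [span_isProj]; trivial
          induction hm using Submodule.span_induction with
          | mem m hm =>
            refine ih _ (fun r hr => ?_) fun r hr => ?_
            · by_cases hrq : r = q
              · subst hrq; simpa using hm
              · rw [Function.update_of_ne hrq]; exact hp r (by simp [hrq, hr])
            · rw [Function.update_of_ne (by rintro rfl; exact hqG hr)]; exact hG r hr
          | zero => simp
          | add x y _ _ hx hy => simp [hx, hy]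
          | smul c x _ hx => simp [hx]
        have := h1 (p q)
        simpa [prodOpTrace] using this
  ext a b
  -- The indices are swapped because the trace of the matrix unit at (b, a) times X is the entry of
  -- X at (a, b).
  let p : S → Matrix (Fin 2) (Fin 2) ℂ := fun q =>
    if hq : q.1 ∈ G then 1 else Matrix.single (b ⟨q, hq⟩) (a ⟨q, hq⟩) 1
  have hp : prodOp p = embedG (Function.Embedding.subtype fun r : S => ¬ r.1 ∈ G)
      (Matrix.single b a 1) := by
    ext u v
    simp only [prodOp, embedG]
    rw [← Fintype.prod_subtype_mul_prod_subtype (fun r : S => ¬ r.1 ∈ G)]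
    have e1 : ∏ i : {r : S // ¬ r.1 ∈ G}, p i.1 (u i) (v i) =
        Matrix.single b a (1 : ℂ) (fun r => u r.1) (fun r => v r.1) := by
      simp only [p]
      rw [Matrix.single_apply]
      split_ifs with hab
      · obtain ⟨rfl, rfl⟩ := hab
        refine Finset.prod_eq_one fun i _ => ?_
        rw [dif_neg i.2]
        simp
      · rw [not_and_or] at hab
        rcases hab with hab | hab
        · obtain ⟨i, hi⟩ := Function.ne_iff.1 hab
          refine Finset.prod_eq_zero (Finset.mem_univ i) ?_
          rw [dif_neg i.2, Matrix.single_apply_of_row_ne hi]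
        · obtain ⟨i, hi⟩ := Function.ne_iff.1 hab
          refine Finset.prod_eq_zero (Finset.mem_univ i) ?_
          rw [dif_neg i.2, Matrix.single_apply_of_col_ne _ _ hi]
    have e2 : ∏ i : {r : S // ¬ ¬ r.1 ∈ G}, p i.1 (u i) (v i) =
        if ∀ r : S, r ∉ Set.range (Function.Embedding.subtype fun r : S => ¬ r.1 ∈ G) → u r = v r
          then 1 else 0 := by
      split_ifs with huv
      · refine Finset.prod_eq_one fun i _ => ?_
        have hi := not_not.1 i.2
        simp only [p, dif_pos hi]
        rw [huv i (by simpa using hi), Matrix.one_apply_eq]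
      · push Not at huv
        obtain ⟨r, h1, h2⟩ := huv
        have hr : r.1 ∈ G := by simpa using h1
        refine Finset.prod_eq_zero (Finset.mem_univ ⟨r, not_not.2 hr⟩) ?_
        simp only [p, dif_pos hr, Matrix.one_apply_ne h2]
    rw [e1, e2, mul_ite, mul_one, mul_zero]
    rfl
  have := key Finset.univ p (fun q hq => absurd (Finset.mem_univ q) hq)
    (fun q hq => by simp only [p, dif_pos hq])
  rw [hp, trace_embedG_mul, trace_embedG_mul, Matrix.trace_single_mul, Matrix.trace_single_mul] at this
  simpa using this

/-! ### Density operators span -/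

theorem trace_pos_of_posSemidef {ι : Type*} [Fintype ι] [DecidableEq ι] {X : Matrix ι ι ℂ} (hX : X.PosSemidef)
    (h0 : X ≠ 0) : 0 < X.trace :=
  lt_of_le_of_ne hX.trace_nonneg fun h => h0 (hX.trace_eq_zero_iff.1 h.symm)

theorem exists_density_of_posSemidef {X : Op S} (hX : X.PosSemidef) (h0 : X ≠ 0) :
    ∃ (ρ : Density S) (c : ℝ), 0 < c ∧ (c : ℂ) = X.trace ∧ X = (c : ℂ) • ρ.1 := by
  have ht := trace_pos_of_posSemidef hX h0
  obtain ⟨c, hc⟩ : ∃ c : ℝ, (c : ℂ) = X.trace := ⟨X.trace.re, (Complex.eq_re_of_ofReal_le (r := 0) (by simpa using ht.le)).symm⟩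
  have hc0 : 0 < c := by rw [← hc] at ht; exact_mod_cast ht
  have hc1 : (c : ℂ) ≠ 0 := by exact_mod_cast hc0.ne'
  refine ⟨⟨(c : ℂ)⁻¹ • X, hX.smul (by rw [← Complex.ofReal_inv]; exact_mod_cast (inv_pos.2 hc0).le), ?_⟩,
    c, hc0, hc, ?_⟩
  · rw [Matrix.trace_smul, ← hc, smul_eq_mul, inv_mul_cancel₀ hc1]
  · rw [smul_smul, mul_inv_cancel₀ hc1, one_smul]

section
open scoped MatrixOrder Matrix.Norms.L2Operator

theorem span_posSemidef (ι : Type) [Fintype ι] [DecidableEq ι] :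
    Submodule.span ℂ {X : Matrix ι ι ℂ | X.PosSemidef} = ⊤ := by
  have h := CStarAlgebra.span_nonneg (A := Matrix ι ι ℂ)
  simpa only [Matrix.nonneg_iff_posSemidef] using h

end

/-- Positive semidefinite operators span, and each nonzero one is a multiple of a density operator.
Facts known only for configurations, such as determinism, extend in this way to arbitrary operators.
-/
theorem ext_density {W : Type*} [AddCommGroup W] [Module ℂ W] {f g : Op S →ₗ[ℂ] W}
    (h : ∀ ρ : Density S, f ρ.1 = g ρ.1) : f = g := by
  refine LinearMap.ext_on (span_posSemidef _) fun X hX => ?_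
  by_cases h0 : X = 0
  · simp [h0]
  · obtain ⟨ρ, c, -, -, hc⟩ := exists_density_of_posSemidef hX h0
    rw [hc, map_smul, map_smul, h]

/-! ### Expressions -/

theorem Value.toExpr_fv (v : Value) : v.toExpr.fv = ∅ := by
  cases v <;> rfl

theorem Value.toExpr_hasTy (v : Value) : v.toExpr.HasTy v.ty := by
  cases v
  · exact .bool _
  · exact .nat _
  · exact .qubit _

namespace Expr

theorem HasTy.qubit_cases {e : Expr} (h : e.HasTy .qubit) :
    (∃ q, e = .qubit q) ∨ ∃ x : Var, x.ty = .qubit ∧ e = .var x := by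
  generalize hT : Ty.qubit = T at h
  cases h with
  | var x => exact Or.inr ⟨x, rfl, rfl⟩
  | qubit q => exact Or.inl ⟨q, rfl⟩
  | _ => cases hT

theorem HasTy.subst {e : Expr} {T : Ty} (h : e.HasTy T) {x : Var} {v : Value} (hv : v.ty = x.ty) :
    (e.subst x v).HasTy T := by
  induction h with
  | var y =>
    simp only [Expr.subst]
    split_ifs with hy
    · subst hy; rw [← hv]; exact v.toExpr_hasTy
    · exact .var y
  | bool b => exact .bool b
  | nat n => exact .nat n
  | qubit q => exact .qubit q
  | not _ ih => exact .not ih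
  | or _ _ ih1 ih2 => exact .or ih1 ih2
  | le _ _ ih1 ih2 => exact .le ih1 ih2
  | eq _ _ ih1 ih2 => exact .eq ih1 ih2

theorem HasTy.eval_ty {e : Expr} {T : Ty} (h : e.HasTy T) {v : Value} (he : e.eval = some v) :
    v.ty = T := by
  cases h <;> simp only [eval, Option.some.injEq, reduceCtorEq] at he
  · subst he; rfl
  · subst he; rfl
  · subst he; rfl
  all_goals
    split at he <;> simp only [Option.some.injEq, reduceCtorEq] at he
    subst he; rfl

theorem fv_subst (e : Expr) (x : Var) (v : Value) : (e.subst x v).fv = e.fv \ {x} := by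
  induction e with
  | var y =>
    simp only [subst]
    split_ifs with hy
    · subst hy; simp [fv, Value.toExpr_fv]
    · ext z; simp only [fv, Set.mem_singleton_iff, Set.mem_sdiff]; grind
  | bool b => simp [subst, fv]
  | nat n => simp [subst, fv]
  | qubit q => simp [subst, fv]
  | not e ih => simpa [subst, fv] using ih
  | or e f ih1 ih2 => simp only [subst, fv, ih1, ih2, Set.union_sdiff_distrib]
  | le e f ih1 ih2 => simp only [subst, fv, ih1, ih2, Set.union_sdiff_distrib]
  | eq e f ih1 ih2 => simp only [subst, fv, ih1, ih2, Set.union_sdiff_distrib]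

end Expr

/-! ### Typing -/

theorem Typing.hasTy {Γ : Set Expr} {P : Proc} (h : Typing Γ P) : ∀ e ∈ Γ, e.HasTy .qubit := by
  induction h with
  | nil _ h => exact h
  | qrecv _ _ _ _ ih => exact fun e he => ih e (Or.inl he)
  | @qsend Γ t c e P hc he mem h ih =>
    intro f hf
    by_cases hfe : f = e
    · rw [hfe]; exact he
    · exact ih f ⟨hf, hfe⟩
  | par _ _ _ ih1 ih2 => exact fun e he => he.elim (ih1 e) (ih2 e)
  | _ => assumption

/-- The terminated processes list what they own, and every rule can be inverted: a qubit reception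
removes its variable, which is fresh for the outer context, and a qubit send puts back what it gave
up. -/
theorem Typing.unique {Γ Γ' : Set Expr} {P : Proc} (h : Typing Γ P) (h' : Typing Γ' P) : Γ = Γ' := by
  induction h generalizing Γ' with
  | nil => cases h'; rfl
  | tau _ ih => cases h' with | tau h' => exact ih h'
  | tauPair _ ih => cases h' with | tauPair h' => exact ih h'
  | sop _ _ _ ih => cases h' with | sop _ _ h' => exact ih h'
  | meas _ _ _ _ ih => cases h' with | meas _ _ _ h' => exact ih h'
  | crecv hc _ _ ih =>
    cases h' with
    | crecv _ _ h' => exact ih h'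
    | qrecv hc' => exact absurd hc' hc
  | @qrecv Γ t c x P hc hx fresh _ ih =>
    cases h' with
    | crecv hc' => exact absurd hc hc'
    | qrecv _ _ fresh' h' =>
      have := ih h'
      ext e
      have he := Set.ext_iff.1 this e
      simp only [Set.mem_union, Set.mem_singleton_iff] at he
      by_cases hex : e = .var x
      · subst hex; simp [fresh, fresh']
      · simpa [hex] using he
  | csend hc _ _ ih =>
    cases h' with
    | csend _ _ h' => exact ih h'
    | qsend hc' => exact absurd hc' hc
  | @qsend Γ t c e P hc he mem _ ih =>
    cases h' with
    | csend hc' => exact absurd hc hc'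
    | qsend _ _ mem' h' =>
      have := ih h'
      ext f
      have hf := Set.ext_iff.1 this f
      simp only [Set.mem_sdiff, Set.mem_singleton_iff] at hf
      by_cases hfe : f = e
      · subst hfe; simp [mem, mem']
      · simpa [hfe] using hf
  | ite _ _ _ ih _ => cases h' with | ite _ h' _ => exact ih h'
  | sum _ _ ih _ => cases h' with | sum h' _ => exact ih h'
  | par _ _ _ ih1 ih2 => cases h' with | par _ h1 h2 => rw [ih1 h1, ih2 h2]
  | restr _ ih => cases h' with | restr h' => exact ih h'

theorem image_subst_eq_self {Γ : Set Expr} (hΓ : ∀ e ∈ Γ, e.HasTy .qubit) {x : Var} {v : Value}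
    (hx : Expr.var x ∉ Γ) : Expr.subst x v '' Γ = Γ := by
  have h : ∀ e ∈ Γ, e.subst x v = e := by
    intro e he
    rcases (hΓ e he).qubit_cases with ⟨q, rfl⟩ | ⟨y, -, rfl⟩
    · rfl
    · have : y ≠ x := by rintro rfl; exact hx he
      simp [Expr.subst, this]
  rw [Set.image_congr h, Set.image_id']

theorem Typing.not_mem_var {Γ : Set Expr} {P : Proc} (h : Typing Γ P) {x : Var}
    (hx : x.ty ≠ .qubit) : Expr.var x ∉ Γ := by
  intro hmem
  have := h.hasTy _ hmem
  rcases this.qubit_cases with ⟨q, hq⟩ | ⟨y, hy, hxy⟩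
  · cases hq
  · cases hxy; exact hx hy

/-- Injectivity on the context is what linearity demands: otherwise substitution could identify two
qubits that are owned separately. -/
theorem Typing.subst {Γ : Set Expr} {P : Proc} (h : Typing Γ P) {x : Var} {v : Value}
    (hv : v.ty = x.ty) (hinj : Set.InjOn (Expr.subst x v) Γ) :
    Typing (Expr.subst x v '' Γ) (P.subst x v) := by
  induction h with
  | @nil es nodup qubits =>
    have : Expr.subst x v '' {e | e ∈ es} = {e | e ∈ es.map (Expr.subst x v)} := by
      ext e; simp
    rw [this]
    refine .nil (List.Nodup.map_on (fun a ha b hb hab => hinj ha hb hab) nodup) ?_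
    intro e he
    obtain ⟨f, hf, rfl⟩ := List.mem_map.1 he
    exact (qubits f hf).subst hv
  | tau _ ih => exact .tau (ih hinj)
  | tauPair _ ih => exact .tauPair (ih hinj)
  | @sop Γ t n E es P inj sub _ ih =>
    refine .sop (fun i j hij => inj (hinj (sub ⟨i, rfl⟩) (sub ⟨j, rfl⟩) hij)) ?_ (ih hinj)
    rintro _ ⟨i, rfl⟩
    exact ⟨_, sub ⟨i, rfl⟩, rfl⟩
  | @meas Γ t n M es y P inj sub hy h ih =>
    refine .meas (fun i j hij => inj (hinj (sub ⟨i, rfl⟩) (sub ⟨j, rfl⟩) hij)) ?_ hy ?_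
    · rintro _ ⟨i, rfl⟩
      exact ⟨_, sub ⟨i, rfl⟩, rfl⟩
    · split_ifs with hyx
      · subst hyx
        rwa [image_subst_eq_self h.hasTy (h.not_mem_var (by simp [hy]))]
      · exact ih hinj
  | @crecv Γ t c y P hc hy h ih =>
    refine .crecv hc hy ?_
    split_ifs with hyx
    · subst hyx
      rwa [image_subst_eq_self h.hasTy (h.not_mem_var (by rwa [hy]))]
    · exact ih hinj
  | @qrecv Γ t c y P hc hy fresh h ih =>
    have hΓ : ∀ e ∈ Γ, e.HasTy .qubit := fun e he => h.hasTy e (Or.inl he)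
    by_cases hyx : y = x
    · subst hyx
      rw [image_subst_eq_self hΓ fresh]
      simp only [Proc.subst, if_true]
      exact .qrecv hc hy fresh h
    · simp only [Proc.subst, if_neg hyx]
      have hys : Expr.subst x v (.var y) = .var y := by simp [Expr.subst, hyx]
      -- A value is never a variable, so a bound variable other than x is hit only by itself. This
      -- keeps it fresh, and keeps the substitution injective on the context extended by it.
      have hvar : ∀ e ∈ Γ, Expr.subst x v e = .var y → e = .var y := by
        intro e he heq
        rcases (hΓ e he).qubit_cases with ⟨q, rfl⟩ | ⟨z, -, rfl⟩
        · cases heq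
        · simp only [Expr.subst] at heq
          split_ifs at heq with hzx
          · cases v <;> cases heq
          · exact heq
      have hfr : Expr.var y ∉ Expr.subst x v '' Γ := by
        rintro ⟨e, he, heq⟩
        exact fresh (hvar e he heq ▸ he)
      refine .qrecv hc hy hfr ?_
      have him : Expr.subst x v '' (Γ ∪ {Expr.var y}) = Expr.subst x v '' Γ ∪ {Expr.var y} := by
        rw [Set.image_union, Set.image_singleton, hys]
      rw [← him]
      refine ih ?_
      intro a ha b hb hab
      rcases ha with ha | rfl <;> rcases hb with hb | rfl
      · exact hinj ha hb hab
      · rw [hys] at hab; exact hvar a ha hab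
      · rw [hys] at hab; exact (hvar b hb hab.symm).symm
      · rfl
  | csend hc he _ ih => exact .csend hc (he.subst hv) (ih hinj)
  | @qsend Γ t c e P hc he mem _ ih =>
    refine .qsend hc (he.subst hv) ⟨e, mem, rfl⟩ ?_
    have : Expr.subst x v '' Γ \ {Expr.subst x v e} = Expr.subst x v '' (Γ \ {e}) := by
      rw [hinj.image_sdiff_subset (by simpa using mem), Set.image_singleton]
    rw [this]
    exact ih (hinj.mono Set.sdiff_subset)
  | ite he _ _ ih1 ih2 => exact .ite (he.subst hv) (ih1 hinj) (ih2 hinj)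
  | sum _ _ ih1 ih2 => exact .sum (ih1 hinj) (ih2 hinj)
  | @par Γ₁ Γ₂ P Q disj _ _ ih1 ih2 =>
    rw [Set.image_union]
    refine .par ?_ (ih1 (hinj.mono Set.subset_union_left)) (ih2 (hinj.mono Set.subset_union_right))
    rw [← hinj.image_inter Set.subset_union_left Set.subset_union_right, disj, Set.image_empty]
  | restr _ ih => exact .restr (ih hinj)

namespace Proc

theorem fv_subst (P : Proc) (x : Var) (v : Value) : (P.subst x v).fv = P.fv \ {x} := by
  induction P with
  | nil es =>
    ext z
    simp only [subst, fv, List.mem_map, Set.mem_ofPred_eq, Set.mem_sdiff, Set.mem_singleton_iff]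
    constructor
    · rintro ⟨_, ⟨e, he, rfl⟩, hz⟩
      rw [Expr.fv_subst] at hz
      exact ⟨⟨e, he, hz.1⟩, hz.2⟩
    · rintro ⟨⟨e, he, hz⟩, hzx⟩
      exact ⟨_, ⟨e, he, rfl⟩, by rw [Expr.fv_subst]; exact ⟨hz, hzx⟩⟩
  | tau t P ih => simpa [subst, fv] using ih
  | tauPair t t' P ih => simpa [subst, fv] using ih
  | recv t c y P ih =>
    simp only [subst, fv]
    split_ifs with h
    · subst h; simp
    · rw [ih, Set.sdiff_sdiff_comm]
  | send t c e P ih => simp only [subst, fv, ih, Expr.fv_subst, Set.union_sdiff_distrib]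
  | sop t E es P ih =>
    simp only [subst, fv, ih, Expr.fv_subst, Set.union_sdiff_distrib, Set.iUnion_sdiff]
  | meas t M es y P ih =>
    simp only [subst, fv, Expr.fv_subst, Set.union_sdiff_distrib, Set.iUnion_sdiff]
    congr 1
    split_ifs with h
    · subst h; simp
    · rw [ih, Set.sdiff_sdiff_comm]
  | ite e P Q ih1 ih2 => simp only [subst, fv, ih1, ih2, Expr.fv_subst, Set.union_sdiff_distrib]
  | sum P Q ih1 ih2 => simp only [subst, fv, ih1, ih2, Set.union_sdiff_distrib]
  | par P Q ih1 ih2 => simp only [subst, fv, ih1, ih2, Set.union_sdiff_distrib]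
  | restr P c ih => simpa [subst, fv] using ih

theorem tags_subst (P : Proc) (x : Var) (v : Value) : (P.subst x v).tags = P.tags := by
  induction P <;> simp only [subst, tags] <;> (try split_ifs) <;> simp_all

theorem uic_subst (P : Proc) (x : Var) (v : Value) : (P.subst x v).uic = P.uic := by
  induction P <;> simp only [subst, uic] <;> (try split_ifs) <;> simp_all

end Proc

/-! ### Owned contexts of closed processes as finite sets of qubit names. -/

theorem qubit_image_injective {G G' : Finset ℕ}
    (h : Expr.qubit '' (G : Set ℕ) = Expr.qubit '' (G' : Set ℕ)) : G = G' := by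
  have hinj : Function.Injective Expr.qubit := fun a b hab => by cases hab; rfl
  exact Finset.coe_injective (hinj.image_injective h)

theorem qubit_mem_image {G : Finset ℕ} {q : ℕ} :
    Expr.qubit q ∈ Expr.qubit '' (G : Set ℕ) ↔ q ∈ G := by
  simp

theorem exists_finset_of_subset {G : Finset ℕ} {Γ : Set Expr}
    (h : Γ ⊆ Expr.qubit '' (G : Set ℕ)) : ∃ G' : Finset ℕ, Γ = Expr.qubit '' (G' : Set ℕ) := by
  classical
  refine ⟨G.filter fun q => Expr.qubit q ∈ Γ, ?_⟩
  ext e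
  simp only [Set.mem_image, Finset.coe_filter, Set.mem_ofPred_eq]
  constructor
  · intro he
    obtain ⟨q, hq, rfl⟩ := h he
    exact ⟨q, ⟨hq, he⟩, rfl⟩
  · rintro ⟨q, ⟨-, hq⟩, rfl⟩
    exact hq

namespace Proc

theorem HasType.unique {P : Proc} {G G' : Finset ℕ} (h : P.HasType G) (h' : P.HasType G') :
    G = G' :=
  qubit_image_injective (h.2.unique h'.2)

theorem HasType.notOwns_iff {P : Proc} {G : Finset ℕ} (h : P.HasType G) {q : ℕ} :
    P.NotOwns q ↔ q ∉ G := by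
  constructor
  · intro hq hmem
    exact hq _ h.2 (qubit_mem_image.2 hmem)
  · intro hq Γ hΓ hmem
    rw [hΓ.unique h.2] at hmem
    exact hq (qubit_mem_image.1 hmem)

theorem HasType.par_inv {P Q : Proc} {G : Finset ℕ} (h : (Proc.par P Q).HasType G) :
    ∃ G₁ G₂ : Finset ℕ, Disjoint G₁ G₂ ∧ G = G₁ ∪ G₂ ∧ P.HasType G₁ ∧ Q.HasType G₂ := by
  obtain ⟨hfv, ht⟩ := h
  simp only [fv, Set.union_empty_iff] at hfv
  generalize hΓ : Expr.qubit '' (G : Set ℕ) = Γ at ht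
  cases ht with
  | @par Γ₁ Γ₂ _ _ disj h1 h2 =>
    obtain ⟨G₁, rfl⟩ := exists_finset_of_subset (G := G) (hΓ ▸ Set.subset_union_left)
    obtain ⟨G₂, rfl⟩ := exists_finset_of_subset (G := G) (hΓ ▸ Set.subset_union_right)
    refine ⟨G₁, G₂, ?_, ?_, ⟨hfv.1, h1⟩, ⟨hfv.2, h2⟩⟩
    · rw [Finset.disjoint_left]
      intro q h1 h2
      have : Expr.qubit q ∈ (∅ : Set Expr) := disj ▸ ⟨qubit_mem_image.2 h1, qubit_mem_image.2 h2⟩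
      exact this
    · apply qubit_image_injective
      rw [hΓ, ← Set.image_union, Finset.coe_union]

theorem HasType.par {P Q : Proc} {G H : Finset ℕ} (hP : P.HasType G) (hQ : Q.HasType H)
    (hd : Disjoint G H) : (Proc.par P Q).HasType (G ∪ H) := by
  refine ⟨by simp [fv, hP.1, hQ.1], ?_⟩
  rw [Finset.coe_union, Set.image_union]
  refine .par ?_ hP.2 hQ.2
  rw [← Set.disjoint_iff_inter_eq_empty, Set.disjoint_left]
  rintro _ ⟨q, hq, rfl⟩ h
  exact Finset.disjoint_left.1 hd hq (qubit_mem_image.1 h)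

theorem HasType.subst_closed {P : Proc} {G : Finset ℕ} {x : Var} {v : Value}
    (h : Typing (Expr.qubit '' (G : Set ℕ)) P) (hfv : P.fv \ {x} = ∅) (hv : v.ty = x.ty) :
    (P.subst x v).HasType G := by
  refine ⟨by rw [fv_subst, hfv], ?_⟩
  have hx : Expr.var x ∉ Expr.qubit '' (G : Set ℕ) := by rintro ⟨q, -, hq⟩; cases hq
  have := h.subst hv (x := x) (v := v) ?_
  · rwa [image_subst_eq_self h.hasTy hx] at this
  · rintro _ ⟨q, hq, rfl⟩ _ ⟨q', hq', rfl⟩ h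
    exact h

/-- That the received name is not yet owned gives the injectivity which `Typing.subst` asks for. -/
theorem HasType.subst_qubit {P : Proc} {G : Finset ℕ} {x : Var} {q : ℕ}
    (h : Typing (Expr.qubit '' (G : Set ℕ) ∪ {Expr.var x}) P) (hfv : P.fv \ {x} = ∅)
    (hx : x.ty = .qubit) (hq : q ∉ G) :
    (P.subst x (.qubit q)).HasType (insert q G) := by
  refine ⟨by rw [fv_subst, hfv], ?_⟩
  have hs : Expr.subst x (.qubit q) (.var x) = .qubit q := by simp [Expr.subst, Value.toExpr]
  have := h.subst (v := .qubit q) (x := x) hx.symm ?_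
  · rw [Set.image_union, Set.image_singleton, hs, Set.image_image] at this
    simp only [Expr.subst] at this
    rw [Finset.coe_insert, Set.image_insert_eq]
    rwa [Set.union_singleton] at this
  · rintro _ (⟨a, ha, rfl⟩ | rfl) _ (⟨b, hb, rfl⟩ | rfl) hab
    · exact hab
    · rw [hs] at hab; cases hab; exact absurd ha hq
    · rw [hs] at hab; cases hab; exact absurd hb hq
    · rfl

end Proc

/-! ### Inversion of the typing of closed processes -/

namespace Proc.HasType

variable {P Q : Proc} {G : Finset ℕ}

theorem tau_inv {t : ℕ} (h : (Proc.tau t P).HasType G) : P.HasType G := by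
  obtain ⟨hfv, ht⟩ := h
  unfold Proc.HasType
  generalize Expr.qubit '' (G : Set ℕ) = Γ at ht ⊢
  cases ht with | tau h => exact ⟨hfv, h⟩

theorem tauPair_inv {t t' : ℕ} (h : (Proc.tauPair t t' P).HasType G) : P.HasType G := by
  obtain ⟨hfv, ht⟩ := h
  unfold Proc.HasType
  generalize Expr.qubit '' (G : Set ℕ) = Γ at ht ⊢
  cases ht with | tauPair h => exact ⟨hfv, h⟩

theorem restr_inv {c : Chan} (h : (Proc.restr P c).HasType G) : P.HasType G := by
  obtain ⟨hfv, ht⟩ := h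
  unfold Proc.HasType
  generalize Expr.qubit '' (G : Set ℕ) = Γ at ht ⊢
  cases ht with | restr h => exact ⟨hfv, h⟩

theorem sum_inv (h : (Proc.sum P Q).HasType G) : P.HasType G ∧ Q.HasType G := by
  obtain ⟨hfv, ht⟩ := h
  simp only [fv, Set.union_empty_iff] at hfv
  unfold Proc.HasType
  generalize Expr.qubit '' (G : Set ℕ) = Γ at ht ⊢
  cases ht with | sum h1 h2 => exact ⟨⟨hfv.1, h1⟩, ⟨hfv.2, h2⟩⟩

theorem ite_inv {e : Expr} (h : (Proc.ite e P Q).HasType G) : P.HasType G ∧ Q.HasType G := by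
  obtain ⟨hfv, ht⟩ := h
  simp only [fv, Set.union_empty_iff] at hfv
  unfold Proc.HasType
  generalize Expr.qubit '' (G : Set ℕ) = Γ at ht ⊢
  cases ht with | ite _ h1 h2 => exact ⟨⟨hfv.1.2, h1⟩, ⟨hfv.2, h2⟩⟩

theorem sop_inv {t n : ℕ} {E : SuperOp n} {es : Fin n → Expr} (h : (Proc.sop t E es P).HasType G) :
    P.HasType G ∧ Set.range es ⊆ Expr.qubit '' (G : Set ℕ) := by
  obtain ⟨hfv, ht⟩ := h
  simp only [fv, Set.union_empty_iff] at hfv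
  unfold Proc.HasType
  generalize Expr.qubit '' (G : Set ℕ) = Γ at ht ⊢
  cases ht with | sop _ hs h => exact ⟨⟨hfv.2, h⟩, hs⟩

theorem meas_inv {t n : ℕ} {M : Measurement n} {es : Fin n → Expr} {x : Var}
    (h : (Proc.meas t M es x P).HasType G) :
    Typing (Expr.qubit '' (G : Set ℕ)) P ∧ P.fv \ {x} = ∅ ∧ x.ty = .nat ∧
      Set.range es ⊆ Expr.qubit '' (G : Set ℕ) := by
  obtain ⟨hfv, ht⟩ := h
  simp only [fv, Set.union_empty_iff] at hfv
  generalize Expr.qubit '' (G : Set ℕ) = Γ at ht ⊢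
  cases ht with | meas _ hs hx h => exact ⟨h, hfv.2, hx, hs⟩

theorem send_inv {t : ℕ} {c : Chan} {e : Expr} (h : (Proc.send t c e P).HasType G) :
    (c.ty ≠ .qubit ∧ e.HasTy c.ty ∧ P.HasType G) ∨
      (c.ty = .qubit ∧ ∃ q ∈ G, e = .qubit q ∧ P.HasType (G.erase q)) := by
  obtain ⟨hfv, ht⟩ := h
  simp only [fv, Set.union_empty_iff] at hfv
  generalize hΓ : Expr.qubit '' (G : Set ℕ) = Γ at ht
  cases ht with
  | csend hc he h => subst hΓ; exact Or.inl ⟨hc, he, hfv.2, h⟩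
  | qsend hc he mem h =>
    subst hΓ
    obtain ⟨q, hq, rfl⟩ := mem
    refine Or.inr ⟨hc, q, hq, rfl, hfv.2, ?_⟩
    have : Expr.qubit '' ((G.erase q : Finset ℕ) : Set ℕ) = Expr.qubit '' (G : Set ℕ) \ {Expr.qubit q} := by
      ext e
      simp only [Finset.coe_erase, Set.mem_image, Set.mem_sdiff, Finset.mem_coe, Set.mem_singleton_iff]
      constructor
      · rintro ⟨r, ⟨h1, h2⟩, rfl⟩
        exact ⟨⟨r, h1, rfl⟩, by simpa using h2⟩
      · rintro ⟨⟨r, h1, rfl⟩, h2⟩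
        exact ⟨r, ⟨h1, by simpa using h2⟩, rfl⟩
    rwa [this]

theorem recv_inv {t : ℕ} {c : Chan} {x : Var} (h : (Proc.recv t c x P).HasType G) :
    P.fv \ {x} = ∅ ∧ x.ty = c.ty ∧
    ((c.ty ≠ .qubit ∧ Typing (Expr.qubit '' (G : Set ℕ)) P) ∨
      (c.ty = .qubit ∧ Typing (Expr.qubit '' (G : Set ℕ) ∪ {Expr.var x}) P)) := by
  obtain ⟨hfv, ht⟩ := h
  simp only [fv] at hfv
  generalize Expr.qubit '' (G : Set ℕ) = Γ at ht ⊢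
  cases ht with
  | crecv hc hx h => exact ⟨hfv, hx, Or.inl ⟨hc, h⟩⟩
  | qrecv hc hx _ h => exact ⟨hfv, hx.trans hc.symm, Or.inr ⟨hc, h⟩⟩

end Proc.HasType

/-! ### Superoperators and quantum vectors -/

/-- Linear maps on operators. -/
abbrev SO (S : Finset ℕ) : Type := Op S →ₗ[ℂ] Op S

/-- Finitely supported weightings of processes by arbitrary operators. -/
abbrev QV (S : Finset ℕ) : Type := Proc →₀ Op S

/-- The map `X ↦ K X Kᴴ`. -/
def conjL (K : Op S) : SO S where
  toFun X := K * X * Kᴴ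
  map_add' X Y := by rw [mul_add, add_mul]
  map_smul' c X := by simp

theorem conjL_apply (K X : Op S) : conjL K X = K * X * Kᴴ := rfl

theorem conjL_one : conjL (1 : Op S) = LinearMap.id := by
  ext X : 1; simp [conjL_apply]

theorem conjL_mul (K L : Op S) : conjL (K * L) = conjL K ∘ₗ conjL L := by
  ext X : 1; simp [conjL_apply, Matrix.conjTranspose_mul, mul_assoc]

/-- The action of a superoperator, as a linear map. -/
def SuperOp.applyL {n : ℕ} (E : SuperOp n) (q : Fin n ↪ S) : SO S :=
  ∑ i, conjL (embed q (E.kraus i))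

theorem SuperOp.applyL_apply {n : ℕ} (E : SuperOp n) (q : Fin n ↪ S) (X : Op S) :
    E.applyL q X = E.apply q X := by
  simp [SuperOp.applyL, SuperOp.apply, conjL_apply]

/-- Completely positive maps that act on the qubits in `G`. -/
def LocalMap (G : Finset ℕ) : AddSubmonoid (SO S) :=
  AddSubmonoid.closure {Φ | ∃ K : Op S, On G K ∧ Φ = conjL K}

theorem conjL_mem_localMap {G : Finset ℕ} {K : Op S} (h : On G K) : conjL K ∈ LocalMap G :=
  AddSubmonoid.subset_closure ⟨K, h, rfl⟩

theorem id_mem_localMap (G : Finset ℕ) : (LinearMap.id : SO S) ∈ LocalMap G := by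
  rw [← conjL_one]; exact conjL_mem_localMap Acts.one

theorem posSemidef_of_localMap {G : Finset ℕ} {Φ : SO S} (h : Φ ∈ LocalMap G) {X : Op S}
    (hX : X.PosSemidef) : (Φ X).PosSemidef := by
  induction h using AddSubmonoid.closure_induction with
  | mem Φ h =>
    obtain ⟨K, -, rfl⟩ := h
    exact hX.mul_mul_conjTranspose_same K
  | zero => exact Matrix.PosSemidef.zero
  | add Φ Ψ _ _ h1 h2 => exact h1.add h2

/-- Each Kraus term acts on the qubits in G, so it commutes with K; sums inherit this. -/
theorem localMap_conjL_comm {G : Finset ℕ} {Φ : SO S} (h : Φ ∈ LocalMap G) {K : Op S}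
    (hK : Off G K) (X : Op S) : Φ (conjL K X) = conjL K (Φ X) := by
  induction h using AddSubmonoid.closure_induction with
  | mem Φ h =>
    obtain ⟨N, hN, rfl⟩ := h
    have hc : N * K = K * N := Acts.commute (fun r h h' => h' h) hN hK
    have hc' : conjL (N * K) X = conjL (K * N) X := by rw [hc]
    simpa only [conjL_mul, LinearMap.comp_apply] using hc'
  | zero => simp
  | add Φ Ψ _ _ h1 h2 => simp [h1, h2]

/-- The total operator. -/
noncomputable def tot : QV S →ₗ[ℂ] Op S := Finsupp.lsum ℂ fun _ => LinearMap.id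

@[simp] theorem tot_single (P : Proc) (X : Op S) : tot (Finsupp.single P X) = X := by
  simp [tot]

theorem tot_eq_sum (D : QV S) : tot D = ∑ P ∈ D.support, D P := by
  simp [tot, Finsupp.sum]

/-- Relabelling of processes. -/
noncomputable abbrev mapV (f : Proc → Proc) : QV S →ₗ[ℂ] QV S := Finsupp.lmapDomain (Op S) ℂ f

/-- The action of a superoperator on all the weights. -/
noncomputable abbrev opV (Φ : SO S) : QV S →ₗ[ℂ] QV S := Finsupp.mapRange.linearMap Φ

@[simp] theorem mapV_single (f : Proc → Proc) (P : Proc) (X : Op S) :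
    mapV f (Finsupp.single P X) = Finsupp.single (f P) X := by
  simp [mapV]

@[simp] theorem opV_single (Φ : SO S) (P : Proc) (X : Op S) :
    opV Φ (Finsupp.single P X) = Finsupp.single P (Φ X) := by
  simp [opV]

theorem tot_mapV (f : Proc → Proc) (D : QV S) : tot (mapV f D) = tot D := by
  induction D using Finsupp.induction_linear with
  | zero => simp
  | add D T h1 h2 => rw [map_add, map_add, h1, h2, map_add]
  | single P X => rw [mapV_single, tot_single, tot_single]

theorem tot_opV (Φ : SO S) (D : QV S) : tot (opV Φ D) = Φ (tot D) := by
  induction D using Finsupp.induction_linear with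
  | zero => simp
  | add D T h1 h2 => rw [map_add, map_add, h1, h2, map_add, map_add]
  | single P X => rw [opV_single, tot_single, tot_single]

theorem opV_mapV (Φ : SO S) (f : Proc → Proc) (D : QV S) :
    opV Φ (mapV f D) = mapV f (opV Φ D) := by
  induction D using Finsupp.induction_linear with
  | zero => simp
  | add D T h1 h2 => rw [map_add, map_add, h1, h2, map_add, map_add]
  | single P X => simp only [opV_single, mapV_single]

/-- The value of a list of weighted targets at an operator. -/
noncomputable def qval (L : List (SO S × Proc)) : Op S →ₗ[ℂ] QV S :=
  (L.map fun x => Finsupp.lsingle x.2 ∘ₗ x.1).sum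

@[simp] theorem qval_nil : qval ([] : List (SO S × Proc)) = 0 := rfl

@[simp] theorem qval_cons (x : SO S × Proc) (L : List (SO S × Proc)) (X : Op S) :
    qval (x :: L) X = Finsupp.single x.2 (x.1 X) + qval L X := by
  simp [qval]

theorem qval_map (f : Proc → Proc) (L : List (SO S × Proc)) (X : Op S) :
    qval (L.map fun x => (x.1, f x.2)) X = (qval L X).mapDomain f := by
  induction L with
  | nil => simp
  | cons x L ih => simp [ih, Finsupp.mapDomain_add, Finsupp.mapDomain_single]

theorem qval_finRange {n : ℕ} (f : Fin n → SO S × Proc) (X : Op S) :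
    qval ((List.finRange n).map f) X = ∑ m, Finsupp.single (f m).2 ((f m).1 X) := by
  rw [Fin.sum_univ_def]
  induction List.finRange n with
  | nil => simp
  | cons x L ih => simp [ih]

theorem mem_of_qval_ne_zero {L : List (SO S × Proc)} {X : Op S} {P : Proc} (h : qval L X P ≠ 0) :
    ∃ Φ, (Φ, P) ∈ L := by
  induction L with
  | nil => simp at h
  | cons x L ih =>
    by_cases hx : x.2 = P
    · exact ⟨x.1, by rw [← hx]; exact List.mem_cons_self⟩
    · rw [qval_cons, Finsupp.add_apply, Finsupp.single_eq_of_ne (Ne.symm hx), zero_add] at h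
      obtain ⟨Φ, hΦ⟩ := ih h
      exact ⟨Φ, List.mem_cons_of_mem _ hΦ⟩

/-! ### Abstract transitions -/

/-- The transitions of processes, independently of the state: a transition leads to a list of
targets, each with the superoperator that yields its weight. -/
inductive KStep : Proc → Act → Sched → List (SO S × Proc) → Prop
  | tau {t : ℕ} {P : Proc} : KStep (.tau t P) .tau (.one t) [(LinearMap.id, P)]
  | tauSynch {t t' : ℕ} {P : Proc} :
      KStep (.tauPair t t' P) .tau (.two t t') [(LinearMap.id, P)]
  | sop {t n : ℕ} {E : SuperOp n} {es : Fin n → Expr} {P : Proc}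
      (q : Fin n ↪ S) (hq : ∀ i, es i = .qubit (q i)) :
      KStep (.sop t E es P) .tau (.one t) [(E.applyL q, P)]
  | meas {t n : ℕ} {M : Measurement n} {es : Fin n → Expr} {x : Var} {P : Proc}
      (q : Fin n ↪ S) (hq : ∀ i, es i = .qubit (q i)) :
      KStep (.meas t M es x P) .tau (.one t)
        ((List.finRange M.k).map fun m =>
          (conjL (embed q (M.op m)), P.subst x (.nat (m : ℕ))))
  | send {t : ℕ} {c : Chan} {e : Expr} {P : Proc} {v : Value} (he : e.eval = some v) :
      KStep (.send t c e P) (.send c v) (.one t) [(LinearMap.id, P)]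
  | recv {t : ℕ} {c : Chan} {x : Var} {P : Proc} {v : Value} (hv : v.ty = c.ty)
      (hq : ∀ q, v = .qubit q → q ∈ S ∧ (Proc.recv t c x P).NotOwns q) :
      KStep (.recv t c x P) (.recv c v) (.one t) [(LinearMap.id, P.subst x v)]
  | iteT {e : Expr} {P Q : Proc} {μ : Act} {s : Sched} {L : List (SO S × Proc)}
      (he : e.eval = some (.bool true)) : KStep P μ s L → KStep (.ite e P Q) μ s L
  | iteF {e : Expr} {P Q : Proc} {μ : Act} {s : Sched} {L : List (SO S × Proc)}
      (he : e.eval = some (.bool false)) : KStep Q μ s L → KStep (.ite e P Q) μ s L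
  | sumL {P Q : Proc} {μ : Act} {s : Sched} {L : List (SO S × Proc)} :
      KStep P μ s L → KStep (.sum P Q) μ s L
  | sumR {P Q : Proc} {μ : Act} {s : Sched} {L : List (SO S × Proc)} :
      KStep Q μ s L → KStep (.sum P Q) μ s L
  | parL {P Q : Proc} {μ : Act} {s : Sched} {L : List (SO S × Proc)}
      (hμ : ∀ c q, μ = .recv c (.qubit q) → Q.NotOwns q) :
      KStep P μ s L → KStep (.par P Q) μ s (L.map fun x => (x.1, .par x.2 Q))
  | parR {P Q : Proc} {μ : Act} {s : Sched} {L : List (SO S × Proc)}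
      (hμ : ∀ c q, μ = .recv c (.qubit q) → P.NotOwns q) :
      KStep Q μ s L → KStep (.par P Q) μ s (L.map fun x => (x.1, .par P x.2))
  | synchL {P Q P' Q' : Proc} {c : Chan} {v : Value} {t t' : ℕ} :
      KStep P (.send c v) (.one t) [(LinearMap.id, P')] →
      KStep Q (.recv c v) (.one t') [(LinearMap.id, Q')] →
      KStep (.par P Q) .tau (.two t t') [(LinearMap.id, .par P' Q')]
  | synchR {P Q P' Q' : Proc} {c : Chan} {v : Value} {t t' : ℕ} :
      KStep P (.recv c v) (.one t) [(LinearMap.id, P')] →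
      KStep Q (.send c v) (.one t') [(LinearMap.id, Q')] →
      KStep (.par P Q) .tau (.two t t') [(LinearMap.id, .par P' Q')]
  | restr {P : Proc} {c : Chan} {μ : Act} {s : Sched} {L : List (SO S × Proc)}
      (hμ : μ.chan ≠ some c) :
      KStep P μ s L → KStep (.restr P c) μ s (L.map fun x => (x.1, .restr x.2 c))

/-- Only sends and receptions produce visible actions, and neither touches the state. This justifies
the single-target premises of the synchronization rules. -/
theorem KStep.visible {P : Proc} {μ : Act} {s : Sched} {L : List (SO S × Proc)}
    (h : KStep P μ s L) (hμ : μ ≠ .tau) : ∃ t P', s = .one t ∧ L = [(LinearMap.id, P')] := by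
  induction h with
  | send => exact ⟨_, _, rfl, rfl⟩
  | recv => exact ⟨_, _, rfl, rfl⟩
  | iteT _ _ ih => exact ih hμ
  | iteF _ _ ih => exact ih hμ
  | sumL _ ih => exact ih hμ
  | sumR _ ih => exact ih hμ
  | parL _ _ ih => obtain ⟨t, P', rfl, rfl⟩ := ih hμ; exact ⟨_, _, rfl, rfl⟩
  | parR _ _ ih => obtain ⟨t, P', rfl, rfl⟩ := ih hμ; exact ⟨_, _, rfl, rfl⟩
  | restr _ _ ih => obtain ⟨t, P', rfl, rfl⟩ := ih hμ; exact ⟨_, _, rfl, rfl⟩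
  | _ => exact absurd rfl hμ

theorem CStep.visible {ρ : Density S} {P : Proc} {μ : Act} {s : Sched} {Δ : Conf S →₀ ℝ≥0}
    (h : CStep ρ P μ s Δ) (hμ : μ ≠ .tau) :
    ∃ t P', s = .one t ∧ Δ = Finsupp.single (ρ, P') 1 := by
  induction h with
  | send => exact ⟨_, _, rfl, rfl⟩
  | recv => exact ⟨_, _, rfl, rfl⟩
  | iteT _ _ ih => exact ih hμ
  | iteF _ _ ih => exact ih hμ
  | sumL _ ih => exact ih hμ
  | sumR _ ih => exact ih hμ
  | parL _ _ ih =>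
    obtain ⟨t, P', rfl, rfl⟩ := ih hμ; exact ⟨_, _, rfl, Finsupp.mapDomain_single⟩
  | parR _ _ ih =>
    obtain ⟨t, P', rfl, rfl⟩ := ih hμ; exact ⟨_, _, rfl, Finsupp.mapDomain_single⟩
  | restr _ _ ih =>
    obtain ⟨t, P', rfl, rfl⟩ := ih hμ; exact ⟨_, _, rfl, Finsupp.mapDomain_single⟩
  | _ => exact absurd rfl hμ

theorem Density.ne_zero (ρ : Density S) : ρ.1 ≠ 0 := by
  intro h
  have := ρ.2.2
  rw [h, Matrix.trace_zero] at this
  exact zero_ne_one this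

/-! ### Comparison of the semantics -/

/-- The quantum vector of a weighted set of configurations. -/
noncomputable def qC : (Conf S →₀ ℝ≥0) →+ QV S :=
  Finsupp.liftAddHom fun C =>
    { toFun := fun p => Finsupp.single C.2 (((p : ℝ) : ℂ) • C.1.1)
      map_zero' := by simp
      map_add' := fun p p' => by simp [add_smul] }

@[simp] theorem qC_single (C : Conf S) (p : ℝ≥0) :
    qC (Finsupp.single C p) = Finsupp.single C.2 (((p : ℝ) : ℂ) • C.1.1) := by
  simp [qC]

theorem qC_smul (p : ℝ≥0) (Δ : Conf S →₀ ℝ≥0) : qC (p • Δ) = ((p : ℝ) : ℂ) • qC Δ := by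
  induction Δ using Finsupp.induction_linear with
  | zero => simp
  | add D T h1 h2 => simp [h1, h2]
  | single C r => rw [Finsupp.smul_single, qC_single, qC_single]; simp [mul_smul]

theorem qC_mapDomain (f : Proc → Proc) (Δ : Conf S →₀ ℝ≥0) :
    qC (Δ.mapDomain fun C => (C.1, f C.2)) = (qC Δ).mapDomain f := by
  induction Δ using Finsupp.induction_linear with
  | zero => simp
  | add D T h1 h2 => simp [Finsupp.mapDomain_add, h1, h2]
  | single C r => simp [Finsupp.mapDomain_single]

theorem qC_apply (Δ : Conf S →₀ ℝ≥0) (P : Proc) :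
    open Classical in
    qC Δ P = ∑ C ∈ Δ.support, if C.2 = P then ((Δ C : ℝ) : ℂ) • C.1.1 else 0 := by
  classical
  simp only [qC, Finsupp.liftAddHom_apply, Finsupp.sum, Finsupp.finsetSum_apply,
    AddMonoidHom.coe_mk, ZeroHom.coe_mk, Finsupp.single_apply]

theorem posSemidef_nnreal_smul (p : ℝ≥0) {X : Op S} (hX : X.PosSemidef) :
    (((p : ℝ) : ℂ) • X).PosSemidef :=
  hX.smul (by exact_mod_cast p.2)

/-- Density operators have trace one, so mass, the quantity that saturated bisimilarity compares
directly, is a linear functional of the quantum vector. -/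
theorem trace_tot_qC (Δ : Conf S →₀ ℝ≥0) : (tot (qC Δ)).trace = ((mass Δ : ℝ) : ℂ) := by
  induction Δ using Finsupp.induction_linear with
  | zero => simp [mass]
  | add D T h1 h2 =>
    have : mass (D + T) = mass D + mass T :=
      Finsupp.sum_add_index' (fun _ => rfl) (fun _ _ _ => rfl)
    simp [h1, h2, this]
  | single C r => simp [mass, Matrix.trace_smul, C.1.2.2]

/-- Processes of configurations in the support carry a nonzero weight. -/
theorem qC_ne_zero {Δ : Conf S →₀ ℝ≥0} {C : Conf S} (hC : C ∈ Δ.support) : qC Δ C.2 ≠ 0 := by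
  classical
  intro h
  have h1 : (qC Δ C.2).trace = 0 := by rw [h, Matrix.trace_zero]
  rw [qC_apply, Matrix.trace_sum] at h1
  have h2 : ∀ C' ∈ Δ.support,
      0 ≤ (if C'.2 = C.2 then ((Δ C' : ℝ) : ℂ) • C'.1.1 else 0).trace := by
    intro C' _
    split_ifs
    · exact (posSemidef_nnreal_smul _ C'.1.2.1).trace_nonneg
    · simp
  have h3 := (Finset.sum_eq_zero_iff_of_nonneg h2).1 h1 C hC
  rw [if_pos rfl, Matrix.trace_smul, C.1.2.2] at h3
  have h4 : Δ C = 0 := by simpa using h3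
  exact Finsupp.mem_support_iff.1 hC h4

theorem exists_of_qC_ne_zero {Δ : Conf S →₀ ℝ≥0} {P : Proc} (h : qC Δ P ≠ 0) :
    ∃ C ∈ Δ.support, C.2 = P := by
  rw [qC_apply] at h
  obtain ⟨C, hC, h⟩ := Finset.exists_ne_zero_of_sum_ne_zero h
  exact ⟨C, hC, by by_contra hne; exact h (if_neg hne)⟩

theorem meas_apply_posSemidef {n : ℕ} (M : Measurement n) (m : Fin M.k) (q : Fin n ↪ S)
    (ρ : Density S) : (M.apply m q ρ.1).PosSemidef :=
  ρ.2.1.mul_mul_conjTranspose_same _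

/-- By cyclicity of the trace the Kraus operators enter only through the sum of their K*K, which is
1. -/
theorem sum_conjL_trace {n k : ℕ} (K : Fin k → Op (Fin n)) (hK : ∑ i, (K i)ᴴ * K i = 1)
    (q : Fin n ↪ S) (X : Op S) : ∑ i, (conjL (embed q (K i)) X).trace = X.trace := by
  have h : ∀ i, (conjL (embed q (K i)) X).trace = (embedG q ((K i)ᴴ * K i) * X).trace := by
    intro i
    rw [conjL_apply, Matrix.trace_mul_comm, ← mul_assoc, embed_eq_embedG, embedG_mul,
      embedG_conjTranspose]
  simp only [h]
  rw [← Matrix.trace_sum, ← Finset.sum_mul, ← embedG_sum, hK, embedG_one, one_mul]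

theorem KStep.trace_tot {P : Proc} {μ : Act} {s : Sched} {L : List (SO S × Proc)}
    (h : KStep P μ s L) (X : Op S) : (tot (qval L X)).trace = X.trace := by
  induction h with
  | @sop t n E es P q hq =>
    simp only [qval_cons, qval_nil, LinearMap.zero_apply, add_zero, tot_single, SuperOp.applyL,
      LinearMap.sum_apply, Matrix.trace_sum]
    exact sum_conjL_trace _ E.complete q X
  | @meas t n M es x P q hq =>
    rw [qval_finRange, map_sum, Matrix.trace_sum]
    simp only [tot_single]
    exact sum_conjL_trace _ M.complete q X
  | iteT _ _ ih => exact ih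
  | iteF _ _ ih => exact ih
  | sumL _ ih => exact ih
  | sumR _ ih => exact ih
  | parL _ _ ih => rw [qval_map (fun P' => .par P' _), ← ih]; exact congrArg _ (tot_mapV _ _)
  | parR _ _ ih => rw [qval_map (fun P' => .par _ P'), ← ih]; exact congrArg _ (tot_mapV _ _)
  | restr _ _ ih => rw [qval_map (fun P' => .restr P' _), ← ih]; exact congrArg _ (tot_mapV _ _)
  | _ => simp

theorem KStep.qcstep {P : Proc} {μ : Act} {s : Sched} {L : List (SO S × Proc)}
    (h : KStep P μ s L) (X : Op S) : QCStep X P μ s (qval L X) := by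
  induction h with
  | tau => simpa using QCStep.tau
  | tauSynch => simpa using QCStep.tauSynch
  | sop q hq => simpa [SuperOp.applyL_apply] using QCStep.sop q hq
  | meas q hq => rw [qval_finRange]; exact QCStep.meas q hq
  | send he => simpa using QCStep.send he
  | recv hv hq => simpa using QCStep.recv hv hq
  | iteT he _ ih => exact .iteT he ih
  | iteF he _ ih => exact .iteF he ih
  | sumL _ ih => exact .sumL ih
  | sumR _ ih => exact .sumR ih
  | parL hμ _ ih => rw [qval_map (fun P' => .par P' _)]; exact .parL hμ ih
  | parR hμ _ ih => rw [qval_map (fun P' => .par _ P')]; exact .parR hμ ih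
  | synchL _ _ ih1 ih2 => simpa using QCStep.synchL (by simpa using ih1) (by simpa using ih2)
  | synchR _ _ ih1 ih2 => simpa using QCStep.synchR (by simpa using ih1) (by simpa using ih2)
  | restr hμ _ ih => rw [qval_map (fun P' => .restr P' _)]; exact .restr hμ ih

/-- At X = 0 the targets are not determined by their weights, but then both sides vanish. -/
theorem single_par_eq {P P' Q Q' : Proc} {X : Op S}
    (h1 : Finsupp.single P X = Finsupp.single P' X) (h2 : Finsupp.single Q X = Finsupp.single Q' X) :
    Finsupp.single (Proc.par P Q) X = Finsupp.single (Proc.par P' Q') X := by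
  by_cases h0 : X = 0
  · simp [h0]
  · rw [Finsupp.single_left_inj h0] at h1 h2
    rw [h1, h2]

/-- Together with `KStep.qcstep`: whether a process can move does not depend on the state, and the
outcome is linear in it. -/
theorem QCStep.kstep {X : Op S} {P : Proc} {μ : Act} {s : Sched} {D : QV S}
    (h : QCStep X P μ s D) : ∃ L, KStep P μ s L ∧ D = qval L X := by
  induction h with
  | tau => exact ⟨_, .tau, by simp⟩
  | tauSynch => exact ⟨_, .tauSynch, by simp⟩
  | sop q hq => exact ⟨_, .sop q hq, by simp [SuperOp.applyL_apply]⟩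
  | meas q hq => exact ⟨_, .meas q hq, by rw [qval_finRange]; rfl⟩
  | send he => exact ⟨_, .send he, by simp⟩
  | recv hv hq => exact ⟨_, .recv hv hq, by simp⟩
  | iteT he _ ih => obtain ⟨L, h, e⟩ := ih; exact ⟨L, .iteT he h, e⟩
  | iteF he _ ih => obtain ⟨L, h, e⟩ := ih; exact ⟨L, .iteF he h, e⟩
  | sumL _ ih => obtain ⟨L, h, e⟩ := ih; exact ⟨L, .sumL h, e⟩
  | sumR _ ih => obtain ⟨L, h, e⟩ := ih; exact ⟨L, .sumR h, e⟩
  | parL hμ _ ih =>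
    obtain ⟨L, h, e⟩ := ih
    exact ⟨_, .parL hμ h, by rw [qval_map (fun P' => .par P' _), e]⟩
  | parR hμ _ ih =>
    obtain ⟨L, h, e⟩ := ih
    exact ⟨_, .parR hμ h, by rw [qval_map (fun P' => .par _ P'), e]⟩
  | synchL _ _ ih1 ih2 =>
    obtain ⟨L1, h1, e1⟩ := ih1
    obtain ⟨L2, h2, e2⟩ := ih2
    obtain ⟨_, P', -, rfl⟩ := h1.visible (by simp)
    obtain ⟨_, Q', -, rfl⟩ := h2.visible (by simp)
    exact ⟨_, .synchL h1 h2, by simpa using single_par_eq (by simpa using e1) (by simpa using e2)⟩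
  | synchR _ _ ih1 ih2 =>
    obtain ⟨L1, h1, e1⟩ := ih1
    obtain ⟨L2, h2, e2⟩ := ih2
    obtain ⟨_, P', -, rfl⟩ := h1.visible (by simp)
    obtain ⟨_, Q', -, rfl⟩ := h2.visible (by simp)
    exact ⟨_, .synchR h1 h2, by simpa using single_par_eq (by simpa using e1) (by simpa using e2)⟩
  | restr hμ _ ih =>
    obtain ⟨L, h, e⟩ := ih
    exact ⟨_, .restr hμ h, by rw [qval_map (fun P' => .restr P' _), e]⟩

theorem density_ext_of_single {ρ : Density S} {P P' : Proc}
    (h : Finsupp.single P ρ.1 = Finsupp.single P' ρ.1) : P = P' :=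
  (Finsupp.single_left_inj ρ.ne_zero).1 h

/-- Configurations carry normalized states, so each target has to be split into a probability and a
density operator; `qC` undoes the splitting. -/
theorem KStep.cstep {P : Proc} {μ : Act} {s : Sched} {L : List (SO S × Proc)}
    (h : KStep P μ s L) (ρ : Density S) : ∃ Δ, CStep ρ P μ s Δ ∧ qC Δ = qval L ρ.1 := by
  induction h with
  | tau => exact ⟨_, .tau, by simp⟩
  | tauSynch => exact ⟨_, .tauSynch, by simp⟩
  | @sop t n E es P q hq =>
    have hpsd : (E.applyL q ρ.1).PosSemidef := by
      rw [SuperOp.applyL_apply]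
      exact Matrix.posSemidef_sum _ fun i _ => ρ.2.1.mul_mul_conjTranspose_same _
    have htr : (E.applyL q ρ.1).trace = 1 := by
      simpa [ρ.2.2] using (KStep.sop (t := t) (E := E) (P := P) q hq).trace_tot ρ.1
    refine ⟨_, .sop q hq ⟨E.applyL q ρ.1, hpsd, htr⟩ (E.applyL_apply q _), by simp⟩
  | @meas t n M es x P q hq =>
    have hm : ∀ m : Fin M.k, ∃ (p : ℝ≥0) (ρ' : Density S),
        ((p : ℝ) : ℂ) = (M.apply m q ρ.1).trace ∧ ((p : ℝ) : ℂ) • ρ'.1 = M.apply m q ρ.1 := by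
      intro m
      by_cases h0 : M.apply m q ρ.1 = 0
      -- An outcome of probability zero needs some density operator as its state; any will do, as
      -- its weight is zero.
      · exact ⟨0, ρ, by simp [h0], by simp [h0]⟩
      · obtain ⟨ρ', c, hc, h1, h2⟩ :=
          exists_density_of_posSemidef (meas_apply_posSemidef M m q ρ) h0
        exact ⟨⟨c, hc.le⟩, ρ', h1, h2.symm⟩
    choose p ρ' h1 h2 using hm
    refine ⟨_, .meas q hq p h1 ρ' h2, ?_⟩
    rw [qval_finRange, map_sum]
    simp only [qC_single, h2]
    rfl
  | send he => exact ⟨_, .send he, by simp⟩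
  | recv hv hq => exact ⟨_, .recv hv hq, by simp⟩
  | iteT he _ ih => obtain ⟨L, h, e⟩ := ih; exact ⟨L, .iteT he h, e⟩
  | iteF he _ ih => obtain ⟨L, h, e⟩ := ih; exact ⟨L, .iteF he h, e⟩
  | sumL _ ih => obtain ⟨L, h, e⟩ := ih; exact ⟨L, .sumL h, e⟩
  | sumR _ ih => obtain ⟨L, h, e⟩ := ih; exact ⟨L, .sumR h, e⟩
  | parL hμ _ ih =>
    obtain ⟨L, h, e⟩ := ih
    exact ⟨_, .parL hμ h, by rw [qval_map (fun P' => .par P' _), ← e, ← qC_mapDomain]⟩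
  | parR hμ _ ih =>
    obtain ⟨L, h, e⟩ := ih
    exact ⟨_, .parR hμ h, by rw [qval_map (fun P' => .par _ P'), ← e, ← qC_mapDomain]⟩
  | synchL _ _ ih1 ih2 =>
    obtain ⟨L1, h1, e1⟩ := ih1
    obtain ⟨L2, h2, e2⟩ := ih2
    obtain ⟨_, P', -, rfl⟩ := h1.visible (by simp)
    obtain ⟨_, Q', -, rfl⟩ := h2.visible (by simp)
    obtain rfl := density_ext_of_single (by simpa using e1)
    obtain rfl := density_ext_of_single (by simpa using e2)
    exact ⟨_, .synchL h1 h2, by simp⟩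
  | synchR _ _ ih1 ih2 =>
    obtain ⟨L1, h1, e1⟩ := ih1
    obtain ⟨L2, h2, e2⟩ := ih2
    obtain ⟨_, P', -, rfl⟩ := h1.visible (by simp)
    obtain ⟨_, Q', -, rfl⟩ := h2.visible (by simp)
    obtain rfl := density_ext_of_single (by simpa using e1)
    obtain rfl := density_ext_of_single (by simpa using e2)
    exact ⟨_, .synchR h1 h2, by simp⟩
  | restr hμ _ ih =>
    obtain ⟨L, h, e⟩ := ih
    exact ⟨_, .restr hμ h, by rw [qval_map (fun P' => .restr P' _), ← e, ← qC_mapDomain]⟩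

theorem CStep.kstep {ρ : Density S} {P : Proc} {μ : Act} {s : Sched} {Δ : Conf S →₀ ℝ≥0}
    (h : CStep ρ P μ s Δ) : ∃ L, KStep P μ s L ∧ qC Δ = qval L ρ.1 := by
  induction h with
  | tau => exact ⟨_, .tau, by simp⟩
  | tauSynch => exact ⟨_, .tauSynch, by simp⟩
  | sop q hq ρ' hρ' => exact ⟨_, .sop q hq, by simp [SuperOp.applyL_apply, hρ']⟩
  | meas q hq p hp ρ' hρ' =>
    refine ⟨_, .meas q hq, ?_⟩
    rw [qval_finRange, map_sum]
    simp only [qC_single, hρ']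
    rfl
  | send he => exact ⟨_, .send he, by simp⟩
  | recv hv hq => exact ⟨_, .recv hv hq, by simp⟩
  | iteT he _ ih => obtain ⟨L, h, e⟩ := ih; exact ⟨L, .iteT he h, e⟩
  | iteF he _ ih => obtain ⟨L, h, e⟩ := ih; exact ⟨L, .iteF he h, e⟩
  | sumL _ ih => obtain ⟨L, h, e⟩ := ih; exact ⟨L, .sumL h, e⟩
  | sumR _ ih => obtain ⟨L, h, e⟩ := ih; exact ⟨L, .sumR h, e⟩
  | parL hμ _ ih =>
    obtain ⟨L, h, e⟩ := ih
    exact ⟨_, .parL hμ h, by rw [qval_map (fun P' => .par P' _), ← e, ← qC_mapDomain]⟩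
  | parR hμ _ ih =>
    obtain ⟨L, h, e⟩ := ih
    exact ⟨_, .parR hμ h, by rw [qval_map (fun P' => .par _ P'), ← e, ← qC_mapDomain]⟩
  | synchL _ _ ih1 ih2 =>
    obtain ⟨L1, h1, e1⟩ := ih1
    obtain ⟨L2, h2, e2⟩ := ih2
    obtain ⟨_, P', -, rfl⟩ := h1.visible (by simp)
    obtain ⟨_, Q', -, rfl⟩ := h2.visible (by simp)
    obtain rfl := density_ext_of_single (by simpa using e1)
    obtain rfl := density_ext_of_single (by simpa using e2)
    exact ⟨_, .synchL h1 h2, by simp⟩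
  | synchR _ _ ih1 ih2 =>
    obtain ⟨L1, h1, e1⟩ := ih1
    obtain ⟨L2, h2, e2⟩ := ih2
    obtain ⟨_, P', -, rfl⟩ := h1.visible (by simp)
    obtain ⟨_, Q', -, rfl⟩ := h2.visible (by simp)
    obtain rfl := density_ext_of_single (by simpa using e1)
    obtain rfl := density_ext_of_single (by simpa using e2)
    exact ⟨_, .synchR h1 h2, by simp⟩
  | restr hμ _ ih =>
    obtain ⟨L, h, e⟩ := ih
    exact ⟨_, .restr hμ h, by rw [qval_map (fun P' => .restr P' _), ← e, ← qC_mapDomain]⟩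

/-! ### Invariants of transitions -/

/-- The type of a process after an action. -/
def Act.after : Act → Finset ℕ → Finset ℕ
  | .send _ (.qubit q), G => G.erase q
  | .recv _ (.qubit q), G => insert q G
  | _, G => G

/-- The conditions on the qubits of an action of a process of type `G`. -/
def Act.Fits (S G : Finset ℕ) : Act → Prop
  | .tau => True
  | .send c v => v.ty = c.ty ∧ ∀ q, v = .qubit q → q ∈ G
  | .recv c v => v.ty = c.ty ∧ ∀ q, v = .qubit q → q ∈ S ∧ q ∉ G

theorem KStep.fits {P : Proc} {μ : Act} {s : Sched} {L : List (SO S × Proc)}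
    (h : KStep P μ s L) {G : Finset ℕ} (hP : P.HasType G) : μ.Fits S G := by
  induction h generalizing G with
  | @send t c e P v he =>
    rcases hP.send_inv with ⟨hc, hty, -⟩ | ⟨hc, q, hq, rfl, -⟩
    · have := hty.eval_ty he
      refine ⟨this, ?_⟩
      rintro q rfl
      exact absurd this.symm hc
    · simp only [Expr.eval, Option.some.injEq] at he
      subst he
      refine ⟨hc.symm, ?_⟩
      rintro _ ⟨⟩
      exact hq
  | recv hv hq =>
    exact ⟨hv, fun q h => ⟨(hq q h).1, hP.notOwns_iff.1 (hq q h).2⟩⟩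
  | iteT _ _ ih => exact ih hP.ite_inv.1
  | iteF _ _ ih => exact ih hP.ite_inv.2
  | sumL _ ih => exact ih hP.sum_inv.1
  | sumR _ ih => exact ih hP.sum_inv.2
  | @parL P Q μ s L hμ h ih =>
    obtain ⟨G₁, G₂, hd, rfl, h1, h2⟩ := hP.par_inv
    have := ih h1
    cases μ with
    | tau => trivial
    | send c v => exact ⟨this.1, fun q hq => Finset.mem_union_left _ (this.2 q hq)⟩
    | recv c v =>
      refine ⟨this.1, fun q hq => ⟨(this.2 q hq).1, ?_⟩⟩
      rw [Finset.mem_union, not_or]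
      exact ⟨(this.2 q hq).2, h2.notOwns_iff.1 (hμ c q (by rw [hq]))⟩
  | @parR P Q μ s L hμ h ih =>
    obtain ⟨G₁, G₂, hd, rfl, h1, h2⟩ := hP.par_inv
    have := ih h2
    cases μ with
    | tau => trivial
    | send c v => exact ⟨this.1, fun q hq => Finset.mem_union_right _ (this.2 q hq)⟩
    | recv c v =>
      refine ⟨this.1, fun q hq => ⟨(this.2 q hq).1, ?_⟩⟩
      rw [Finset.mem_union, not_or]
      exact ⟨h1.notOwns_iff.1 (hμ c q (by rw [hq])), (this.2 q hq).2⟩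
  | restr _ _ ih => exact ih hP.restr_inv
  | _ => trivial

/-- A qubit sent by the first component belongs to it, so erasing it leaves the qubits of the other
one untouched. -/
theorem Act.Fits.after_union {μ : Act} {G₁ G₂ : Finset ℕ} (hd : Disjoint G₁ G₂)
    (h : μ.Fits S (G₁)) : μ.after (G₁ ∪ G₂) = μ.after G₁ ∪ G₂ := by
  rcases μ with _ | ⟨c, _ | _ | q⟩ | ⟨c, _ | _ | q⟩ <;> simp only [Act.after]
  · have hq := h.2 q rfl
    rw [Finset.erase_union_distrib, Finset.erase_eq_of_notMem (Finset.disjoint_left.1 hd hq)]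
  · rw [Finset.insert_union]

theorem Act.Fits.after_disjoint {μ : Act} {G₁ G₂ : Finset ℕ} (hd : Disjoint G₁ G₂)
    (hμ : ∀ c q, μ = .recv c (.qubit q) → q ∉ G₂) : Disjoint (μ.after G₁) G₂ := by
  rcases μ with _ | ⟨c, _ | _ | q⟩ | ⟨c, _ | _ | q⟩ <;> simp only [Act.after] <;> try exact hd
  · exact hd.mono_left (Finset.erase_subset _ _)
  · rw [Finset.disjoint_insert_left]
    exact ⟨hμ c q rfl, hd⟩

theorem Act.Fits.after_subset {μ : Act} {G : Finset ℕ} (h : μ.Fits S G) (hG : G ⊆ S) :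
    μ.after G ⊆ S := by
  rcases μ with _ | ⟨c, _ | _ | q⟩ | ⟨c, _ | _ | q⟩ <;> simp only [Act.after] <;> try exact hG
  · exact (Finset.erase_subset _ _).trans hG
  · exact Finset.insert_subset (h.2 q rfl).1 hG

/-- A communicated qubit changes its owner, so the union of the two owned sets stays the same. -/
theorem synch_union {c c' : Chan} {v : Value} {G₁ G₂ : Finset ℕ} (hd : Disjoint G₁ G₂)
    (h : ∀ q, v = .qubit q → q ∈ G₁) :
    (Act.send c v).after G₁ ∪ (Act.recv c' v).after G₂ = G₁ ∪ G₂ ∧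
      Disjoint ((Act.send c v).after G₁) ((Act.recv c' v).after G₂) := by
  rcases v with _ | _ | q
  · exact ⟨rfl, hd⟩
  · exact ⟨rfl, hd⟩
  · have hq := h q rfl
    constructor
    · ext r
      simp only [Act.after, Finset.mem_union, Finset.mem_erase, Finset.mem_insert]
      by_cases hr : r = q
      · subst hr; simp [hq]
      · simp [hr]
    · simp only [Act.after]
      rw [Finset.disjoint_insert_right]
      exact ⟨Finset.notMem_erase _ _, hd.mono_left (Finset.erase_subset _ _)⟩

theorem Proc.HasType.restr {P : Proc} {G : Finset ℕ} (h : P.HasType G) (c : Chan) :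
    (Proc.restr P c).HasType G := ⟨h.1, .restr h.2⟩

theorem KStep.hasType {P : Proc} {μ : Act} {s : Sched} {L : List (SO S × Proc)}
    (h : KStep P μ s L) {G : Finset ℕ} (hP : P.HasType G) :
    ∀ x ∈ L, x.2.HasType (μ.after G) := by
  induction h generalizing G with
  | tau => simpa [Act.after] using hP.tau_inv
  | tauSynch => simpa [Act.after] using hP.tauPair_inv
  | sop => simpa [Act.after] using hP.sop_inv.1
  | @meas t n M es x P q hq =>
    intro y hy
    obtain ⟨m, -, rfl⟩ := List.mem_map.1 hy
    obtain ⟨h1, h2, h3, -⟩ := hP.meas_inv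
    exact Proc.HasType.subst_closed h1 h2 h3.symm
  | @send t c e P v he =>
    simp only [List.mem_singleton, forall_eq]
    rcases hP.send_inv with ⟨hc, hty, h⟩ | ⟨hc, q, hq, rfl, h⟩
    · have := hty.eval_ty he
      rcases v with _ | _ | q
      · exact h
      · exact h
      · exact absurd this.symm hc
    · simp only [Expr.eval, Option.some.injEq] at he
      subst he
      exact h
  | @recv t c x P v hv hq =>
    simp only [List.mem_singleton, forall_eq]
    obtain ⟨hfv, hx, ⟨hc, h⟩ | ⟨hc, h⟩⟩ := hP.recv_inv
    · have : (P.subst x v).HasType G := Proc.HasType.subst_closed h hfv (hv.trans hx.symm)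
      rcases v with _ | _ | q
      · exact this
      · exact this
      · exact absurd hv.symm hc
    · rcases v with _ | _ | q
      · rw [hc] at hv; cases hv
      · rw [hc] at hv; cases hv
      · exact Proc.HasType.subst_qubit h hfv (hx.trans hc) (hP.notOwns_iff.1 (hq q rfl).2)
  | iteT _ _ ih => exact ih hP.ite_inv.1
  | iteF _ _ ih => exact ih hP.ite_inv.2
  | sumL _ ih => exact ih hP.sum_inv.1
  | sumR _ ih => exact ih hP.sum_inv.2
  | @parL P Q μ s L hμ h ih =>
    obtain ⟨G₁, G₂, hd, rfl, h1, h2⟩ := hP.par_inv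
    intro y hy
    obtain ⟨x, hx, rfl⟩ := List.mem_map.1 hy
    rw [(h.fits h1).after_union hd]
    exact (ih h1 x hx).par h2
      (Act.Fits.after_disjoint hd fun c q hq => h2.notOwns_iff.1 (hμ c q hq))
  | @parR P Q μ s L hμ h ih =>
    obtain ⟨G₁, G₂, hd, rfl, h1, h2⟩ := hP.par_inv
    intro y hy
    obtain ⟨x, hx, rfl⟩ := List.mem_map.1 hy
    rw [Finset.union_comm, (h.fits h2).after_union hd.symm, Finset.union_comm]
    exact h1.par (ih h2 x hx)
      (Act.Fits.after_disjoint hd.symm fun c q hq => h1.notOwns_iff.1 (hμ c q hq)).symm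
  | @synchL P Q P' Q' c v t t' hP' hQ' ih1 ih2 =>
    obtain ⟨G₁, G₂, hd, rfl, h1, h2⟩ := hP.par_inv
    simp only [List.mem_singleton, forall_eq] at ih1 ih2 ⊢
    obtain ⟨e, hd'⟩ := synch_union (c := c) (c' := c) (v := v) hd (hP'.fits h1).2
    have := (ih1 h1).par (ih2 h2) hd'
    rwa [e] at this
  | @synchR P Q P' Q' c v t t' hP' hQ' ih1 ih2 =>
    obtain ⟨G₁, G₂, hd, rfl, h1, h2⟩ := hP.par_inv
    simp only [List.mem_singleton, forall_eq] at ih1 ih2 ⊢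
    obtain ⟨e, hd'⟩ := synch_union (c := c) (c' := c) (v := v) hd.symm (hQ'.fits h2).2
    have := (ih1 h1).par (ih2 h2) hd'.symm
    rwa [Finset.union_comm, e, Finset.union_comm] at this
  | restr _ _ ih =>
    intro y hy
    obtain ⟨x, hx, rfl⟩ := List.mem_map.1 hy
    exact (ih hP.restr_inv x hx).restr _

/-- Typing admits superoperators and measurements on owned qubits only. This locality is why
operators on the environment commute with transitions. -/
theorem KStep.localMap {P : Proc} {μ : Act} {s : Sched} {L : List (SO S × Proc)}
    (h : KStep P μ s L) {G : Finset ℕ} (hP : P.HasType G) :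
    ∀ x ∈ L, x.1 ∈ LocalMap G := by
  have mono : ∀ {G₁ G₂ : Finset ℕ}, G₁ ⊆ G₂ → (LocalMap G₁ : AddSubmonoid (SO S)) ≤ LocalMap G₂ := by
    intro G₁ G₂ h
    refine AddSubmonoid.closure_mono ?_
    rintro _ ⟨K, hK, rfl⟩
    exact ⟨K, hK.mono fun r hr => h hr, rfl⟩
  have hmem : ∀ {n : ℕ} {es : Fin n → Expr} {G : Finset ℕ} {q : Fin n ↪ S},
      (∀ i, es i = .qubit (q i)) → Set.range es ⊆ Expr.qubit '' (G : Set ℕ) → ∀ i, (q i).1 ∈ G := by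
    intro n es G q hq hs i
    have := hs ⟨i, rfl⟩
    rwa [hq i, qubit_mem_image] at this
  induction h generalizing G with
  | @sop t n E es P q hq =>
    simp only [List.mem_singleton, forall_eq]
    exact sum_mem fun i _ => conjL_mem_localMap (Acts.of_embedG q (hmem hq hP.sop_inv.2) _)
  | @meas t n M es x P q hq =>
    intro y hy
    obtain ⟨m, -, rfl⟩ := List.mem_map.1 hy
    exact conjL_mem_localMap (Acts.of_embedG q (hmem hq hP.meas_inv.2.2.2) _)
  | iteT _ _ ih => exact ih hP.ite_inv.1
  | iteF _ _ ih => exact ih hP.ite_inv.2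
  | sumL _ ih => exact ih hP.sum_inv.1
  | sumR _ ih => exact ih hP.sum_inv.2
  | parL hμ h ih =>
    obtain ⟨G₁, G₂, hd, rfl, h1, h2⟩ := hP.par_inv
    intro y hy
    obtain ⟨x, hx, rfl⟩ := List.mem_map.1 hy
    exact mono Finset.subset_union_left (ih h1 x hx)
  | parR hμ h ih =>
    obtain ⟨G₁, G₂, hd, rfl, h1, h2⟩ := hP.par_inv
    intro y hy
    obtain ⟨x, hx, rfl⟩ := List.mem_map.1 hy
    exact mono Finset.subset_union_right (ih h2 x hx)
  | restr _ _ ih =>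
    intro y hy
    obtain ⟨x, hx, rfl⟩ := List.mem_map.1 hy
    exact ih hP.restr_inv x hx
  | _ => simpa using id_mem_localMap _

/-- The tags of a scheduler. -/
def Sched.tags : Sched → Finset ℕ
  | .one t => {t}
  | .two t t' => {t, t'}

theorem KStep.sched_tags {P : Proc} {μ : Act} {s : Sched} {L : List (SO S × Proc)}
    (h : KStep P μ s L) : s.tags ⊆ P.tags := by
  induction h with
  | synchL _ _ ih1 ih2 =>
    simp only [Sched.tags, Proc.tags, Finset.singleton_subset_iff] at *
    exact Finset.insert_subset (Finset.mem_union_left _ ih1)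
      (Finset.singleton_subset_iff.2 (Finset.mem_union_right _ ih2))
  | synchR _ _ ih1 ih2 =>
    simp only [Sched.tags, Proc.tags, Finset.singleton_subset_iff] at *
    exact Finset.insert_subset (Finset.mem_union_left _ ih1)
      (Finset.singleton_subset_iff.2 (Finset.mem_union_right _ ih2))
  | tauSynch =>
    simp only [Sched.tags, Proc.tags]
    exact Finset.insert_subset_insert _ (Finset.singleton_subset_iff.2 (Finset.mem_insert_self _ _))
  | iteT _ _ ih => exact ih.trans Finset.subset_union_left
  | iteF _ _ ih => exact ih.trans Finset.subset_union_right
  | sumL _ ih => exact ih.trans Finset.subset_union_left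
  | sumR _ ih => exact ih.trans Finset.subset_union_right
  | parL _ _ ih => exact ih.trans Finset.subset_union_left
  | parR _ _ ih => exact ih.trans Finset.subset_union_right
  | restr _ _ ih => exact ih
  | _ => simp [Sched.tags, Proc.tags]

theorem KStep.tags_subset {P : Proc} {μ : Act} {s : Sched} {L : List (SO S × Proc)}
    (h : KStep P μ s L) : ∀ x ∈ L, x.2.tags ⊆ P.tags := by
  induction h with
  | tauSynch =>
    simp only [List.mem_singleton, forall_eq, Proc.tags]
    exact (Finset.subset_insert _ _).trans (Finset.subset_insert _ _)
  | meas q hq =>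
    intro y hy
    obtain ⟨m, -, rfl⟩ := List.mem_map.1 hy
    simp [Proc.tags_subst, Proc.tags]
  | recv => simp [Proc.tags_subst, Proc.tags]
  | synchL _ _ ih1 ih2 =>
    simp only [List.mem_singleton, forall_eq, Proc.tags] at *
    exact Finset.union_subset_union ih1 ih2
  | synchR _ _ ih1 ih2 =>
    simp only [List.mem_singleton, forall_eq, Proc.tags] at *
    exact Finset.union_subset_union ih1 ih2
  | iteT _ _ ih => exact fun x hx => (ih x hx).trans Finset.subset_union_left
  | iteF _ _ ih => exact fun x hx => (ih x hx).trans Finset.subset_union_right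
  | sumL _ ih => exact fun x hx => (ih x hx).trans Finset.subset_union_left
  | sumR _ ih => exact fun x hx => (ih x hx).trans Finset.subset_union_right
  | parL _ _ ih =>
    intro y hy
    obtain ⟨x, hx, rfl⟩ := List.mem_map.1 hy
    exact Finset.union_subset_union (ih x hx) subset_rfl
  | parR _ _ ih =>
    intro y hy
    obtain ⟨x, hx, rfl⟩ := List.mem_map.1 hy
    exact Finset.union_subset_union subset_rfl (ih x hx)
  | restr _ _ ih =>
    intro y hy
    obtain ⟨x, hx, rfl⟩ := List.mem_map.1 hy
    exact ih x hx
  | _ => simp [Proc.tags]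

/-- A reception that gets past all restrictions is on an unrestricted input channel; so
input-restricted processes never receive qubits from outside. -/
theorem KStep.recv_mem_uic {P : Proc} {μ : Act} {s : Sched} {L : List (SO S × Proc)}
    (h : KStep P μ s L) {c : Chan} {v : Value} (hμ : μ = .recv c v) (hc : c.ty = .qubit) :
    c ∈ P.uic := by
  induction h with
  | recv => cases hμ; simp [Proc.uic, hc]
  | iteT _ _ ih => exact Or.inl (ih hμ)
  | iteF _ _ ih => exact Or.inr (ih hμ)
  | sumL _ ih => exact Or.inl (ih hμ)
  | sumR _ ih => exact Or.inr (ih hμ)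
  | parL _ _ ih => exact Or.inl (ih hμ)
  | parR _ _ ih => exact Or.inr (ih hμ)
  | restr hμ' _ ih =>
    refine ⟨ih hμ, fun h => hμ' ?_⟩
    rw [hμ, Set.mem_singleton_iff.1 h]; rfl
  | _ => cases hμ

theorem KStep.uic_subset {P : Proc} {μ : Act} {s : Sched} {L : List (SO S × Proc)}
    (h : KStep P μ s L) : ∀ x ∈ L, x.2.uic ⊆ P.uic := by
  induction h with
  | meas q hq =>
    intro y hy
    obtain ⟨m, -, rfl⟩ := List.mem_map.1 hy
    simp [Proc.uic_subst, Proc.uic]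
  | recv =>
    simp only [List.mem_singleton, forall_eq, Proc.uic_subst, Proc.uic]
    split_ifs
    · exact Set.subset_union_right
    · exact subset_rfl
  | synchL _ _ ih1 ih2 =>
    simp only [List.mem_singleton, forall_eq, Proc.uic] at *
    exact Set.union_subset_union ih1 ih2
  | synchR _ _ ih1 ih2 =>
    simp only [List.mem_singleton, forall_eq, Proc.uic] at *
    exact Set.union_subset_union ih1 ih2
  | iteT _ _ ih => exact fun x hx => (ih x hx).trans Set.subset_union_left
  | iteF _ _ ih => exact fun x hx => (ih x hx).trans Set.subset_union_right
  | sumL _ ih => exact fun x hx => (ih x hx).trans Set.subset_union_left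
  | sumR _ ih => exact fun x hx => (ih x hx).trans Set.subset_union_right
  | parL _ _ ih =>
    intro y hy
    obtain ⟨x, hx, rfl⟩ := List.mem_map.1 hy
    exact Set.union_subset_union (ih x hx) subset_rfl
  | parR _ _ ih =>
    intro y hy
    obtain ⟨x, hx, rfl⟩ := List.mem_map.1 hy
    exact Set.union_subset_union subset_rfl (ih x hx)
  | restr _ _ ih =>
    intro y hy
    obtain ⟨x, hx, rfl⟩ := List.mem_map.1 hy
    exact Set.sdiff_subset_sdiff_left (ih x hx)
  | _ => simp [Proc.uic]

/-! ### The linear transition operator -/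

open Classical in
/-- The transition of a process with a given action and scheduler, as a linear map; it is zero if
there is none. -/
noncomputable def stepL (P : Proc) (μ : Act) (s : Sched) : Op S →ₗ[ℂ] QV S :=
  if h : ∃ L : List (SO S × Proc), KStep P μ s L then qval h.choose else 0

/-- The transition operator on quantum vectors. -/
noncomputable def stepV (μ : Act) (s : Sched) : QV S →ₗ[ℂ] QV S :=
  Finsupp.lsum ℂ fun P => stepL P μ s

@[simp] theorem stepV_single (μ : Act) (s : Sched) (P : Proc) (X : Op S) :
    stepV μ s (Finsupp.single P X) = stepL P μ s X := by
  simp [stepV]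

theorem stepV_eq_sum (μ : Act) (s : Sched) (D : QV S) :
    stepV μ s D = ∑ P ∈ D.support, stepL P μ s (D P) := by
  simp [stepV, Finsupp.sum]

theorem stepL_eq_zero {P : Proc} {μ : Act} {s : Sched}
    (h : ∀ L : List (SO S × Proc), ¬ KStep P μ s L) : (stepL P μ s : Op S →ₗ[ℂ] QV S) = 0 := by
  rw [stepL, dif_neg (by rintro ⟨L, hL⟩; exact h L hL)]

/-- Deterministic closed processes of a given type. -/
structure Good (S G : Finset ℕ) (P : Proc) : Prop where
  det : P.Deterministic
  hasType : P.HasType G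
  subset : G ⊆ S

theorem Density.nonempty (S : Finset ℕ) : Nonempty (Density S) := by
  obtain ⟨ρ, -⟩ := exists_density_of_posSemidef (S := S) (X := 1) Matrix.PosSemidef.one one_ne_zero
  exact ⟨ρ⟩

theorem Good.stepDeterministic {G : Finset ℕ} {P : Proc} (h : Good S G P) :
    P.StepDeterministic := h.det P .refl

/-- Two abstract transitions may be different lists of targets. Determinism makes their values agree
at every density operator, hence at every operator. -/
theorem Good.qval_unique {G : Finset ℕ} {P : Proc} (h : Good S G P) {μ : Act} {s : Sched}
    {L L' : List (SO S × Proc)} (hL : KStep P μ s L) (hL' : KStep P μ s L') : qval L = qval L' := by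
  refine ext_density fun ρ => ?_
  obtain ⟨Δ, h1, e1⟩ := hL.cstep ρ
  obtain ⟨Δ', h2, e2⟩ := hL'.cstep ρ
  rcases h.stepDeterministic S G ρ h.hasType h.subset s μ μ Δ Δ' h1 h2 with ⟨-, rfl⟩ | ⟨hne, -⟩
  · rw [← e1, e2]
  · exact absurd rfl hne

theorem Good.act_unique {G : Finset ℕ} {P : Proc} (h : Good S G P) {μ μ' : Act} {s : Sched}
    {L L' : List (SO S × Proc)} (hL : KStep P μ s L) (hL' : KStep P μ' s L') :
    μ = μ' ∨ ∃ c v v', μ = .recv c v ∧ μ' = .recv c v' := by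
  obtain ⟨ρ⟩ := Density.nonempty S
  obtain ⟨Δ, h1, -⟩ := hL.cstep ρ
  obtain ⟨Δ', h2, -⟩ := hL'.cstep ρ
  rcases h.stepDeterministic S G ρ h.hasType h.subset s μ μ' Δ Δ' h1 h2 with ⟨e, -⟩ | ⟨-, h⟩
  · exact Or.inl e
  · exact Or.inr h

theorem Good.stepL_eq {G : Finset ℕ} {P : Proc} (h : Good S G P) {μ : Act} {s : Sched}
    {L : List (SO S × Proc)} (hL : KStep P μ s L) : stepL P μ s = qval L := by
  have hex : ∃ L : List (SO S × Proc), KStep P μ s L := ⟨L, hL⟩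
  rw [stepL, dif_pos hex]
  exact h.qval_unique hex.choose_spec hL

theorem Good.of_kstep {G : Finset ℕ} {P P' : Proc} (h : Good S G P) {μ : Act} {s : Sched}
    {L : List (SO S × Proc)} (hL : KStep P μ s L) {X : Op S} (hP' : qval L X P' ≠ 0) :
    Good S (μ.after G) P' := by
  obtain ⟨Φ, hΦ⟩ := mem_of_qval_ne_zero hP'
  refine ⟨?_, hL.hasType h.hasType _ hΦ, (hL.fits h.hasType).after_subset h.subset⟩
  -- Determinism passes only to processes reached with positive probability from some density
  -- operator. If no density operator reached `P'`, the component at `P'` would vanish at all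
  -- operators, and in particular at X.
  obtain ⟨ρ, hρ⟩ : ∃ ρ : Density S, qval L ρ.1 P' ≠ 0 := by
    by_contra hno
    push Not at hno
    have : (Finsupp.lapply P' ∘ₗ qval L : Op S →ₗ[ℂ] Op S) = 0 :=
      ext_density fun ρ => by simpa using hno ρ
    exact hP' (by simpa using LinearMap.congr_fun this X)
  obtain ⟨Δ, h1, e1⟩ := hL.cstep ρ
  rw [← e1] at hρ
  obtain ⟨C, hC, rfl⟩ := exists_of_qC_ne_zero hρ
  intro P'' hP''
  exact h.det P'' (.head ⟨S, G, ρ, C.1, μ, s, Δ, h.hasType, h.subset, h1, hC⟩ hP'')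

/-! ### Supports -/

/-- Quantum vectors whose processes satisfy a predicate. -/
abbrev Supp (p : Proc → Prop) : Submodule ℂ (QV S) := Finsupp.supported (Op S) ℂ {P | p P}

theorem mem_supp {p : Proc → Prop} {D : QV S} : D ∈ Supp p ↔ ∀ P, D P ≠ 0 → p P := by
  rw [Finsupp.mem_supported]
  exact ⟨fun h P hP => h (Finsupp.mem_support_iff.2 hP),
    fun h P hP => h P (Finsupp.mem_support_iff.1 hP)⟩

theorem supp_induction {p : Proc → Prop} {C : QV S → Prop} (h0 : C 0)
    (hadd : ∀ D T, C D → C T → C (D + T)) (hs : ∀ P X, p P → C (Finsupp.single P X))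
    {D : QV S} (hD : D ∈ Supp p) : C D := by
  rw [← Finsupp.sum_single D]
  exact Finset.sum_induction _ C hadd h0 fun P hP => hs P _ (mem_supp.1 hD P (Finsupp.mem_support_iff.1 hP))

/-- Linear maps that agree on the vectors of single processes agree. -/
theorem supp_ext {p : Proc → Prop} {W : Type*} [AddCommGroup W] [Module ℂ W] {f g : QV S →ₗ[ℂ] W}
    (h : ∀ P X, p P → f (Finsupp.single P X) = g (Finsupp.single P X)) {D : QV S} (hD : D ∈ Supp p) :
    f D = g D :=
  supp_induction (C := fun D => f D = g D) (by simp) (fun D T h1 h2 => by rw [map_add, map_add, h1, h2])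
    h hD

theorem single_mem_supp {p : Proc → Prop} {P : Proc} {X : Op S} (h : X ≠ 0 → p P) :
    Finsupp.single P X ∈ Supp p := by
  rw [mem_supp]
  intro Q hQ
  by_cases hQP : Q = P
  · subst hQP; rw [Finsupp.single_eq_same] at hQ; exact h hQ
  · rw [Finsupp.single_eq_of_ne hQP] at hQ; exact absurd rfl hQ

theorem stepV_mem_supp {p p' : Proc → Prop} {μ : Act} {s : Sched} {G : Finset ℕ}
    (hp : ∀ P, p P → Good S G P)
    (h : ∀ P (L : List (SO S × Proc)), p P → KStep P μ s L → ∀ X P', qval L X P' ≠ 0 → p' P')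
    {D : QV S} (hD : D ∈ Supp p) : stepV μ s D ∈ Supp p' := by
  refine supp_induction (C := fun D => stepV μ s D ∈ Supp p') (by simp)
    (fun D T h1 h2 => by rw [map_add]; exact add_mem h1 h2) (fun P X hP => ?_) hD
  rw [stepV_single]
  by_cases hex : ∃ L : List (SO S × Proc), KStep P μ s L
  · obtain ⟨L, hL⟩ := hex
    rw [(hp P hP).stepL_eq hL, mem_supp]
    exact h P L hP hL X
  · rw [stepL_eq_zero (by simpa using hex)]
    simp

theorem stepV_good {μ : Act} {s : Sched} {G : Finset ℕ} {D : QV S} (hD : D ∈ Supp (Good S G)) :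
    stepV μ s D ∈ Supp (Good S (μ.after G)) :=
  stepV_mem_supp (fun _ h => h) (fun _ _ hP hL _ _ h => hP.of_kstep hL h) hD

theorem opV_mem_supp {p : Proc → Prop} {Φ : SO S} {D : QV S} (hD : D ∈ Supp p) :
    opV Φ D ∈ Supp p := by
  rw [mem_supp] at hD ⊢
  intro P hP
  refine hD P fun h => hP ?_
  simp [opV, h]

theorem qval_conjL_comm {L : List (SO S × Proc)} {G : Finset ℕ} (hL : ∀ x ∈ L, x.1 ∈ LocalMap G)
    {K : Op S} (hK : Off G K) (X : Op S) : qval L (conjL K X) = opV (conjL K) (qval L X) := by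
  induction L with
  | nil => simp
  | cons x L ih =>
    rw [qval_cons, qval_cons, map_add, opV_single, ih fun y hy => hL y (List.mem_cons_of_mem _ hy),
      localMap_conjL_comm (hL x List.mem_cons_self) hK]

/-- Processes act only on what they own, so an operation on the environment may be performed before
or after a step. Both directions of the theorem rest on this. -/
theorem stepV_conjL_comm {μ : Act} {s : Sched} {G : Finset ℕ} {D : QV S} (hD : D ∈ Supp (Good S G))
    {K : Op S} (hK : Off G K) :
    stepV μ s (opV (conjL K) D) = opV (conjL K) (stepV μ s D) := by
  refine supp_ext (f := stepV μ s ∘ₗ opV (conjL K)) (g := opV (conjL K) ∘ₗ stepV μ s)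
    (fun P X hP => ?_) hD
  simp only [LinearMap.comp_apply, opV_single, stepV_single]
  by_cases hex : ∃ L : List (SO S × Proc), KStep P μ s L
  · obtain ⟨L, hL⟩ := hex
    rw [hP.stepL_eq hL, qval_conjL_comm (hL.localMap hP.hasType) hK]
  · rw [stepL_eq_zero (by simpa using hex)]
    simp

/-! ### Positivity -/

theorem qval_posSemidef {L : List (SO S × Proc)} {G : Finset ℕ} (hL : ∀ x ∈ L, x.1 ∈ LocalMap G)
    {X : Op S} (hX : X.PosSemidef) (P : Proc) : (qval L X P).PosSemidef := by
  classical
  induction L with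
  | nil => simpa using Matrix.PosSemidef.zero
  | cons x L ih =>
    rw [qval_cons, Finsupp.add_apply]
    refine Matrix.PosSemidef.add ?_ (ih fun y hy => hL y (List.mem_cons_of_mem _ hy))
    rw [Finsupp.single_apply]
    split_ifs
    · exact posSemidef_of_localMap (hL x List.mem_cons_self) hX
    · exact Matrix.PosSemidef.zero

theorem Good.stepL_posSemidef {G : Finset ℕ} {P : Proc} (h : Good S G P) (μ : Act) (s : Sched)
    {X : Op S} (hX : X.PosSemidef) (P' : Proc) : (stepL P μ s X P').PosSemidef := by
  by_cases hex : ∃ L : List (SO S × Proc), KStep P μ s L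
  · obtain ⟨L, hL⟩ := hex
    rw [h.stepL_eq hL]
    exact qval_posSemidef (hL.localMap h.hasType) hX P'
  · rw [stepL_eq_zero (by simpa using hex)]
    simpa using Matrix.PosSemidef.zero

theorem Good.trace_stepL_le {G : Finset ℕ} {P : Proc} (h : Good S G P) (μ : Act) (s : Sched)
    {X : Op S} (hX : X.PosSemidef) : (tot (stepL P μ s X)).trace ≤ X.trace := by
  by_cases hex : ∃ L : List (SO S × Proc), KStep P μ s L
  · obtain ⟨L, hL⟩ := hex
    rw [h.stepL_eq hL, hL.trace_tot]
  · rw [stepL_eq_zero (by simpa using hex)]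
    simpa using hX.trace_nonneg

theorem QDist.trace_le (D : QDist S) : (tot D.1).trace.re ≤ 1 := by
  have := D.2.2
  rwa [tot_eq_sum, Matrix.trace_sum, Complex.re_sum]

/-- Quantum distributions from their weights. -/
theorem qdist_mem {D : QV S} (h1 : ∀ P, (D P).PosSemidef) (h2 : (tot D).trace.re ≤ 1) :
    (∀ P, (D P).PosSemidef) ∧ ∑ P ∈ D.support, (D P).trace.re ≤ 1 :=
  ⟨h1, by rwa [tot_eq_sum, Matrix.trace_sum, Complex.re_sum] at h2⟩

theorem trace_tot_nonneg {D : QV S} (h : ∀ P, (D P).PosSemidef) : 0 ≤ (tot D).trace := by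
  rw [tot_eq_sum, Matrix.trace_sum]
  exact Finset.sum_nonneg fun P _ => (h P).trace_nonneg

theorem stepV_posSemidef {G : Finset ℕ} {D : QV S} (hD : D ∈ Supp (Good S G))
    (h : ∀ P, (D P).PosSemidef) (μ : Act) (s : Sched) (P' : Proc) :
    (stepV μ s D P').PosSemidef := by
  rw [stepV_eq_sum, Finsupp.finsetSum_apply]
  exact Matrix.posSemidef_sum _ fun P hP =>
    (mem_supp.1 hD P (Finsupp.mem_support_iff.1 hP)).stepL_posSemidef μ s (h P) P'

theorem trace_stepV_le {G : Finset ℕ} {D : QV S} (hD : D ∈ Supp (Good S G))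
    (h : ∀ P, (D P).PosSemidef) (μ : Act) (s : Sched) :
    (tot (stepV μ s D)).trace ≤ (tot D).trace := by
  rw [stepV_eq_sum, map_sum, Matrix.trace_sum, tot_eq_sum, Matrix.trace_sum]
  exact Finset.sum_le_sum fun P hP =>
    (mem_supp.1 hD P (Finsupp.mem_support_iff.1 hP)).trace_stepL_le μ s (h P)

/-! ### Transitions of quantum distributions -/

theorem eq_zero_of_posSemidef_add {ι : Type*} [Fintype ι] [DecidableEq ι] {X Y : Matrix ι ι ℂ}
    (hX : X.PosSemidef) (hY : Y.PosSemidef) (h : X + Y = 0) : X = 0 := by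
  rw [← hX.trace_eq_zero_iff]
  have h1 : X.trace + Y.trace = 0 := by rw [← Matrix.trace_add, h, Matrix.trace_zero]
  exact ((add_eq_zero_iff_of_nonneg hX.trace_nonneg hY.trace_nonneg).1 h1).1

/-- A distribution may be decomposed in many ways before it moves, but positive weights cannot
cancel. The parts are therefore supported on processes of the whole, and linearity makes the result
independent of the decomposition. -/
theorem QStep.eq_stepV {G : Finset ℕ} {D D' : QDist S} {μ : Act} {s : Sched} (h : QStep D μ s D')
    (hD : D.1 ∈ Supp (Good S G)) : D'.1 = stepV μ s D.1 := by
  induction h with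
  | @id D D' ρ P μ s hDe h =>
    obtain ⟨L, hL, e⟩ := h.kstep
    rw [hDe, stepV_single, e]
    by_cases h0 : ρ = 0
    · simp [h0]
    · rw [(mem_supp.1 hD P (by rw [hDe]; simpa using h0)).stepL_eq hL]
  | @not D D' ρ P μ s hDe hD' h =>
    rw [hDe, hD', stepV_single, stepL_eq_zero fun L hL => h _ (hL.qcstep ρ)]
    rfl
  | @conv D T D' T' U U' μ s hU hU' _ _ ih1 ih2 =>
    rw [mem_supp] at hD
    rw [hU', hU, map_add, ih1, ih2]
    · refine mem_supp.2 fun P hP => hD P fun h0 => hP ?_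
      rw [hU, Finsupp.add_apply, add_comm] at h0
      exact eq_zero_of_posSemidef_add (T.2.1 P) (D.2.1 P) h0
    · refine mem_supp.2 fun P hP => hD P fun h0 => hP ?_
      rw [hU, Finsupp.add_apply] at h0
      exact eq_zero_of_posSemidef_add (D.2.1 P) (T.2.1 P) h0

/-- The outcome of the transition operator, as a quantum distribution. -/
noncomputable def QDist.step {G : Finset ℕ} (D : QDist S) (hD : D.1 ∈ Supp (Good S G)) (μ : Act)
    (s : Sched) : QDist S :=
  ⟨stepV μ s D.1, qdist_mem (stepV_posSemidef hD D.2.1 μ s)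
    ((Complex.le_def.1 (trace_stepV_le hD D.2.1 μ s)).1.trans D.trace_le)⟩

theorem QDist.qstep_step_of_single {G : Finset ℕ} {D : QDist S} (hD : D.1 ∈ Supp (Good S G))
    {P : Proc} {X : Op S} (hDe : D.1 = Finsupp.single P X) (μ : Act) (s : Sched) :
    QStep D μ s (D.step hD μ s) := by
  have hst : (D.step hD μ s).1 = stepL P μ s X := by
    change stepV μ s D.1 = _
    rw [hDe, stepV_single]
  by_cases hex : ∃ L : List (SO S × Proc), KStep P μ s L
  · obtain ⟨L, hL⟩ := hex
    refine .id hDe ?_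
    have : (D.step hD μ s).1 = qval L X := by
      rw [hst]
      by_cases h0 : X = 0
      · simp [h0]
      · rw [(mem_supp.1 hD P (by rw [hDe]; simpa using h0)).stepL_eq hL]
    rw [this]
    exact hL.qcstep X
  · refine .not hDe (by rw [hst, stepL_eq_zero (by simpa using hex)]; rfl) ?_
    intro T hT
    obtain ⟨L, hL, -⟩ := hT.kstep
    exact hex ⟨L, hL⟩

theorem QDist.qstep_step {G : Finset ℕ} (D : QDist S) (hD : D.1 ∈ Supp (Good S G)) (μ : Act)
    (s : Sched) : QStep D μ s (D.step hD μ s) := by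
  classical
  suffices H : ∀ (A : Finset Proc) (D : QDist S) (hD : D.1 ∈ Supp (Good S G)), D.1.support ⊆ A →
      QStep D μ s (D.step hD μ s) from H _ D hD subset_rfl
  intro A
  induction A using Finset.induction_on with
  | empty =>
    intro D hD hA
    -- There is no separate rule for the empty distribution; it moves as zero weight on an arbitrary
    -- process.
    refine qstep_step_of_single hD (P := .nil []) (X := 0) ?_ μ s
    rw [Finsupp.single_zero]
    exact Finsupp.support_eq_empty.1 (Finset.subset_empty.1 hA)
  | insert P A _ ih =>
    intro D hD hA
    have hsum : D.1 = Finsupp.single P (D.1 P) + D.1.erase P := (Finsupp.single_add_erase P D.1).symm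
    have hp1 : ∀ Q, (Finsupp.single P (D.1 P) Q).PosSemidef := by
      intro Q
      rw [Finsupp.single_apply]
      split_ifs
      · exact D.2.1 P
      · exact Matrix.PosSemidef.zero
    have hp2 : ∀ Q, (D.1.erase P Q).PosSemidef := by
      intro Q
      rw [Finsupp.erase_apply]
      split_ifs
      · exact Matrix.PosSemidef.zero
      · exact D.2.1 Q
    have htr : (tot D.1).trace.re =
        (tot (Finsupp.single P (D.1 P))).trace.re + (tot (D.1.erase P)).trace.re := by
      conv_lhs => rw [hsum]
      rw [map_add, Matrix.trace_add, Complex.add_re]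
    have hn1 := (Complex.le_def.1 (trace_tot_nonneg hp1)).1
    have hn2 := (Complex.le_def.1 (trace_tot_nonneg hp2)).1
    have hle := D.trace_le
    rw [Complex.zero_re] at hn1 hn2
    let D1 : QDist S := ⟨Finsupp.single P (D.1 P), qdist_mem hp1 (by linarith)⟩
    let D2 : QDist S := ⟨D.1.erase P, qdist_mem hp2 (by linarith)⟩
    have hD1 : D1.1 ∈ Supp (Good S G) := single_mem_supp fun h => mem_supp.1 hD P h
    have hD2 : D2.1 ∈ Supp (Good S G) := mem_supp.2 fun Q hQ => mem_supp.1 hD Q fun h0 => hQ (by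
      change D.1.erase P Q = 0
      rw [Finsupp.erase_apply, h0, ite_self])
    refine .conv (D := D1) (T := D2) (D' := D1.step hD1 μ s) (T' := D2.step hD2 μ s) hsum ?_
      (qstep_step_of_single hD1 rfl μ s) (ih D2 hD2 ?_)
    · change stepV μ s D.1 = stepV μ s D1.1 + stepV μ s D2.1
      rw [← map_add]
      exact congrArg _ hsum
    · intro Q hQ
      have hQ' : Q ∈ (D.1.erase P).support := hQ
      rw [Finsupp.support_erase, Finset.mem_erase] at hQ'
      exact (Finset.mem_insert.1 (hA hQ'.2)).resolve_left hQ'.1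

/-! ### Transitions of distributions of configurations -/

/-- The processes of the configurations of `Δ` satisfy `p`. -/
def SDist.All {S : Finset ℕ} (p : Proc → Prop) (Δ : SDist (Conf S)) : Prop :=
  ∀ C ∈ Δ.1.support, p C.2

theorem SDist.all_iff {p : Proc → Prop} {Δ : SDist (Conf S)} :
    Δ.All p ↔ qC Δ.1 ∈ Supp p := by
  rw [mem_supp]
  constructor
  · intro h P hP
    obtain ⟨C, hC, rfl⟩ := exists_of_qC_ne_zero hP
    exact h C hC
  · intro h C hC
    exact h C.2 (qC_ne_zero hC)

/-- The left-linear lifting of a relation whose values are given by a linear map is that linear map.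
-/
theorem DStep.qC_eq {G : Finset ℕ} {Δ Θ : SDist (Conf S)} {μ : Act} {s : Sched}
    (h : DStep Δ μ s Θ) (hΔ : Δ.All (Good S G)) : qC Θ.1 = stepV μ s (qC Δ.1) := by
  induction h with
  | @point C Θ hC =>
    have hgood : Good S G C.2 := hΔ C (by simp [SDist.point])
    have hq : qC (SDist.point C).1 = Finsupp.single C.2 C.1.1 := by simp [SDist.point]
    rw [hq, stepV_single]
    rcases hC with hC | ⟨h0, hC⟩
    · obtain ⟨L, hL, e⟩ := hC.kstep
      rw [e, hgood.stepL_eq hL]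
    · rw [h0, map_zero, stepL_eq_zero]
      · rfl
      · intro L hL
        obtain ⟨Δ, h, -⟩ := hL.cstep C.1
        exact hC Δ h
  | @linear n p hp Δ Θ Δ' Θ' hΔ' hΘ' _ ih =>
    rw [hΔ', hΘ', map_sum, map_sum, map_sum]
    refine Finset.sum_congr rfl fun i _ => ?_
    rw [qC_smul, qC_smul, map_smul]
    -- Components with coefficient zero need not lie in the support of the sum, so nothing is known
    -- about their processes; they contribute nothing.
    by_cases h0 : p i = 0
    · simp [h0]
    · rw [ih i]
      intro C hC
      refine hΔ C ?_
      rw [hΔ', Finsupp.mem_support_iff, Finsupp.finsetSum_apply]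
      intro hz
      have := Finset.sum_eq_zero_iff.1 hz i (Finset.mem_univ i)
      rw [Finsupp.smul_apply, smul_eq_zero] at this
      exact this.elim h0 (Finsupp.mem_support_iff.1 hC)

/-! ### Mass, and the existence of transitions of distributions. -/

theorem mass_add {A : Type} (Δ Θ : A →₀ ℝ≥0) : mass (Δ + Θ) = mass Δ + mass Θ :=
  Finsupp.sum_add_index' (fun _ => rfl) (fun _ _ _ => rfl)

theorem mass_smul {A : Type} (p : ℝ≥0) (Δ : A →₀ ℝ≥0) : mass (p • Δ) = p * mass Δ := by
  rw [mass, mass, Finsupp.sum_smul_index (fun _ => rfl), Finsupp.mul_sum]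

theorem mass_sum {A ι : Type} (t : Finset ι) (Δ : ι → A →₀ ℝ≥0) :
    mass (∑ i ∈ t, Δ i) = ∑ i ∈ t, mass (Δ i) :=
  map_sum (⟨⟨mass, by simp [mass]⟩, mass_add⟩ : (A →₀ ℝ≥0) →+ ℝ≥0) Δ t

theorem exists_cstepBot (C : Conf S) (μ : Act) (s : Sched) : ∃ Θ : SDist (Conf S), CStepBot μ s C Θ := by
  by_cases hex : ∃ L : List (SO S × Proc), KStep C.2 μ s L
  · obtain ⟨L, hL⟩ := hex
    obtain ⟨Δ, h, e⟩ := hL.cstep C.1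
    have hm : ((mass Δ : ℝ) : ℂ) = 1 := by
      rw [← trace_tot_qC, e, hL.trace_tot, C.1.2.2]
    have hm' : mass Δ = 1 := by exact_mod_cast hm
    exact ⟨⟨Δ, hm'.le⟩, Or.inl h⟩
  · refine ⟨⟨0, by simp [mass]⟩, Or.inr ⟨rfl, fun Δ h => ?_⟩⟩
    obtain ⟨L, hL, -⟩ := h.kstep
    exact hex ⟨L, hL⟩

/-- Every configuration moves, if only to the empty distribution; these moves are combined over the
support. A matching step thus always exists, and in the bisimulation proofs only its outcome has to
be controlled. -/
theorem exists_dstep (Δ : SDist (Conf S)) (μ : Act) (s : Sched) : ∃ Θ, DStep Δ μ s Θ := by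
  choose Θ hΘ using fun C : Conf S => exists_cstepBot C μ s
  let e := Δ.1.support.equivFin.symm
  have hsum : Δ.1 = ∑ i, Δ.1 (e i).1 • (SDist.point (e i).1).1 := by
    rw [Equiv.sum_comp e fun C : Δ.1.support => Δ.1 C.1 • (SDist.point C.1).1,
      Finset.sum_coe_sort Δ.1.support fun C => Δ.1 C • (SDist.point C).1]
    conv_lhs => rw [← Finsupp.sum_single Δ.1]
    refine Finset.sum_congr rfl fun C _ => ?_
    simp [SDist.point]
  have hmass : mass Δ.1 = ∑ i, Δ.1 (e i).1 := by
    conv_lhs => rw [hsum]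
    rw [mass_sum]
    refine Finset.sum_congr rfl fun i _ => ?_
    rw [mass_smul]
    simp [SDist.point, mass]
  refine ⟨⟨∑ i, Δ.1 (e i).1 • (Θ (e i).1).1, ?_⟩, ?_⟩
  · rw [mass_sum]
    refine le_trans (Finset.sum_le_sum fun i _ => ?_) (hmass ▸ Δ.2)
    rw [mass_smul]
    exact mul_le_of_le_one_right' (Θ _).2
  · refine .linear (fun i => Δ.1 (e i).1) (fun i => ?_) (fun i => SDist.point (e i).1)
      (fun i => Θ (e i).1) _ _ hsum rfl fun i => .point (hΘ _)
    refine le_trans ?_ Δ.2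
    rw [hmass]
    exact Finset.single_le_sum (f := fun i => Δ.1 (e i).1) (fun _ _ => zero_le) (Finset.mem_univ i)

/-! ### Determinism of parallel compositions -/

theorem CStep.sched_tags {ρ : Density S} {P : Proc} {μ : Act} {s : Sched} {Δ : Conf S →₀ ℝ≥0}
    (h : CStep ρ P μ s Δ) : s.tags ⊆ P.tags := by
  obtain ⟨L, hL, -⟩ := h.kstep
  exact hL.sched_tags

theorem Sched.tags_absurd {s : Sched} {A B : Finset ℕ} (hd : Disjoint A B) (h1 : s.tags ⊆ A)
    (h2 : s.tags ⊆ B) : False := by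
  obtain ⟨t, ht⟩ : s.tags.Nonempty := by cases s <;> simp [Sched.tags]
  exact Finset.disjoint_left.1 hd (h1 ht) (h2 ht)

theorem Sched.two_tags_subset {t t' : ℕ} {A : Finset ℕ} :
    (Sched.two t t').tags ⊆ A ↔ (Sched.one t).tags ⊆ A ∧ (Sched.one t').tags ⊆ A := by
  simp [Sched.tags, Finset.insert_subset_iff]

theorem single_conf_inj {ρ : Density S} {P P' : Proc}
    (h : (Finsupp.single (ρ, P) 1 : Conf S →₀ ℝ≥0) = Finsupp.single (ρ, P') 1) : P = P' := by
  have := (Finsupp.single_left_inj (one_ne_zero : (1 : ℝ≥0) ≠ 0)).1 h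
  exact (Prod.mk.inj this).2

/-- With disjoint tags the scheduler reveals which component moves, or that both synchronize. -/
theorem Proc.StepDeterministic.par {X Y : Proc} (hX : X.StepDeterministic)
    (hY : Y.StepDeterministic) (hd : Disjoint X.tags Y.tags) :
    (Proc.par X Y).StepDeterministic := by
  intro S G ρ hG hGS s μ μ' Δ Δ' h h'
  obtain ⟨G₁, G₂, -, rfl, h1, h2⟩ := hG.par_inv
  have dX := hX S G₁ ρ h1 (Finset.subset_union_left.trans hGS)
  have dY := hY S G₂ ρ h2 (Finset.subset_union_right.trans hGS)
  cases h with
  | parL hμ a =>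
    cases h' with
    | parL hμ' b =>
      rcases dX _ _ _ _ _ a b with ⟨rfl, rfl⟩ | h
      · exact Or.inl ⟨rfl, rfl⟩
      · exact Or.inr h
    | parR _ b => exact (Sched.tags_absurd hd a.sched_tags b.sched_tags).elim
    | synchL _ c =>
      exact (Sched.tags_absurd hd (Sched.two_tags_subset.1 a.sched_tags).2 c.sched_tags).elim
    | synchR _ c =>
      exact (Sched.tags_absurd hd (Sched.two_tags_subset.1 a.sched_tags).2 c.sched_tags).elim
  | parR hμ a =>
    cases h' with
    | parL _ b => exact (Sched.tags_absurd hd b.sched_tags a.sched_tags).elim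
    | parR hμ' b =>
      rcases dY _ _ _ _ _ a b with ⟨rfl, rfl⟩ | h
      · exact Or.inl ⟨rfl, rfl⟩
      · exact Or.inr h
    | synchL b _ =>
      exact (Sched.tags_absurd hd b.sched_tags (Sched.two_tags_subset.1 a.sched_tags).1).elim
    | synchR b _ =>
      exact (Sched.tags_absurd hd b.sched_tags (Sched.two_tags_subset.1 a.sched_tags).1).elim
  | synchL a1 a2 =>
    cases h' with
    | parL _ b =>
      exact (Sched.tags_absurd hd (Sched.two_tags_subset.1 b.sched_tags).2 a2.sched_tags).elim
    | parR _ b =>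
      exact (Sched.tags_absurd hd a1.sched_tags (Sched.two_tags_subset.1 b.sched_tags).1).elim
    | synchL b1 b2 =>
      -- The sender is unambiguous, so channel and value are fixed; this removes the receiver's
      -- freedom to choose a value.
      rcases dX _ _ _ _ _ a1 b1 with ⟨e, e1⟩ | ⟨-, c, v, v', e, -⟩
      · cases e
        rcases dY _ _ _ _ _ a2 b2 with ⟨-, e2⟩ | ⟨h, -⟩
        · rw [single_conf_inj e1, single_conf_inj e2]
          exact Or.inl ⟨rfl, rfl⟩
        · exact absurd rfl h
      · cases e
    | synchR b1 b2 =>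
      rcases dX _ _ _ _ _ a1 b1 with ⟨e, -⟩ | ⟨-, c, v, v', e, -⟩ <;> cases e
  | synchR a1 a2 =>
    cases h' with
    | parL _ b =>
      exact (Sched.tags_absurd hd (Sched.two_tags_subset.1 b.sched_tags).2 a2.sched_tags).elim
    | parR _ b =>
      exact (Sched.tags_absurd hd a1.sched_tags (Sched.two_tags_subset.1 b.sched_tags).1).elim
    | synchL b1 b2 =>
      rcases dX _ _ _ _ _ a1 b1 with ⟨e, -⟩ | ⟨-, c, v, v', -, e⟩ <;> cases e
    | synchR b1 b2 =>
      rcases dY _ _ _ _ _ a2 b2 with ⟨e, e2⟩ | ⟨-, c, v, v', e, -⟩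
      · cases e
        rcases dX _ _ _ _ _ a1 b1 with ⟨-, e1⟩ | ⟨h, -⟩
        · rw [single_conf_inj e1, single_conf_inj e2]
          exact Or.inl ⟨rfl, rfl⟩
        · exact absurd rfl h
      · cases e

theorem CStep.tags_subset {ρ : Density S} {P : Proc} {μ : Act} {s : Sched} {Δ : Conf S →₀ ℝ≥0}
    (h : CStep ρ P μ s Δ) {C : Conf S} (hC : C ∈ Δ.support) : C.2.tags ⊆ P.tags := by
  obtain ⟨L, hL, e⟩ := h.kstep
  have := qC_ne_zero hC
  rw [e] at this
  obtain ⟨Φ, hΦ⟩ := mem_of_qval_ne_zero this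
  exact hL.tags_subset _ hΦ

theorem exists_of_mem_support_mapDomain {A B : Type} {f : A → B} {Δ : A →₀ ℝ≥0} {b : B}
    (h : b ∈ (Δ.mapDomain f).support) : ∃ a ∈ Δ.support, f a = b := by
  classical
  exact Finset.mem_image.1 (Finsupp.mapDomain_support h)

theorem Proc.Derivative.par_inv {X Y Z : Proc} (h : (Proc.par X Y).Derivative Z) :
    ∃ X' Y', Z = .par X' Y' ∧ (X = X' ∨ X.Derivative X') ∧ (Y = Y' ∨ Y.Derivative Y') ∧
      X'.tags ⊆ X.tags ∧ Y'.tags ⊆ Y.tags := by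
  obtain ⟨S, G, ρ, ρ', μ, s, Δ, hG, hGS, h, hm⟩ := h
  obtain ⟨G₁, G₂, -, rfl, h1, h2⟩ := hG.par_inv
  have s1 := Finset.subset_union_left.trans hGS
  have s2 := Finset.subset_union_right.trans hGS
  have hsup : ∀ P : Proc, (ρ, P) ∈ (Finsupp.single (ρ, P) 1 : Conf S →₀ ℝ≥0).support := by
    intro P; simp
  cases h with
  | parL _ a =>
    obtain ⟨C, hC, e⟩ := exists_of_mem_support_mapDomain hm
    cases e
    exact ⟨C.2, Y, rfl, Or.inr ⟨S, G₁, ρ, C.1, μ, s, _, h1, s1, a, hC⟩, Or.inl rfl,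
      a.tags_subset hC, subset_rfl⟩
  | parR _ a =>
    obtain ⟨C, hC, e⟩ := exists_of_mem_support_mapDomain hm
    cases e
    exact ⟨X, C.2, rfl, Or.inl rfl, Or.inr ⟨S, G₂, ρ, C.1, μ, s, _, h2, s2, a, hC⟩,
      subset_rfl, a.tags_subset hC⟩
  | synchL a b =>
    have e := Finset.mem_singleton.1 (Finsupp.support_single_subset hm)
    cases e
    exact ⟨_, _, rfl, Or.inr ⟨S, G₁, ρ, ρ, _, _, _, h1, s1, a, hsup _⟩,
      Or.inr ⟨S, G₂, ρ, ρ, _, _, _, h2, s2, b, hsup _⟩, a.tags_subset (hsup _),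
      b.tags_subset (hsup _)⟩
  | synchR a b =>
    have e := Finset.mem_singleton.1 (Finsupp.support_single_subset hm)
    cases e
    exact ⟨_, _, rfl, Or.inr ⟨S, G₁, ρ, ρ, _, _, _, h1, s1, a, hsup _⟩,
      Or.inr ⟨S, G₂, ρ, ρ, _, _, _, h2, s2, b, hsup _⟩, a.tags_subset (hsup _),
      b.tags_subset (hsup _)⟩

theorem Proc.Deterministic.par {P R : Proc} (hP : P.Deterministic) (hR : R.Deterministic)
    (hd : Disjoint P.tags R.tags) : (Proc.par P R).Deterministic := by
  have key : ∀ Z, Relation.ReflTransGen Proc.Derivative (Proc.par P R) Z →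
      ∃ X Y, Z = .par X Y ∧ Relation.ReflTransGen Proc.Derivative P X ∧
        Relation.ReflTransGen Proc.Derivative R Y ∧ X.tags ⊆ P.tags ∧ Y.tags ⊆ R.tags := by
    intro Z hZ
    induction hZ with
    | refl => exact ⟨P, R, rfl, .refl, .refl, subset_rfl, subset_rfl⟩
    | tail _ hstep ih =>
      obtain ⟨X, Y, rfl, hX, hY, tX, tY⟩ := ih
      obtain ⟨X', Y', rfl, dX, dY, tX', tY'⟩ := hstep.par_inv
      refine ⟨X', Y', rfl, ?_, ?_, tX'.trans tX, tY'.trans tY⟩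
      · rcases dX with rfl | dX
        · exact hX
        · exact hX.tail dX
      · rcases dY with rfl | dY
        · exact hY
        · exact hY.tail dY
  intro Z hZ
  obtain ⟨X, Y, rfl, hX, hY, tX, tY⟩ := key Z hZ
  exact (hP X hX).par (hR Y hY) (hd.mono tX tY)

theorem Good.par {G H : Finset ℕ} {P R : Proc} (hP : Good S G P) (hR : Good S H R)
    (hGH : Disjoint G H) (hd : Disjoint P.tags R.tags) : Good S (G ∪ H) (.par P R) :=
  ⟨hP.det.par hR.det hd, hP.hasType.par hR.hasType hGH, Finset.union_subset hP.subset hR.subset⟩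

/-! ### The transition operator on parallel compositions -/

/-- The first tag of a scheduler. -/
def Sched.fst : Sched → ℕ
  | .one t => t
  | .two t _ => t

/-- The last tag of a scheduler. -/
def Sched.last : Sched → ℕ
  | .one t => t
  | .two _ t => t

theorem Sched.fst_mem (s : Sched) : s.fst ∈ s.tags := by cases s <;> simp [Sched.fst, Sched.tags]

theorem Sched.last_mem (s : Sched) : s.last ∈ s.tags := by cases s <;> simp [Sched.last, Sched.tags]

theorem KStep.one_mem {P : Proc} {μ : Act} {t : ℕ} {L : List (SO S × Proc)}
    (h : KStep P μ (.one t) L) : t ∈ P.tags := h.sched_tags (by simp [Sched.tags])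

section Par

variable {G H : Finset ℕ} {P R : Proc}

/-- In a step by R alone, and in any synchronization, the last tag of the scheduler belongs to R. If
it does not, only P can move. -/
theorem stepL_par_left (hP : Good S G P) (hR : Good S H R) (hGH : Disjoint G H)
    (hd : Disjoint P.tags R.tags) {μ : Act} {s : Sched} (hs : s.last ∉ R.tags)
    (hμ : ∀ c q, μ = .recv c (.qubit q) → q ∉ H) (X : Op S) :
    stepL (.par P R) μ s X = mapV (fun P' => .par P' R) (stepL P μ s X) := by
  have hPR := hP.par hR hGH hd
  by_cases hex : ∃ L : List (SO S × Proc), KStep P μ s L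
  · obtain ⟨L, hL⟩ := hex
    rw [hPR.stepL_eq (.parL (fun c q h => hR.hasType.notOwns_iff.2 (hμ c q h)) hL), hP.stepL_eq hL,
      qval_map (fun P' => .par P' R)]
    rfl
  · rw [stepL_eq_zero (P := P) (by simpa using hex), stepL_eq_zero]
    · simp
    · intro L h
      cases h with
      | parL _ h => exact hex ⟨_, h⟩
      | parR _ h => exact hs (h.sched_tags s.last_mem)
      | synchL _ h => exact hs h.one_mem
      | synchR _ h => exact hs h.one_mem

theorem stepL_par_left_owned (hR : Good S H R) {c : Chan} {q : ℕ} {s : Sched}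
    (hs : s.last ∉ R.tags) (hq : q ∈ H) :
    (stepL (.par P R) (.recv c (.qubit q)) s : Op S →ₗ[ℂ] QV S) = 0 := by
  refine stepL_eq_zero fun L h => ?_
  cases h with
  | parL hμ _ => exact hR.hasType.notOwns_iff.1 (hμ c q rfl) hq
  | parR _ h => exact hs (h.sched_tags s.last_mem)

theorem stepL_par_right (hP : Good S G P) (hR : Good S H R) (hGH : Disjoint G H)
    (hd : Disjoint P.tags R.tags) {μ : Act} {s : Sched} (hs : s.fst ∉ P.tags)
    (hμ : ∀ c q, μ = .recv c (.qubit q) → q ∉ G) (X : Op S) :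
    stepL (.par P R) μ s X = mapV (fun R' => .par P R') (stepL R μ s X) := by
  have hPR := hP.par hR hGH hd
  by_cases hex : ∃ L : List (SO S × Proc), KStep R μ s L
  · obtain ⟨L, hL⟩ := hex
    rw [hPR.stepL_eq (.parR (fun c q h => hP.hasType.notOwns_iff.2 (hμ c q h)) hL), hR.stepL_eq hL,
      qval_map (fun R' => .par P R')]
    rfl
  · rw [stepL_eq_zero (P := R) (by simpa using hex), stepL_eq_zero]
    · simp
    · intro L h
      cases h with
      | parL _ h => exact hs (h.sched_tags s.fst_mem)
      | parR _ h => exact hex ⟨_, h⟩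
      | synchL h _ => exact hs h.one_mem
      | synchR h _ => exact hs h.one_mem

theorem stepL_par_right_owned (hP : Good S G P) {c : Chan} {q : ℕ} {s : Sched}
    (hs : s.fst ∉ P.tags) (hq : q ∈ G) :
    (stepL (.par P R) (.recv c (.qubit q)) s : Op S →ₗ[ℂ] QV S) = 0 := by
  refine stepL_eq_zero fun L h => ?_
  cases h with
  | parL _ h => exact hs (h.sched_tags s.fst_mem)
  | parR hμ _ => exact hP.hasType.notOwns_iff.1 (hμ c q rfl) hq

theorem stepL_two_visible {μ : Act} (hμ : μ ≠ .tau) (t t' : ℕ) :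
    (stepL P μ (.two t t') : Op S →ₗ[ℂ] QV S) = 0 := by
  refine stepL_eq_zero fun L h => ?_
  obtain ⟨_, _, h, -⟩ := h.visible hμ
  cases h

theorem stepL_synch_recv (hP : Good S G P) (hR : Good S H R) (hGH : Disjoint G H)
    (hd : Disjoint P.tags R.tags) {c : Chan} {v : Value} {t t' : ℕ} {R' : Proc} (ht : t ∉ R.tags)
    (hR' : KStep R (.send c v) (.one t') [((LinearMap.id : SO S), R')]) (X : Op S) :
    stepL (.par P R) .tau (.two t t') X =
      mapV (fun P' => .par P' R') (stepL P (.recv c v) (.one t) X) := by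
  have hPR := hP.par hR hGH hd
  have ht' : t' ∉ P.tags := fun h => Finset.disjoint_left.1 hd h hR'.one_mem
  by_cases hex : ∃ L : List (SO S × Proc), KStep P (.recv c v) (.one t) L
  · obtain ⟨L, hL⟩ := hex
    obtain ⟨_, P', -, rfl⟩ := hL.visible (by simp)
    rw [hPR.stepL_eq (.synchR hL hR'), hP.stepL_eq hL]
    simp
  · rw [stepL_eq_zero (P := P) (by simpa using hex), stepL_eq_zero]
    · simp
    · intro L h
      cases h with
      | parL _ h => exact ht' (h.sched_tags (Sched.last_mem (.two t t')))
      | parR _ h => exact ht (h.sched_tags (Sched.fst_mem (.two t t')))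
      -- R already sends under t', so by determinism it cannot also receive under t'.
      | synchL _ h =>
        rcases hR.act_unique hR' h with e | ⟨_, _, _, e, -⟩ <;> cases e
      | synchR h1 h2 =>
        rcases hR.act_unique hR' h2 with e | ⟨_, _, _, e, -⟩
        · cases e; exact hex ⟨_, h1⟩
        · cases e

/-- P sends at most one value under t, so at most one summand is nonzero. The sum is there so that
one formula, linear in the left component, covers vectors whose processes send different values. -/
theorem stepL_synch_send (hP : Good S G P) (hR : Good S H R) (hGH : Disjoint G H)
    (hd : Disjoint P.tags R.tags) {c : Chan} {v₀ : Value} {t t' : ℕ} (ht : t ∉ R.tags)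
    {L₀ : List (SO S × Proc)} (hR₀ : KStep R (.recv c v₀) (.one t') L₀)
    {W : Finset Value} {r : Value → Proc}
    (hr : ∀ v ∈ W, KStep R (.recv c v) (.one t') [((LinearMap.id : SO S), r v)])
    (hW : ∀ v, (∃ L : List (SO S × Proc), KStep P (.send c v) (.one t) L) →
      (∃ L : List (SO S × Proc), KStep R (.recv c v) (.one t') L) → v ∈ W) (X : Op S) :
    stepL (.par P R) .tau (.two t t') X =
      ∑ v ∈ W, mapV (fun P' => .par P' (r v)) (stepL P (.send c v) (.one t) X) := by
  have hPR := hP.par hR hGH hd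
  have ht' : t' ∉ P.tags := fun h => Finset.disjoint_left.1 hd h hR₀.one_mem
  by_cases hex : ∃ v ∈ W, ∃ L : List (SO S × Proc), KStep P (.send c v) (.one t) L
  · obtain ⟨v, hv, L, hL⟩ := hex
    obtain ⟨_, P', -, rfl⟩ := hL.visible (by simp)
    rw [hPR.stepL_eq (.synchL hL (hr v hv)), Finset.sum_eq_single v]
    · rw [hP.stepL_eq hL]; simp
    · intro v' _ hne
      rw [stepL_eq_zero]
      · simp
      · intro L' hL'
        rcases hP.act_unique hL hL' with e | ⟨_, _, _, e, -⟩
        · cases e; exact hne rfl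
        · cases e
    · exact fun h => absurd hv h
  · rw [Finset.sum_eq_zero, stepL_eq_zero]
    · rfl
    · intro L h
      cases h with
      | parL _ h => exact ht' (h.sched_tags (Sched.last_mem (.two t t')))
      | parR _ h => exact ht (h.sched_tags (Sched.fst_mem (.two t t')))
      | @synchL _ _ _ _ c' v' _ _ h1 h2 =>
        have hc : c' = c := by
          rcases hR.act_unique hR₀ h2 with e | ⟨_, _, _, e, e'⟩
          · cases e; rfl
          · cases e; cases e'; rfl
        subst hc
        exact hex ⟨v', hW v' ⟨_, h1⟩ ⟨_, h2⟩, _, h1⟩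
      | synchR _ h =>
        rcases hR.act_unique hR₀ h with e | ⟨_, _, _, -, e⟩ <;> cases e
    · intro v hv
      rw [stepL_eq_zero]
      · simp
      · exact fun L hL => hex ⟨v, hv, L, hL⟩

theorem stepL_synch_none (hd : Disjoint P.tags R.tags) {t t' : ℕ} (ht : t ∉ R.tags)
    (ht' : t' ∈ R.tags)
    (hR : ∀ (c : Chan) (v : Value) (L : List (SO S × Proc)),
      ¬ KStep R (.send c v) (.one t') L ∧ ¬ KStep R (.recv c v) (.one t') L) :
    (stepL (.par P R) .tau (.two t t') : Op S →ₗ[ℂ] QV S) = 0 := by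
  refine stepL_eq_zero fun L h => ?_
  have ht'' : t' ∉ P.tags := fun h => Finset.disjoint_left.1 hd h ht'
  cases h with
  | parL _ h => exact ht'' (h.sched_tags (Sched.last_mem (.two t t')))
  | parR _ h => exact ht (h.sched_tags (Sched.fst_mem (.two t t')))
  | synchL _ h => exact (hR _ _ _).2 h
  | synchR _ h => exact (hR _ _ _).1 h

/-- Good processes with no tag in `A`. -/
def GoodOff (S G A : Finset ℕ) (P : Proc) : Prop := Good S G P ∧ Disjoint P.tags A

theorem stepV_goodOff {μ : Act} {s : Sched} {A : Finset ℕ} {D : QV S}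
    (hD : D ∈ Supp (GoodOff S G A)) : stepV μ s D ∈ Supp (GoodOff S (μ.after G) A) := by
  refine stepV_mem_supp (fun _ h => h.1) (fun P L hP hL X P' h => ?_) hD
  obtain ⟨Φ, hΦ⟩ := mem_of_qval_ne_zero h
  exact ⟨hP.1.of_kstep hL h, hP.2.mono_left (hL.tags_subset _ hΦ)⟩

theorem Supp.mono {p p' : Proc → Prop} (h : ∀ P, p P → p' P) :
    (Supp p : Submodule ℂ (QV S)) ≤ Supp p' :=
  Finsupp.supported_mono fun P hP => h P hP

/-! ### Extension of the parallel composition rules from processes to quantum vectors. -/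

theorem stepV_par_left (hR : Good S H R) (hGH : Disjoint G H) {μ : Act} {s : Sched}
    (hs : s.last ∉ R.tags) (hμ : ∀ c q, μ = .recv c (.qubit q) → q ∉ H) {D : QV S}
    (hD : D ∈ Supp (GoodOff S G R.tags)) :
    stepV μ s (mapV (fun P' => .par P' R) D) = mapV (fun P' => .par P' R) (stepV μ s D) := by
  refine supp_ext (f := stepV μ s ∘ₗ mapV fun P' => .par P' R)
    (g := (mapV fun P' => .par P' R) ∘ₗ stepV μ s) (fun P X hP => ?_) hD
  simp only [LinearMap.comp_apply, mapV_single, stepV_single]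
  exact stepL_par_left hP.1 hR hGH hP.2 hs hμ X

theorem stepV_par_left_owned (hR : Good S H R) {c : Chan} {q : ℕ} {s : Sched}
    (hs : s.last ∉ R.tags) (hq : q ∈ H) (D : QV S) :
    stepV (.recv c (.qubit q)) s (mapV (fun P' => .par P' R) D) = 0 := by
  refine supp_ext (p := fun _ => True)
    (f := stepV (.recv c (.qubit q)) s ∘ₗ mapV fun P' => .par P' R) (g := 0)
    (fun P X _ => ?_) (by simp [mem_supp])
  simp only [LinearMap.comp_apply, mapV_single, stepV_single]
  rw [stepL_par_left_owned hR hs hq, LinearMap.zero_apply, LinearMap.zero_apply]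

theorem stepV_par_right (hR : Good S H R) (hGH : Disjoint G H) {μ : Act} {s : Sched}
    (hs : s.fst ∈ R.tags) (hμ : ∀ c q, μ = .recv c (.qubit q) → q ∉ G)
    {L : List (SO S × Proc)} (hL : KStep R μ s L) {D : QV S}
    (hD : D ∈ Supp (GoodOff S G R.tags)) :
    stepV μ s (mapV (fun P' => .par P' R) D) =
      (L.map fun x => mapV (fun P' => .par P' x.2) (opV x.1 D)).sum := by
  have e : ∀ D : QV S, (L.map fun x => mapV (fun P' => .par P' x.2) (opV x.1 D)).sum =
      (L.map fun x : SO S × Proc => (mapV (fun P' => .par P' x.2)) ∘ₗ opV x.1).sum D := by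
    intro D
    clear hL
    induction L with
    | nil => simp
    | cons x L ih =>
      rw [List.map_cons, List.sum_cons, List.map_cons, List.sum_cons, LinearMap.add_apply, ih]
      rfl
  rw [e]
  refine supp_ext (f := stepV μ s ∘ₗ mapV fun P' => .par P' R) (fun P X hP => ?_) hD
  rw [← e]
  simp only [LinearMap.comp_apply, mapV_single, stepV_single, opV_single]
  rw [stepL_par_right hP.1 hR hGH hP.2 (fun h => Finset.disjoint_left.1 hP.2 h hs) hμ,
    hR.stepL_eq hL]
  clear e hL
  induction L with
  | nil => simp
  | cons x L ih => rw [qval_cons, map_add, ih, mapV_single, List.map_cons, List.sum_cons]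

theorem stepV_par_right_none {μ : Act} {s : Sched}
    (hs : s.fst ∈ R.tags) (hL : ∀ L : List (SO S × Proc), ¬ KStep R μ s L) {D : QV S}
    (hD : D ∈ Supp (GoodOff S G R.tags)) :
    stepV μ s (mapV (fun P' => .par P' R) D) = 0 := by
  refine supp_ext (f := stepV μ s ∘ₗ mapV fun P' => .par P' R) (g := 0) (fun P X hP => ?_) hD
  simp only [LinearMap.comp_apply, mapV_single, stepV_single]
  have hs' : s.fst ∉ P.tags := fun h => Finset.disjoint_left.1 hP.2 h hs
  rw [stepL_eq_zero, LinearMap.zero_apply, LinearMap.zero_apply]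
  intro L h
  cases h with
  | parL _ h => exact hs' (h.sched_tags s.fst_mem)
  | parR _ h => exact hL _ h
  | synchL h _ => exact hs' h.one_mem
  | synchR h _ => exact hs' h.one_mem

theorem stepV_par_right_owned {c : Chan} {q : ℕ} {s : Sched} (hs : s.fst ∈ R.tags) (hq : q ∈ G)
    {D : QV S} (hD : D ∈ Supp (GoodOff S G R.tags)) :
    stepV (.recv c (.qubit q)) s (mapV (fun P' => .par P' R) D) = 0 := by
  refine supp_ext (f := stepV (.recv c (.qubit q)) s ∘ₗ mapV fun P' => .par P' R) (g := 0)
    (fun P X hP => ?_) hD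
  simp only [LinearMap.comp_apply, mapV_single, stepV_single]
  rw [stepL_par_right_owned hP.1 (fun h => Finset.disjoint_left.1 hP.2 h hs) hq,
    LinearMap.zero_apply, LinearMap.zero_apply]

theorem stepV_two_visible {μ : Act} (hμ : μ ≠ .tau) (t t' : ℕ) (D : QV S) :
    stepV μ (.two t t') D = 0 := by
  refine supp_ext (p := fun _ => True) (f := stepV μ (.two t t')) (g := 0) (fun P X _ => ?_)
    (by simp [mem_supp])
  rw [stepV_single, stepL_two_visible hμ, LinearMap.zero_apply, LinearMap.zero_apply]

theorem stepV_synch_recv (hR : Good S H R) (hGH : Disjoint G H) {c : Chan} {v : Value} {t t' : ℕ}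
    {R' : Proc} (ht : t ∉ R.tags)
    (hR' : KStep R (.send c v) (.one t') [((LinearMap.id : SO S), R')]) {D : QV S}
    (hD : D ∈ Supp (GoodOff S G R.tags)) :
    stepV .tau (.two t t') (mapV (fun P' => .par P' R) D) =
      mapV (fun P' => .par P' R') (stepV (.recv c v) (.one t) D) := by
  refine supp_ext (f := stepV .tau (.two t t') ∘ₗ mapV fun P' => .par P' R)
    (g := (mapV fun P' => .par P' R') ∘ₗ stepV (.recv c v) (.one t)) (fun P X hP => ?_) hD
  simp only [LinearMap.comp_apply, mapV_single, stepV_single]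
  exact stepL_synch_recv hP.1 hR hGH hP.2 ht hR' X

theorem stepV_synch_none {t t' : ℕ} (ht : t ∉ R.tags) (ht' : t' ∈ R.tags)
    (hR : ∀ (c : Chan) (v : Value) (L : List (SO S × Proc)),
      ¬ KStep R (.send c v) (.one t') L ∧ ¬ KStep R (.recv c v) (.one t') L) {D : QV S}
    (hD : D ∈ Supp (GoodOff S G R.tags)) :
    stepV .tau (.two t t') (mapV (fun P' => .par P' R) D) = 0 := by
  refine supp_ext (f := stepV .tau (.two t t') ∘ₗ mapV fun P' => .par P' R) (g := 0)
    (fun P X hP => ?_) hD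
  simp only [LinearMap.comp_apply, mapV_single, stepV_single]
  rw [stepL_synch_none hP.2 ht ht' hR, LinearMap.zero_apply, LinearMap.zero_apply]

/-- Each process of the finite support sends at most one value. Hence a reception by R, which offers
a choice of values, still gives a finite sum. -/
theorem finite_sent (D : QV S) (hD : D ∈ Supp (Good S G)) (c : Chan) (s : Sched) :
    {v | ∃ P ∈ D.support, ∃ L : List (SO S × Proc), KStep P (.send c v) s L}.Finite := by
  have : {v | ∃ P ∈ D.support, ∃ L : List (SO S × Proc), KStep P (.send c v) s L} =
      ⋃ P ∈ D.support, {v | ∃ L : List (SO S × Proc), KStep P (.send c v) s L} := by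
    ext v; simp
  rw [this]
  refine Set.Finite.biUnion D.support.finite_toSet fun P hP => Set.Subsingleton.finite ?_
  rintro v ⟨L, hL⟩ v' ⟨L', hL'⟩
  rcases (mem_supp.1 hD P (Finsupp.mem_support_iff.1 hP)).act_unique hL hL' with e | ⟨_, _, _, e, -⟩
  · cases e; rfl
  · cases e

/-- A reception of the process on the right: there is one summand for each value that may be sent
from the left. -/
theorem stepV_synch_send (hR : Good S H R) (hGH : Disjoint G H) {c : Chan} {v₀ : Value} {t t' : ℕ}
    (ht : t ∉ R.tags) {L₀ : List (SO S × Proc)} (hR₀ : KStep R (.recv c v₀) (.one t') L₀)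
    {D : QV S} (hD : D ∈ Supp (GoodOff S G R.tags)) :
    ∃ (W : Finset Value) (r : Value → Proc),
      (∀ v ∈ W, KStep R (.recv c v) (.one t') [((LinearMap.id : SO S), r v)]) ∧
      (∀ v ∉ W, ∀ L : List (SO S × Proc), KStep R (.recv c v) (.one t') L →
        stepV (.send c v) (.one t) D = 0) ∧
      stepV .tau (.two t t') (mapV (fun P' => .par P' R) D) =
        ∑ v ∈ W, mapV (fun P' => .par P' (r v)) (stepV (.send c v) (.one t) D) := by
  classical
  have hfin := finite_sent D (Supp.mono (fun _ h => h.1) hD) c (.one t)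
  have hr : ∀ v, (∃ L : List (SO S × Proc), KStep R (.recv c v) (.one t') L) →
      ∃ R', KStep R (.recv c v) (.one t') [((LinearMap.id : SO S), R')] := by
    rintro v ⟨L, hL⟩
    obtain ⟨_, R', -, rfl⟩ := hL.visible (by simp)
    exact ⟨R', hL⟩
  let r : Value → Proc := fun v =>
    if h : ∃ L : List (SO S × Proc), KStep R (.recv c v) (.one t') L then (hr v h).choose else R
  let W := hfin.toFinset.filter fun v => ∃ L : List (SO S × Proc), KStep R (.recv c v) (.one t') L
  have hWr : ∀ v ∈ W, KStep R (.recv c v) (.one t') [((LinearMap.id : SO S), r v)] := by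
    intro v hv
    have h := (Finset.mem_filter.1 hv).2
    simp only [r, dif_pos h]
    exact (hr v h).choose_spec
  have hD' : D ∈ Supp fun P => GoodOff S G R.tags P ∧ P ∈ D.support :=
    mem_supp.2 fun P hP => ⟨mem_supp.1 hD P hP, Finsupp.mem_support_iff.2 hP⟩
  refine ⟨W, r, hWr, fun v hv L hL => ?_, ?_⟩
  · rw [stepV_eq_sum]
    refine Finset.sum_eq_zero fun P hP => ?_
    rw [stepL_eq_zero]
    · rfl
    · intro L' hL'
      exact hv (Finset.mem_filter.2 ⟨hfin.mem_toFinset.2 ⟨P, hP, L', hL'⟩, L, hL⟩)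
  · have e : ∀ D : QV S, ∑ v ∈ W, mapV (fun P' => .par P' (r v)) (stepV (.send c v) (.one t) D) =
        (∑ v ∈ W, (mapV fun P' => .par P' (r v)) ∘ₗ stepV (.send c v) (.one t)) D := by
      intro D; rw [LinearMap.sum_apply]; rfl
    rw [e]
    refine supp_ext (f := stepV .tau (.two t t') ∘ₗ mapV fun P' => .par P' R) (fun P X hP => ?_) hD'
    rw [← e]
    simp only [LinearMap.comp_apply, mapV_single, stepV_single]
    refine stepL_synch_send hP.1.1 hR hGH hP.1.2 ht hR₀ hWr (fun v h1 h2 => ?_) X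
    obtain ⟨L, hL⟩ := h1
    exact Finset.mem_filter.2 ⟨hfin.mem_toFinset.2 ⟨P, hP.2, L, hL⟩, h2⟩

end Par

/-! ### Families of indistinguishable differences -/

/-- Families of subspaces of quantum vectors, indexed by types, that consist of differences which
no environment can observe. -/
structure ClosedFamily (M : Finset ℕ → Submodule ℂ (QV S)) : Prop where
  good : ∀ G, M G ≤ Supp (Good S G)
  env : ∀ G, ∀ Z ∈ M G, ∀ N : Op S, Off G N → (N * tot Z).trace = 0
  step : ∀ G, ∀ Z ∈ M G, ∀ μ s, stepV μ s Z ∈ M (μ.after G)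
  conj : ∀ G, ∀ Z ∈ M G, ∀ K : Op S, Off G K → opV (conjL K) Z ∈ M G

theorem stepV_fits {G : Finset ℕ} {Z : QV S} (hZ : Z ∈ Supp (Good S G)) {μ : Act} {s : Sched}
    (h0 : stepV μ s Z ≠ 0) : μ.Fits S G := by
  by_contra hno
  refine h0 (supp_ext (f := stepV μ s) (g := 0) (fun P X hP => ?_) hZ)
  rw [stepV_single, stepL_eq_zero fun L hL => hno (hL.fits hP.hasType)]
  rfl

/-- Several targets may be the same process, but their weights are positive semidefinite and cannot
cancel. -/
theorem qval_eq_zero_of_mem {L : List (SO S × Proc)} {G : Finset ℕ}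
    (hL : ∀ x ∈ L, x.1 ∈ LocalMap G) {X : Op S} (hX : X.PosSemidef) {x : SO S × Proc} (hx : x ∈ L)
    (h : qval L X x.2 = 0) : x.1 X = 0 := by
  classical
  induction L with
  | nil => cases hx
  | cons y L ih =>
    have hL' : ∀ x ∈ L, x.1 ∈ LocalMap G := fun z hz => hL z (List.mem_cons_of_mem _ hz)
    rw [qval_cons, Finsupp.add_apply] at h
    have h1 : (Finsupp.single y.2 (y.1 X) x.2).PosSemidef := by
      rw [Finsupp.single_apply]
      split_ifs
      · exact posSemidef_of_localMap (hL y List.mem_cons_self) hX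
      · exact Matrix.PosSemidef.zero
    have h2 := qval_posSemidef hL' hX x.2
    rcases List.mem_cons.1 hx with rfl | hx
    · have := eq_zero_of_posSemidef_add h1 h2 h
      rwa [Finsupp.single_eq_same] at this
    · exact ih hL' hx (eq_zero_of_posSemidef_add h2 h1 (by rw [add_comm]; exact h))

/-- A target with zero superoperator is never reached, so determinism says nothing about it; every
other target is reached from some density operator. -/
theorem Good.of_mem {G : Finset ℕ} {P : Proc} (h : Good S G P) {μ : Act} {s : Sched}
    {L : List (SO S × Proc)} (hL : KStep P μ s L) {x : SO S × Proc} (hx : x ∈ L) (h0 : x.1 ≠ 0) :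
    Good S (μ.after G) x.2 := by
  obtain ⟨ρ, hρ⟩ : ∃ ρ : Density S, x.1 ρ.1 ≠ 0 := by
    by_contra hno
    push Not at hno
    exact h0 (ext_density fun ρ => by simpa using hno ρ)
  exact h.of_kstep hL fun h1 => hρ (qval_eq_zero_of_mem (hL.localMap h.hasType) ρ.2.1 hx h1)

theorem Good.of_visible {G : Finset ℕ} {P P' : Proc} (h : Good S G P) {μ : Act} {s : Sched}
    (hL : KStep P μ s [((LinearMap.id : SO S), P')]) : Good S (μ.after G) P' :=
  h.of_mem hL (List.mem_singleton_self _) fun h => one_ne_zero (LinearMap.congr_fun h (1 : Op S))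

theorem mapV_par_good {G H : Finset ℕ} {R : Proc} (hR : Good S H R) (hGH : Disjoint G H) {Z : QV S}
    (hZ : Z ∈ Supp (GoodOff S G R.tags)) :
    mapV (fun P => .par P R) Z ∈ Supp (Good S (G ∪ H)) := by
  refine supp_induction (C := fun Z => mapV (fun P => .par P R) Z ∈ Supp (Good S (G ∪ H)))
    (by simp) (fun D T h1 h2 => by rw [map_add]; exact add_mem h1 h2) (fun P X hP => ?_) hZ
  rw [mapV_single]
  exact single_mem_supp fun _ => hP.1.par hR hGH hP.2

theorem opV_apply (Φ : SO S) (Z : QV S) (P : Proc) : opV Φ Z P = Φ (Z P) := by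
  rw [Finsupp.mapRange.linearMap_apply, Finsupp.mapRange_apply]

theorem opV_zero (Z : QV S) : opV (0 : SO S) Z = 0 :=
  Finsupp.ext fun P => by rw [opV_apply]; rfl

theorem opV_add (Φ Ψ : SO S) (Z : QV S) : opV (Φ + Ψ) Z = opV Φ Z + opV Ψ Z :=
  Finsupp.ext fun P => by rw [Finsupp.add_apply, opV_apply, opV_apply, opV_apply]; rfl

/-- An operation of a parallel component is a sum of conjugations by operators on its own qubits,
which are environment for the vectors in M G. -/
theorem ClosedFamily.localMap {M : Finset ℕ → Submodule ℂ (QV S)} (hM : ClosedFamily M)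
    {G H : Finset ℕ} (hGH : Disjoint G H) {Φ : SO S} (hΦ : Φ ∈ LocalMap H) {Z : QV S}
    (hZ : Z ∈ M G) : opV Φ Z ∈ M G := by
  refine AddSubmonoid.closure_induction (motive := fun Φ _ => opV Φ Z ∈ M G) ?_ ?_ ?_ hΦ
  · rintro _ ⟨K, hK, rfl⟩
    have hoff : ∀ r : S, r.1 ∈ H → ¬ r.1 ∈ G := fun r hr hr' => Finset.disjoint_left.1 hGH hr' hr
    have hK' : Off G K := hK.mono hoff
    exact hM.conj G Z hZ K hK'
  · rw [opV_zero]
    exact zero_mem _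
  · intro Φ Ψ _ _ h1 h2
    rw [opV_add]
    exact add_mem h1 h2

/-- The family generated by the parallel compositions of the vectors of `M` with processes. -/
noncomputable def parFamily (M : Finset ℕ → Submodule ℂ (QV S)) (G : Finset ℕ) : Submodule ℂ (QV S) :=
  Submodule.span ℂ {Y | ∃ (G₁ H : Finset ℕ) (R : Proc) (Z : QV S), G = G₁ ∪ H ∧ Disjoint G₁ H ∧
    Good S H R ∧ Z ∈ M G₁ ∧ Z ∈ Supp (GoodOff S G₁ R.tags) ∧ Y = mapV (fun P => .par P R) Z}

theorem mem_parFamily {M : Finset ℕ → Submodule ℂ (QV S)} {G G₁ H : Finset ℕ} {R : Proc} {Z : QV S}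
    (hG : G = G₁ ∪ H) (hd : Disjoint G₁ H) (hR : Good S H R) (hZ : Z ∈ M G₁)
    (hZ' : Z ∈ Supp (GoodOff S G₁ R.tags)) : mapV (fun P => .par P R) Z ∈ parFamily M G :=
  Submodule.subset_span ⟨G₁, H, R, Z, hG, hd, hR, hZ, hZ', rfl⟩

theorem goodOff_mono {G A A' : Finset ℕ} (h : A' ⊆ A) {Z : QV S} (hZ : Z ∈ Supp (GoodOff S G A)) :
    Z ∈ Supp (GoodOff S G A') :=
  Supp.mono (fun _ hP => ⟨hP.1, hP.2.mono_right h⟩) hZ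

/-- The position of the tags of R in the scheduler decides the case. If both ends are in R, then R
acts, by conjugations of vectors of M. If only the last is, the sole possibility is a
synchronization, a labelled step on M. If the last is not, the left component moves alone. -/
theorem parFamily_step {M : Finset ℕ → Submodule ℂ (QV S)} (hM : ClosedFamily M)
    {G₁ H : Finset ℕ} {R : Proc} {Z : QV S} (hd : Disjoint G₁ H) (hR : Good S H R) (hZ : Z ∈ M G₁)
    (hZ' : Z ∈ Supp (GoodOff S G₁ R.tags)) (μ : Act) (s : Sched) :
    stepV μ s (mapV (fun P => .par P R) Z) ∈ parFamily M (μ.after (G₁ ∪ H)) := by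
  have hgood := hM.good G₁ hZ
  by_cases hlast : s.last ∈ R.tags
  · by_cases hfst : s.fst ∈ R.tags
    · by_cases hμ : ∀ c q, μ = .recv c (.qubit q) → q ∉ G₁
      · by_cases hex : ∃ L : List (SO S × Proc), KStep R μ s L
        · obtain ⟨L, hL⟩ := hex
          rw [stepV_par_right hR hd hfst hμ hL hZ']
          refine list_sum_mem fun Y hY => ?_
          obtain ⟨x, hx, rfl⟩ := List.mem_map.1 hY
          by_cases h0 : x.1 = 0
          · rw [h0, opV_zero, map_zero]
            exact zero_mem _
          · refine mem_parFamily ?_ (Act.Fits.after_disjoint hd.symm hμ).symm (hR.of_mem hL hx h0)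
              (hM.localMap hd (hL.localMap hR.hasType x hx) hZ)
              (goodOff_mono (hL.tags_subset x hx) (opV_mem_supp hZ'))
            rw [Finset.union_comm, (hL.fits hR.hasType).after_union hd.symm, Finset.union_comm]
        · rw [stepV_par_right_none hfst (by simpa using hex) hZ']
          exact zero_mem _
      · push Not at hμ
        obtain ⟨c, q, rfl, hq⟩ := hμ
        rw [stepV_par_right_owned hfst hq hZ']
        exact zero_mem _
    · obtain ⟨t, t', rfl⟩ : ∃ t t', s = .two t t' := by
        cases s with
        | one t => exact absurd hlast hfst
        | two t t' => exact ⟨t, t', rfl⟩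
      change t ∉ R.tags at hfst
      change t' ∈ R.tags at hlast
      by_cases hμ : μ = .tau
      · subst hμ
        by_cases hs : ∃ (c : Chan) (v : Value) (L : List (SO S × Proc)), KStep R (.send c v) (.one t') L
        · obtain ⟨c, v, L, hL⟩ := hs
          obtain ⟨_, R', -, rfl⟩ := hL.visible (by simp)
          rw [stepV_synch_recv hR hd hfst hL hZ']
          obtain ⟨e, hd'⟩ := synch_union (c := c) (c' := c) (v := v) hd.symm (hL.fits hR.hasType).2
          refine mem_parFamily ?_ hd'.symm (hR.of_visible hL) (hM.step _ _ hZ _ _)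
            (goodOff_mono (hL.tags_subset _ (List.mem_singleton_self _)) (stepV_goodOff hZ'))
          rw [Finset.union_comm ((Act.recv c v).after G₁), e, Finset.union_comm]
          rfl
        · by_cases hr : ∃ (c : Chan) (v : Value) (L : List (SO S × Proc)), KStep R (.recv c v) (.one t') L
          · obtain ⟨c, v, L, hL⟩ := hr
            obtain ⟨W, r, hr, -, e⟩ := stepV_synch_send hR hd hfst hL hZ'
            rw [e]
            refine sum_mem fun v hv => ?_
            by_cases h0 : stepV (.send c v) (.one t) Z = 0
            · rw [h0, map_zero]; exact zero_mem _
            · obtain ⟨e, hd'⟩ := synch_union (c := c) (c' := c) (v := v) hd (stepV_fits hgood h0).2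
              refine mem_parFamily e.symm hd' (hR.of_visible (hr v hv)) (hM.step _ _ hZ _ _)
                (goodOff_mono ((hr v hv).tags_subset _ (List.mem_singleton_self _))
                  (stepV_goodOff hZ'))
          · rw [stepV_synch_none hfst hlast (fun c v L => ⟨fun h => hs ⟨c, v, L, h⟩,
              fun h => hr ⟨c, v, L, h⟩⟩) hZ']
            exact zero_mem _
      · rw [stepV_two_visible hμ]
        exact zero_mem _
  · by_cases hμ : ∀ c q, μ = .recv c (.qubit q) → q ∉ H
    · rw [stepV_par_left hR hd hlast hμ hZ']
      by_cases h0 : stepV μ s Z = 0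
      · rw [h0, map_zero]; exact zero_mem _
      · exact mem_parFamily ((stepV_fits hgood h0).after_union hd) (Act.Fits.after_disjoint hd hμ) hR
          (hM.step _ _ hZ _ _) (stepV_goodOff hZ')
    · push Not at hμ
      obtain ⟨c, q, rfl, hq⟩ := hμ
      rw [stepV_par_left_owned hR hlast hq]
      exact zero_mem _

/-- Composition with R enlarges the owned set, so operators off the larger set are also off the
smaller one, and the environment conditions pass to the composite. -/
theorem ClosedFamily.par {M : Finset ℕ → Submodule ℂ (QV S)} (hM : ClosedFamily M) :
    ClosedFamily (parFamily M) where
  good G := by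
    refine Submodule.span_le.2 ?_
    rintro _ ⟨G₁, H, R, Z, rfl, hd, hR, -, hZ', rfl⟩
    exact mapV_par_good hR hd hZ'
  env G Z hZ N hN := by
    induction hZ using Submodule.span_induction with
    | mem Y hY =>
      obtain ⟨G₁, H, R, Z, rfl, hd, hR, hZ, -, rfl⟩ := hY
      rw [tot_mapV]
      exact hM.env G₁ Z hZ N (hN.mono fun r hr h => hr (Finset.mem_union_left _ h))
    | zero => simp
    | add x y _ _ h1 h2 => rw [map_add, mul_add, Matrix.trace_add, h1, h2, add_zero]
    | smul a x _ h => rw [map_smul, mul_smul_comm, Matrix.trace_smul, h, smul_zero]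
  step G Z hZ μ s := by
    induction hZ using Submodule.span_induction with
    | mem Y hY =>
      obtain ⟨G₁, H, R, Z, rfl, hd, hR, hZ, hZ', rfl⟩ := hY
      exact parFamily_step hM hd hR hZ hZ' μ s
    | zero => rw [map_zero]; exact zero_mem _
    | add x y _ _ h1 h2 => rw [map_add]; exact add_mem h1 h2
    | smul a x _ h => rw [map_smul]; exact Submodule.smul_mem _ _ h
  conj G Z hZ K hK := by
    induction hZ using Submodule.span_induction with
    | mem Y hY =>
      obtain ⟨G₁, H, R, Z, rfl, hd, hR, hZ, hZ', rfl⟩ := hY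
      rw [opV_mapV]
      exact mem_parFamily rfl hd hR
        (hM.conj G₁ Z hZ K (hK.mono fun r hr h => hr (Finset.mem_union_left _ h))) (opV_mem_supp hZ')
    | zero => rw [map_zero]; exact zero_mem _
    | add x y _ _ h1 h2 => rw [map_add]; exact add_mem h1 h2
    | smul a x _ h => rw [map_smul]; exact Submodule.smul_mem _ _ h

/-! ### The family of ground bisimilarity -/

/-- Good processes that are input-restricted. -/
def GoodIR (S G : Finset ℕ) (P : Proc) : Prop := Good S G P ∧ P.InputRestricted

theorem stepV_goodIR {μ : Act} {s : Sched} {G : Finset ℕ} {D : QV S}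
    (hD : D ∈ Supp (GoodIR S G)) : stepV μ s D ∈ Supp (GoodIR S (μ.after G)) := by
  refine stepV_mem_supp (fun _ h => h.1) (fun P L hP hL X P' h => ?_) hD
  obtain ⟨Φ, hΦ⟩ := mem_of_qval_ne_zero h
  refine ⟨hP.1.of_kstep hL h, ?_⟩
  have := hL.uic_subset _ hΦ
  rw [show P.uic = ∅ from hP.2] at this
  exact Set.subset_empty_iff.1 this

theorem stepV_recv_qubit {G : Finset ℕ} {D : QV S} (hD : D ∈ Supp (GoodIR S G)) (c : Chan) (q : ℕ)
    (s : Sched) : stepV (.recv c (.qubit q)) s D = 0 := by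
  refine supp_ext (f := stepV (.recv c (.qubit q)) s) (g := 0) (fun P X hP => ?_) hD
  rw [stepV_single, stepL_eq_zero]
  · rfl
  · intro L hL
    have h1 := hL.recv_mem_uic rfl (hL.fits hP.1.hasType).1.symm
    rw [show P.uic = ∅ from hP.2] at h1
    exact h1

/-- The vectors whose environment vanishes after the given sequence of transitions. -/
noncomputable def nullAfter : List (Act × Sched) → Finset ℕ → Submodule ℂ (QV S)
  | [], G =>
    { carrier := {Z | ∀ N : Op S, Off G N → (N * tot Z).trace = 0}
      zero_mem' := by simp
      add_mem' := fun h1 h2 N hN => by rw [map_add, mul_add, Matrix.trace_add, h1 N hN, h2 N hN, add_zero]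
      smul_mem' := fun a Z h N hN => by
        rw [map_smul, mul_smul_comm, Matrix.trace_smul, h N hN, smul_zero] }
  | (μ, s) :: w, G => (nullAfter w (μ.after G)).comap (stepV μ s)

/-- The operator K is commuted past all steps of the word and absorbed into the final test operator.
-/
theorem nullAfter_conj (w : List (Act × Sched)) {G : Finset ℕ} {Z : QV S} (hZ : Z ∈ Supp (GoodIR S G))
    (h : Z ∈ nullAfter w G) {K : Op S} (hK : Off G K) : opV (conjL K) Z ∈ nullAfter w G := by
  induction w generalizing G Z with
  | nil =>
    intro N hN
    rw [tot_opV, conjL_apply, ← mul_assoc, Matrix.trace_mul_comm, ← mul_assoc, ← mul_assoc]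
    -- By cyclicity, testing KXK* with N is testing X with K*NK, which is again an operator on the
    -- environment.
    exact h _ ((hK.star.mul hN).mul hK)
  | cons x w ih =>
    obtain ⟨μ, s⟩ := x
    change stepV μ s (opV (conjL K) Z) ∈ nullAfter w (μ.after G)
    rw [stepV_conjL_comm (Supp.mono (fun _ h => h.1) hZ) hK]
    by_cases hμ : ∃ c q, μ = .recv c (.qubit q)
    · obtain ⟨c, q, rfl⟩ := hμ
      rw [stepV_recv_qubit hZ, map_zero]
      exact zero_mem _
    -- Apart from qubit receptions, which are ruled out, actions never enlarge the owned set, so K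
    -- remains off it.
    · refine ih (stepV_goodIR hZ) h (hK.mono fun r hr hr' => hr ?_)
      rcases μ with _ | ⟨c, _ | _ | q⟩ | ⟨c, _ | _ | q⟩ <;> simp only [Act.after] at hr' <;>
        try exact hr'
      · exact Finset.mem_of_mem_erase hr'
      · exact absurd ⟨c, q, rfl⟩ hμ

/-- The differences of input-restricted processes that no sequence of transitions reveals. -/
noncomputable def groundFamily (G : Finset ℕ) : Submodule ℂ (QV S) :=
  Supp (GoodIR S G) ⊓ ⨅ w, nullAfter w G

theorem mem_groundFamily {G : Finset ℕ} {Z : QV S} :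
    Z ∈ groundFamily G ↔ Z ∈ Supp (GoodIR S G) ∧ ∀ w, Z ∈ nullAfter w G := by
  rw [groundFamily, Submodule.mem_inf, Submodule.mem_iInf]

theorem closedFamily_ground : ClosedFamily (groundFamily (S := S)) where
  good G := fun Z hZ => Supp.mono (fun _ h => h.1) (mem_groundFamily.1 hZ).1
  env G Z hZ := (mem_groundFamily.1 hZ).2 []
  step G Z hZ μ s := by
    rw [mem_groundFamily] at hZ ⊢
    exact ⟨stepV_goodIR hZ.1, fun w => hZ.2 ((μ, s) :: w)⟩
  conj G Z hZ K hK := by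
    rw [mem_groundFamily] at hZ ⊢
    exact ⟨opV_mem_supp hZ.1, fun w => nullAfter_conj w hZ.1 (hZ.2 w) hK⟩

theorem QTyped.of_supp {G : Finset ℕ} {D : QDist S} (hG : G ⊆ S) (hD : D.1 ∈ Supp (Good S G)) :
    QTyped G D :=
  ⟨hG, fun P hP => (mem_supp.1 hD P (Finsupp.mem_support_iff.1 hP)).hasType⟩

theorem QDist.env_eq_iff {G : Finset ℕ} {D T : QDist S} :
    D.env G = T.env G ↔ ∀ N : Op S, Off G N → (N * tot D.1).trace = (N * tot T.1).trace := by
  rw [QDist.env, QDist.env, ← tot_eq_sum, ← tot_eq_sum, partialTrace_eq_iff]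

/-- Steps are determined, so the matching step in the bisimulation must be the one given by `stepV`;
the environments are compared at the end of the word. -/
theorem IsGroundBisimulation.mem_nullAfter {R : QDist S → QDist S → Prop}
    (hR : IsGroundBisimulation R) (w : List (Act × Sched)) {G : Finset ℕ} {D T : QDist S} (h : R D T)
    (hD : D.1 ∈ Supp (Good S G)) (hT : T.1 ∈ Supp (Good S G)) (hG : G ⊆ S) :
    D.1 - T.1 ∈ nullAfter w G := by
  induction w generalizing G D T with
  | nil =>
    intro N hN
    have := QDist.env_eq_iff.1 (hR.env_eq D T h G (.of_supp hG hD) (.of_supp hG hT)) N hN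
    rw [map_sub, mul_sub, Matrix.trace_sub, this, sub_self]
  | cons x w ih =>
    obtain ⟨μ, s⟩ := x
    change stepV μ s (D.1 - T.1) ∈ nullAfter w (μ.after G)
    obtain ⟨T', hT', hR'⟩ := hR.forth D T h μ s _ (D.qstep_step hD μ s)
    have e1 : (D.step hD μ s).1 = stepV μ s D.1 := rfl
    have e2 := hT'.eq_stepV hT
    rw [map_sub, ← e1, ← e2]
    -- A nonzero outcome shows that the action fits the type, which keeps the owned set inside the
    -- register. If both outcomes vanish there is nothing left to compare.
    by_cases h0 : stepV μ s D.1 = 0 ∧ stepV μ s T.1 = 0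
    · rw [e1, e2, h0.1, h0.2, sub_self]
      exact zero_mem _
    · have hfit : μ.Fits S G := by
        rw [not_and_or] at h0
        rcases h0 with h0 | h0
        · exact stepV_fits hD h0
        · exact stepV_fits hT h0
      exact ih hR' (by rw [e1]; exact stepV_good hD) (by rw [e2]; exact stepV_good hT)
        (hfit.after_subset hG)

/-! ### Ground bisimilarity implies saturated bisimilarity -/

/-- Distributions of type `G` whose difference lies in a closed family. -/
def Indist (G : Finset ℕ) (Δ Θ : SDist (Conf S)) : Prop :=
  ∃ M : Finset ℕ → Submodule ℂ (QV S), ClosedFamily M ∧ G ⊆ S ∧ Δ.All (Good S G) ∧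
    Θ.All (Good S G) ∧ qC Δ.1 - qC Θ.1 ∈ M G

theorem Indist.symm {G : Finset ℕ} {Δ Θ : SDist (Conf S)} (h : Indist G Δ Θ) : Indist G Θ Δ := by
  obtain ⟨M, hM, hG, h1, h2, h3⟩ := h
  exact ⟨M, hM, hG, h2, h1, by rw [← neg_sub]; exact neg_mem h3⟩

/-- The environment condition is tested against the identity operator. -/
theorem Indist.mass_eq {G : Finset ℕ} {Δ Θ : SDist (Conf S)} (h : Indist G Δ Θ) :
    mass Δ.1 = mass Θ.1 := by
  obtain ⟨M, hM, -, -, -, h3⟩ := h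
  have := hM.env G _ h3 1 Acts.one
  rw [one_mul, map_sub, Matrix.trace_sub, trace_tot_qC, trace_tot_qC, sub_eq_zero] at this
  exact_mod_cast this

/-- The type is unique unless both distributions are empty; in that case their difference is zero
and lies in every member of the family. -/
theorem Indist.of_distTyped {G G' : Finset ℕ} {Δ Θ : SDist (Conf S)} (h : Indist G Δ Θ)
    (hΔ : DistTyped G' Δ) (hΘ : DistTyped G' Θ) : Indist G' Δ Θ := by
  by_cases h1 : ∃ C, C ∈ Δ.1.support
  · obtain ⟨C, hC⟩ := h1
    obtain ⟨M, hM, hG, h1, h2, h3⟩ := h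
    obtain rfl := (h1 C hC).hasType.unique (hΔ.2 C hC)
    exact ⟨M, hM, hG, h1, h2, h3⟩
  · by_cases h2 : ∃ C, C ∈ Θ.1.support
    · obtain ⟨C, hC⟩ := h2
      obtain ⟨M, hM, hG, h1, h2, h3⟩ := h
      obtain rfl := (h2 C hC).hasType.unique (hΘ.2 C hC)
      exact ⟨M, hM, hG, h1, h2, h3⟩
    · push Not at h1 h2
      obtain ⟨M, hM, -⟩ := h
      refine ⟨M, hM, hΔ.1, fun C hC => absurd hC (h1 C), fun C hC => absurd hC (h2 C), ?_⟩
      rw [Finsupp.support_eq_empty.1 (Finset.eq_empty_of_forall_notMem h1),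
        Finsupp.support_eq_empty.1 (Finset.eq_empty_of_forall_notMem h2), map_zero, sub_self]
      exact zero_mem _

theorem Context.qC_apply (B : Context) (Δ : SDist (Conf S)) :
    qC (B.apply Δ).1 = mapV B.fill (qC Δ.1) :=
  qC_mapDomain B.fill Δ.1

theorem Indist.context {G G' : Finset ℕ} {Δ Θ : SDist (Conf S)} (h : Indist G Δ Θ) {B : Context}
    (hΔ : B.Compatible G G' Δ) (hΘ : B.Compatible G G' Θ) : Indist G' (B.apply Δ) (B.apply Θ) := by
  obtain ⟨M, hM, hG, h1, h2, h3⟩ := h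
  cases B with
  | hole =>
    have e : ∀ Δ : SDist (Conf S), (Context.hole.apply Δ) = Δ := by
      intro Δ
      refine Subtype.ext ?_
      exact Finsupp.mapDomain_id
    obtain rfl : G' = G := hΔ.1
    rw [e, e]
    exact ⟨M, hM, hG, h1, h2, h3⟩
  | par R =>
    obtain ⟨⟨hGG', hR, hdet⟩, -, hG'S, hΔt⟩ := hΔ
    have hΘt := hΘ.2.2.2
    have hRg : Good S (G' \ G) R := ⟨hdet, hR, Finset.sdiff_subset.trans hG'S⟩
    have hd : Disjoint G (G' \ G) := Finset.disjoint_sdiff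
    have hu : G' = G ∪ (G' \ G) := (Finset.union_sdiff_of_subset hGG').symm
    have hΔo : Δ.All (GoodOff S G R.tags) := fun C hC => ⟨h1 C hC, hΔt C hC⟩
    have hΘo : Θ.All (GoodOff S G R.tags) := fun C hC => ⟨h2 C hC, hΘt C hC⟩
    rw [SDist.all_iff] at hΔo hΘo
    refine ⟨parFamily M, hM.par, hG'S, ?_, ?_, ?_⟩
    · rw [SDist.all_iff, Context.qC_apply, hu]
      exact mapV_par_good hRg hd hΔo
    · rw [SDist.all_iff, Context.qC_apply, hu]
      exact mapV_par_good hRg hd hΘo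
    · rw [Context.qC_apply, Context.qC_apply, ← map_sub]
      exact mem_parFamily hu hd hRg h3 (sub_mem hΔo hΘo)

theorem Indist.step {G : Finset ℕ} {Δ Θ Δ' : SDist (Conf S)} (h : Indist G Δ Θ) {s : Sched}
    (hs : DStep Δ .tau s Δ') : ∃ Θ', DStep Θ .tau s Θ' ∧ Indist G Δ' Θ' := by
  obtain ⟨M, hM, hG, h1, h2, h3⟩ := h
  obtain ⟨Θ', hΘ'⟩ := exists_dstep Θ .tau s
  have e1 := hs.qC_eq h1
  have e2 := hΘ'.qC_eq h2
  refine ⟨Θ', hΘ', M, hM, hG, ?_, ?_, ?_⟩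
  · rw [SDist.all_iff] at h1 ⊢
    rw [e1]
    exact stepV_good h1
  · rw [SDist.all_iff] at h2 ⊢
    rw [e2]
    exact stepV_good h2
  · rw [e1, e2, ← map_sub]
    exact hM.step G _ h3 .tau s

/-- A context passes to the family generated by parallel composition, a step stays within the
family. The family may therefore change in the course of the game, which is why `Indist` quantifies
over it. -/
theorem isScheduledSaturatedBisimulation_indist :
    IsScheduledSaturatedBisimulation fun Δ Θ : SDist (Conf S) => ∃ G, Indist G Δ Θ where
  wellTyped := by
    rintro Δ Θ ⟨G, M, hM, hG, h1, h2, -⟩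
    exact ⟨G, ⟨hG, fun C hC => (h1 C hC).hasType⟩, ⟨hG, fun C hC => (h2 C hC).hasType⟩⟩
  mass_eq := by
    rintro Δ Θ ⟨G, h⟩
    exact h.mass_eq
  forth := by
    rintro Δ Θ ⟨G₀, h⟩ B G G' hΔ hΘ s Δ' hs
    obtain ⟨Θ', h1, h2⟩ := ((h.of_distTyped hΔ.2.1 hΘ.2.1).context hΔ hΘ).step hs
    exact ⟨Θ', h1, _, h2⟩
  back := by
    rintro Δ Θ ⟨G₀, h⟩ B G G' hΔ hΘ s Θ' hs
    obtain ⟨Δ', h1, h2⟩ := ((h.symm.of_distTyped hΘ.2.1 hΔ.2.1).context hΘ hΔ).step hs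
    exact ⟨Δ', h1, _, h2.symm⟩

theorem QDist.point_supp {ρ : Density S} {P : Proc} {p : Proc → Prop} (hP : p P) :
    (QDist.point ρ P).1 ∈ Supp p := single_mem_supp fun _ => hP

theorem QTyped.point_inv {G : Finset ℕ} {ρ : Density S} {P : Proc} (h : QTyped G (QDist.point ρ P)) :
    G ⊆ S ∧ P.HasType G := by
  refine ⟨h.1, h.2 P ?_⟩
  rw [Finsupp.mem_support_iff]
  change Finsupp.single P ρ.1 P ≠ 0
  rw [Finsupp.single_eq_same]
  exact ρ.ne_zero

theorem qC_point (ρ : Density S) (P : Proc) :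
    qC (SDist.point ((ρ, P) : Conf S)).1 = Finsupp.single P ρ.1 := by
  simp [SDist.point]

theorem scheduledSaturatedBisimilar_of_ground {ρ σ : Density S} {P Q : Proc} (hP : P.Deterministic)
    (hQ : Q.Deterministic) (hPg : P.InputRestricted) (hQg : Q.InputRestricted)
    (h : GroundBisimilar (QDist.point ρ P) (QDist.point σ Q)) :
    ScheduledSaturatedBisimilar (SDist.point ((ρ, P) : Conf S))
      (SDist.point ((σ, Q) : Conf S)) := by
  obtain ⟨R, hR, hPQ⟩ := h
  obtain ⟨G, h1, h2⟩ := hR.wellTyped _ _ hPQ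
  have gP : GoodIR S G P := ⟨⟨hP, h1.point_inv.2, h1.1⟩, hPg⟩
  have gQ : GoodIR S G Q := ⟨⟨hQ, h2.point_inv.2, h2.1⟩, hQg⟩
  refine ⟨_, isScheduledSaturatedBisimulation_indist, G, groundFamily, closedFamily_ground, h1.1,
    ?_, ?_, ?_⟩
  · rw [SDist.all_iff, qC_point]
    exact single_mem_supp fun _ => gP.1
  · rw [SDist.all_iff, qC_point]
    exact single_mem_supp fun _ => gQ.1
  · rw [qC_point, qC_point, mem_groundFamily]
    refine ⟨sub_mem (single_mem_supp fun _ => gP) (single_mem_supp fun _ => gQ), fun w => ?_⟩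
    exact hR.mem_nullAfter w hPQ (single_mem_supp fun _ => gP.1) (single_mem_supp fun _ => gQ.1) h1.1

/-! ### Sequential processes are deterministic -/

/-- Processes built from prefixes and conditionals. -/
def Proc.Sequential : Proc → Prop
  | .nil _ => True
  | .tau _ P => P.Sequential
  | .recv _ _ _ P => P.Sequential
  | .send _ _ _ P => P.Sequential
  | .meas _ _ _ _ P => P.Sequential
  | .ite _ P Q => P.Sequential ∧ Q.Sequential
  | _ => False

theorem Proc.Sequential.subst {P : Proc} (h : P.Sequential) (x : Var) (v : Value) :
    (P.subst x v).Sequential := by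
  induction P <;> simp only [Proc.subst, Proc.Sequential] at * <;> (try split_ifs) <;> simp_all

theorem Proc.Sequential.of_kstep {P : Proc} (hP : P.Sequential) {μ : Act} {s : Sched}
    {L : List (SO S × Proc)} (h : KStep P μ s L) : ∀ x ∈ L, x.2.Sequential := by
  induction h with
  | tau => simpa [Proc.Sequential] using hP
  | @meas t n M es x P q hq =>
    intro y hy
    obtain ⟨m, -, rfl⟩ := List.mem_map.1 hy
    exact Proc.Sequential.subst (P := P) hP _ _
  | send => simpa [Proc.Sequential] using hP
  | @recv t c x P v hv hq => simpa using Proc.Sequential.subst (P := P) hP _ _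
  | iteT _ _ ih => exact ih hP.1
  | iteF _ _ ih => exact ih hP.2
  | _ => exact hP.elim

theorem Proc.Sequential.cstep_unique {P : Proc} (hP : P.Sequential) {ρ : Density S} {μ μ' : Act}
    {s : Sched} {Δ Δ' : Conf S →₀ ℝ≥0} (h : CStep ρ P μ s Δ) (h' : CStep ρ P μ' s Δ') :
    (μ = μ' ∧ Δ = Δ') ∨ (μ ≠ μ' ∧ ∃ c v v', μ = .recv c v ∧ μ' = .recv c v') := by
  induction h generalizing μ' Δ' with
  | tau => cases h' with | tau => exact Or.inl ⟨rfl, rfl⟩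
  | meas q hq p hp ρ' hρ' =>
    cases h' with
    | meas q' hq' p' hp' ρ'' hρ'' =>
      obtain rfl : q = q' := by
        ext i
        have := (hq i).symm.trans (hq' i)
        simpa using this
      obtain rfl : p = p' := by
        funext m
        have := (hp m).trans (hp' m).symm
        exact_mod_cast this
      refine Or.inl ⟨rfl, Finset.sum_congr rfl fun m _ => ?_⟩
      -- The state after an outcome of probability zero is arbitrary and need not agree in the two
      -- transitions, but its weight is zero.
      by_cases h0 : p m = 0
      · rw [h0, Finsupp.single_zero, Finsupp.single_zero]
      · have h1 : ((p m : ℝ) : ℂ) ≠ 0 := by exact_mod_cast h0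
        have h2 := (hρ' m).trans (hρ'' m).symm
        rw [Subtype.ext (smul_right_injective _ h1 h2)]
  | send he =>
    cases h' with
    | send he' =>
      rw [he] at he'
      cases he'
      exact Or.inl ⟨rfl, rfl⟩
  | @recv t c x P v hv hq =>
    cases h' with
    | @recv _ _ _ _ v' hv' hq' =>
      by_cases hvv : v = v'
      · subst hvv; exact Or.inl ⟨rfl, rfl⟩
      · exact Or.inr ⟨by simpa using hvv, c, v, v', rfl, rfl⟩
  | iteT he _ ih =>
    cases h' with
    | iteT _ h' => exact ih hP.1 h'
    | iteF he' _ => rw [he] at he'; simp at he'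
  | iteF he _ ih =>
    cases h' with
    | iteF _ h' => exact ih hP.2 h'
    | iteT he' _ => rw [he] at he'; simp at he'
  | _ => exact hP.elim

theorem Proc.Sequential.deterministic {P : Proc} (hP : P.Sequential) : P.Deterministic := by
  have key : ∀ P', Relation.ReflTransGen Proc.Derivative P P' → P'.Sequential := by
    intro P' h
    induction h with
    | refl => exact hP
    | tail _ h ih =>
      obtain ⟨S, G, ρ, ρ', μ, s, Δ, -, -, h, hm⟩ := h
      obtain ⟨L, hL, e⟩ := h.kstep
      have := qC_ne_zero hm
      rw [e] at this
      obtain ⟨Φ, hΦ⟩ := mem_of_qval_ne_zero this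
      exact ih.of_kstep hL _ hΦ
  intro P' h S G ρ _ _ s μ μ' Δ Δ' h1 h2
  exact (key P' h).cstep_unique h1 h2

/-! ### Observing processes -/

theorem Value.toExpr_eval (v : Value) : v.toExpr.eval = some v := by cases v <;> rfl

theorem Value.toExpr_subst (v w : Value) (x : Var) : v.toExpr.subst x w = v.toExpr := by
  cases v <;> rfl

theorem eval_eq_values (v w : Value) :
    (Expr.eq v.toExpr w.toExpr).eval = some (.bool (decide (v = w))) := by
  simp [Expr.eval, Value.toExpr_eval]

theorem not_kstep_nil (es : List Expr) (μ : Act) (s : Sched) (L : List (SO S × Proc)) :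
    ¬ KStep (.nil es) μ s L := by
  intro h; cases h

theorem Typing.nil_singleton {e : Expr} (he : e.HasTy .qubit) : Typing {e} (.nil [e]) := by
  have := Typing.nil (es := [e]) (by simp) (by simpa using he)
  simpa using this

theorem Typing.nil_empty : Typing ∅ (.nil []) := by
  have := Typing.nil (es := []) (by simp) (by simp)
  simpa using this

theorem good_nil_empty : Good S ∅ (.nil []) :=
  ⟨Proc.Sequential.deterministic (P := .nil []) trivial,
    ⟨by simp [Proc.fv], by simpa using Typing.nil_empty⟩, by simp⟩

theorem good_nil_singleton {q : ℕ} (hq : q ∈ S) : Good S {q} (.nil [.qubit q]) :=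
  ⟨Proc.Sequential.deterministic (P := .nil [.qubit q]) trivial,
    ⟨by simp [Proc.fv, Expr.fv], by simpa using Typing.nil_singleton (.qubit q)⟩, by simpa using hq⟩

theorem single1_conjTranspose (m : Matrix (Fin 2) (Fin 2) ℂ) : (single1 m)ᴴ = single1 mᴴ := rfl

theorem single1_eq (m : Matrix (Fin 2) (Fin 2) ℂ) :
    single1 m = m.submatrix (Equiv.funUnique (Fin 1) (Fin 2)) (Equiv.funUnique (Fin 1) (Fin 2)) := rfl

theorem single1_mul (m m' : Matrix (Fin 2) (Fin 2) ℂ) :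
    single1 m * single1 m' = single1 (m * m') := by
  rw [single1_eq, single1_eq, single1_eq, Matrix.submatrix_mul_equiv]

/-- The projective measurement with outcomes `p` and `1 - p`. -/
def projMeas (p : Matrix (Fin 2) (Fin 2) ℂ) (hp : IsProj p) : Measurement 1 where
  k := 2
  op := ![single1 p, single1 (1 - p)]
  complete := by
    have h1 : (1 - p)ᴴ * (1 - p) = 1 - p := by
      rw [Matrix.conjTranspose_sub, Matrix.conjTranspose_one, hp.1, mul_sub, sub_mul, sub_mul, hp.2]
      simp
    simp only [Fin.sum_univ_two, Matrix.cons_val_zero, Matrix.cons_val_one, single1_conjTranspose,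
      single1_mul, h1, hp.1, hp.2]
    have h2 : single1 p + single1 (1 - p) = single1 1 := by
      ext a b
      simp [single1_eq]
    rw [h2, single1_eq, Matrix.submatrix_one_equiv]

/-- After outcome `n` of a measurement of `e`, proceed only if `n` is zero. -/
def onZero (t : ℕ) (e n : Expr) : Proc := .ite (.eq n (.nat 0)) (.tau t (.nil [e])) (.nil [e])

/-- The variable for outcomes. -/
def outcome : Var := ⟨.nat, 0⟩

/-- Measure the qubit `e`, and proceed only if the outcome is `p`. -/
def measProc (t t' : ℕ) (p : Matrix (Fin 2) (Fin 2) ℂ) (hp : IsProj p) (e : Expr) : Proc :=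
  .meas t (projMeas p hp) (fun _ => e) outcome (onZero t' e (.var outcome))

theorem typing_onZero (t : ℕ) {e n : Expr} (he : e.HasTy .qubit) (hn : n.HasTy .nat) :
    Typing {e} (onZero t e n) :=
  .ite (.eq hn (.nat 0)) (.tau (.nil_singleton he)) (.nil_singleton he)

theorem typing_measProc (t t' : ℕ) {p : Matrix (Fin 2) (Fin 2) ℂ} (hp : IsProj p) {e : Expr}
    (he : e.HasTy .qubit) : Typing {e} (measProc t t' p hp e) := by
  refine .meas (fun i j _ => Subsingleton.elim i j) ?_ rfl (typing_onZero t' he (.var outcome))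
  rintro _ ⟨i, rfl⟩
  rfl

theorem fv_measProc (t t' : ℕ) {p : Matrix (Fin 2) (Fin 2) ℂ} (hp : IsProj p) {e : Expr}
    (he : e.HasTy .qubit) : (measProc t t' p hp e).fv = e.fv := by
  have : outcome ∉ e.fv := by
    rcases he.qubit_cases with ⟨q, rfl⟩ | ⟨x, hx, rfl⟩
    · simp [Expr.fv]
    · rw [Expr.fv, Set.mem_singleton_iff]
      rintro rfl
      cases hx
  ext x
  simp only [measProc, onZero, Proc.fv, Expr.fv, Set.mem_union, Set.mem_iUnion, exists_const,
    List.mem_singleton, exists_eq_left, Set.mem_sdiff, Set.mem_singleton_iff, Set.mem_empty_iff_false,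
    Set.mem_ofPred_eq]
  tauto

theorem sequential_onZero (t : ℕ) (e n : Expr) : (onZero t e n).Sequential := ⟨trivial, trivial⟩

theorem sequential_measProc (t t' : ℕ) {p : Matrix (Fin 2) (Fin 2) ℂ} (hp : IsProj p) (e : Expr) :
    (measProc t t' p hp e).Sequential := sequential_onZero t' e (.var outcome)

theorem image_qubit_singleton (q : ℕ) : Expr.qubit '' (({q} : Finset ℕ) : Set ℕ) = {Expr.qubit q} := by
  simp

theorem good_onZero (t : ℕ) {q : ℕ} (hq : q ∈ S) (n : ℕ) :
    Good S {q} (onZero t (.qubit q) (.nat n)) :=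
  ⟨(sequential_onZero _ _ _).deterministic, ⟨by simp [onZero, Proc.fv, Expr.fv],
    by rw [image_qubit_singleton]; exact typing_onZero t (.qubit q) (.nat n)⟩, by simpa using hq⟩

theorem good_measProc (t t' : ℕ) {p : Matrix (Fin 2) (Fin 2) ℂ} (hp : IsProj p) {q : ℕ}
    (hq : q ∈ S) : Good S {q} (measProc t t' p hp (.qubit q)) :=
  ⟨(sequential_measProc _ _ hp _).deterministic, ⟨by rw [fv_measProc _ _ _ (.qubit q)]; rfl,
    by rw [image_qubit_singleton]; exact typing_measProc t t' hp (.qubit q)⟩, by simpa using hq⟩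

/-- The embedding of a single qubit. -/
def qubitEmb (q : S) : Fin 1 ↪ S := ⟨fun _ => q, fun i j _ => Subsingleton.elim i j⟩

@[simp] theorem qubitEmb_apply (q : S) (i : Fin 1) : qubitEmb q i = q := rfl

theorem kstep_measProc (t t' : ℕ) {p : Matrix (Fin 2) (Fin 2) ℂ} (hp : IsProj p) (q : S) :
    KStep (measProc t t' p hp (.qubit q)) .tau (.one t)
      [(conjL (embed (qubitEmb q) (single1 p)), onZero t' (.qubit q) (.nat 0)),
        (conjL (embed (qubitEmb q) (single1 (1 - p))), onZero t' (.qubit q) (.nat 1))] :=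
  KStep.meas (M := projMeas p hp) (x := outcome) (P := onZero t' (.qubit q) (.var outcome))
    (qubitEmb q) fun _ => rfl

theorem stepV_onZero_zero {G : Finset ℕ} (t : ℕ) {q : ℕ} (hq : q ∈ S) (hqG : q ∉ G) {Y : QV S}
    (hY : Y ∈ Supp (GoodOff S G {t})) :
    stepV .tau (.one t) (mapV (fun P => .par P (onZero t (.qubit q) (.nat 0))) Y) =
      mapV (fun P => .par P (.nil [.qubit q])) Y := by
  have hL : KStep (S := S) (onZero t (.qubit q) (.nat 0)) .tau (.one t)
      [(LinearMap.id, .nil [.qubit q])] := .iteT (by simp [Expr.eval]) .tau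
  rw [stepV_par_right (good_onZero t hq 0) (by simpa using hqG) (by simp [Sched.fst, onZero, Proc.tags])
    (by simp) hL (goodOff_mono (by simp [onZero, Proc.tags]) hY)]
  simp

/-- After the wrong outcome nothing carries the tag t, and the step discards this branch. Deadlock
is the filter that makes outcomes visible as mass. -/
theorem stepV_onZero_one {G : Finset ℕ} (t q : ℕ) {Y : QV S} (hY : Y ∈ Supp (GoodOff S G {t})) :
    stepV .tau (.one t) (mapV (fun P => .par P (onZero t (.qubit q) (.nat 1))) Y) = 0 := by
  refine stepV_par_right_none (G := G) (by simp [Sched.fst, onZero, Proc.tags]) ?_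
    (goodOff_mono (by simp [onZero, Proc.tags]) hY)
  intro L h
  cases h with
  | iteT he _ => simp [Expr.eval] at he
  | iteF _ h => exact not_kstep_nil _ _ _ _ h

/-- Running a measuring context. -/
theorem stepV_measure {G : Finset ℕ} {t t' : ℕ} {p : Matrix (Fin 2) (Fin 2) ℂ} {q : S}
    {N : Proc} (hN : Good S {q.1} N) (ht : t ∈ N.tags) (ht' : t' ∈ N.tags)
    (hL : KStep N .tau (.one t)
      [(conjL (embed (qubitEmb q) (single1 p)), onZero t' (.qubit q) (.nat 0)),
        (conjL (embed (qubitEmb q) (single1 (1 - p))), onZero t' (.qubit q) (.nat 1))])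
    (hqG : q.1 ∉ G) {Y : QV S} (hY : Y ∈ Supp (GoodOff S G N.tags)) :
    stepV .tau (.one t') (stepV .tau (.one t) (mapV (fun P => .par P N) Y)) =
      mapV (fun P => .par P (.nil [.qubit q])) (opV (conjL (embed (qubitEmb q) (single1 p))) Y) := by
  have hY' : Y ∈ Supp (GoodOff S G {t'}) := goodOff_mono (by simpa using ht') hY
  rw [stepV_par_right (μ := .tau) (s := .one t) hN (by simpa using hqG) ht (by simp) hL hY]
  simp only [List.map_cons, List.map_nil, List.sum_cons, List.sum_nil, add_zero, map_add]
  rw [stepV_onZero_zero t' q.2 hqG (opV_mem_supp hY'), stepV_onZero_one t' q (opV_mem_supp hY'),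
    add_zero]

/-- A context that receives a value and then can only go on if it is `v`. -/
theorem stepV_select {G : Finset ℕ} {t t₁ t₂ : ℕ} {c : Chan} {x : Var} {B : Proc} {v : Value}
    (hR : Good S ∅ (.recv t₁ c x B)) (ht : t ∉ (Proc.recv t₁ c x B).tags) (ht₂ : t₂ ∈ B.tags)
    (hB : ∀ v', v' ≠ v → ∀ L : List (SO S × Proc), ¬ KStep (B.subst x v') .tau (.one t₂) L)
    (hv : v.ty = c.ty) (hq : ∀ q, v = .qubit q → q ∈ S) {Y : QV S}
    (hY : Y ∈ Supp (GoodOff S G (Proc.recv t₁ c x B).tags)) :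
    stepV .tau (.one t₂)
        (stepV .tau (.two t t₁) (mapV (fun P => .par P (.recv t₁ c x B)) Y)) =
      stepV .tau (.one t₂)
        (mapV (fun P => .par P (B.subst x v)) (stepV (.send c v) (.one t) Y)) := by
  have hRv : KStep (.recv t₁ c x B) (.recv c v) (.one t₁) [((LinearMap.id : SO S), B.subst x v)] :=
    .recv hv fun q h => ⟨hq q h, hR.hasType.notOwns_iff.2 (by simp)⟩
  obtain ⟨W, r, hr, hW, e⟩ := stepV_synch_send hR (by simp) ht hRv hY
  have hrB : ∀ v' ∈ W, r v' = B.subst x v' := by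
    intro v' hv'
    have := hr v' hv'
    generalize hL : [((LinearMap.id : SO S), r v')] = L at this
    cases this with
    | recv => simpa using hL
  -- After any value other than v the continuation is stuck under t₂ and its summand is lost. If v
  -- is not among the received values, the send of v contributes zero.
  rw [e, map_sum, Finset.sum_eq_single v]
  · by_cases hvW : v ∈ W
    · rw [hrB v hvW]
    · simp only [hW v hvW _ hRv, map_zero]
  · intro v' hv' hne
    rw [hrB v' hv']
    refine stepV_par_right_none (G := (Act.send c v').after G) ?_ (hB v' hne)
      (goodOff_mono ?_ (stepV_goodOff hY))
    · rw [Proc.tags_subst]; exact ht₂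
    · rw [Proc.tags_subst, Proc.tags]; exact Finset.subset_insert _ _
  · intro hvW
    simp only [hW v hvW _ hRv, map_zero]

/-! ### Frames -/

/-- Parallel contexts with processes that have no tags, which own the qubits in `A`. -/
inductive Frame (S : Finset ℕ) : (Proc → Proc) → Finset ℕ → Prop
  | id : Frame S (fun P => P) ∅
  | par {f : Proc → Proc} {A B : Finset ℕ} {N : Proc} : Frame S f A → Disjoint A B → Good S B N →
      N.tags = ∅ → Frame S (fun P => .par (f P) N) (A ∪ B)

theorem Frame.goodOff {f : Proc → Proc} {A : Finset ℕ} (hf : Frame S f A) {G T : Finset ℕ}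
    (hd : Disjoint G A) {P : Proc} (hP : GoodOff S G T P) : GoodOff S (G ∪ A) T (f P) := by
  induction hf with
  | id => rwa [Finset.union_empty]
  | @par f A B N _ hAB hN ht ih =>
    have h1 := ih (hd.mono_right Finset.subset_union_left)
    rw [← Finset.union_assoc]
    refine ⟨h1.1.par hN ?_ (by simp [ht]), ?_⟩
    · rw [Finset.disjoint_union_left]
      exact ⟨hd.mono_right Finset.subset_union_right, hAB⟩
    · simpa [Proc.tags, ht] using h1.2

theorem Frame.mapV_goodOff {f : Proc → Proc} {A : Finset ℕ} (hf : Frame S f A) {G T : Finset ℕ}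
    (hd : Disjoint G A) {D : QV S} (hD : D ∈ Supp (GoodOff S G T)) :
    mapV f D ∈ Supp (GoodOff S (G ∪ A) T) := by
  refine supp_induction (C := fun Z => mapV f Z ∈ Supp (GoodOff S (G ∪ A) T))
    (by simp) (fun D T h1 h2 => by rw [map_add]; exact add_mem h1 h2) (fun P X hP => ?_) hD
  rw [mapV_single]
  exact single_mem_supp fun _ => hf.goodOff hd hP

theorem goodOff_empty {G : Finset ℕ} {D : QV S} (hD : D ∈ Supp (Good S G)) :
    D ∈ Supp (GoodOff S G ∅) :=
  Supp.mono (fun _ h => ⟨h, by simp⟩) hD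

/-- Processes without tags neither move nor synchronize. They interfere only by blocking the
reception of a qubit that they own, hence the restriction on μ. -/
theorem Frame.stepV_mapV {f : Proc → Proc} {A : Finset ℕ} (hf : Frame S f A) {G : Finset ℕ}
    (hd : Disjoint G A) {D : QV S} (hD : D ∈ Supp (Good S G)) {μ : Act} (s : Sched)
    (hμ : ∀ c q, μ ≠ .recv c (.qubit q)) : stepV μ s (mapV f D) = mapV f (stepV μ s D) := by
  have hid : ∀ D : QV S, mapV (fun P => P) D = D := fun D => Finsupp.mapDomain_id
  induction hf with
  | id => rw [hid, hid]
  | @par f A B N hf hAB hN ht ih =>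
    have hcomp : ∀ D : QV S, mapV (fun P => .par (f P) N) D = mapV (fun P => .par P N) (mapV f D) := by
      intro D
      exact Finsupp.mapDomain_comp (g := fun P => Proc.par P N) (f := f)
    have hdA := hd.mono_right (Finset.subset_union_left (s₁ := A) (s₂ := B))
    rw [hcomp, hcomp, ← ih hdA]
    refine stepV_par_left hN ?_ (by simp [ht]) (fun c q h => absurd h (hμ c q)) ?_ (G := G ∪ A)
    · rw [Finset.disjoint_union_left]
      exact ⟨hd.mono_right Finset.subset_union_right, hAB⟩
    · rw [ht]
      exact hf.mapV_goodOff hdA (goodOff_empty hD)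

/-! ### Experiments on saturated bisimilar distributions -/

theorem ScheduledSaturatedBisimilar.symm {Δ Θ : SDist (Conf S)}
    (h : ScheduledSaturatedBisimilar Δ Θ) : ScheduledSaturatedBisimilar Θ Δ := by
  obtain ⟨R, hR, h⟩ := h
  refine ⟨fun Δ Θ => R Θ Δ, ⟨?_, ?_, ?_, ?_⟩, h⟩
  · intro Δ Θ h
    obtain ⟨G, h1, h2⟩ := hR.wellTyped _ _ h
    exact ⟨G, h2, h1⟩
  · exact fun Δ Θ h => (hR.mass_eq _ _ h).symm
  · exact fun Δ Θ h B G G' h1 h2 s Δ' hs => hR.back _ _ h B G G' h2 h1 s Δ' hs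
  · exact fun Δ Θ h B G G' h1 h2 s Δ' hs => hR.forth _ _ h B G G' h2 h1 s Δ' hs

theorem ScheduledSaturatedBisimilar.step {Δ Θ : SDist (Conf S)}
    (h : ScheduledSaturatedBisimilar Δ Θ) {G : Finset ℕ} (hG : G ⊆ S) (h1 : Δ.All (Good S G))
    (h2 : Θ.All (Good S G)) (s : Sched) :
    ∃ Δ' Θ' : SDist (Conf S), ScheduledSaturatedBisimilar Δ' Θ' ∧
      qC Δ'.1 = stepV .tau s (qC Δ.1) ∧ qC Θ'.1 = stepV .tau s (qC Θ.1) := by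
  obtain ⟨R, hR, h⟩ := h
  have e : ∀ Δ : SDist (Conf S), (Context.hole.apply Δ) = Δ := fun Δ =>
    Subtype.ext Finsupp.mapDomain_id
  have c1 : Context.hole.Compatible G G Δ :=
    ⟨rfl, ⟨hG, fun C hC => (h1 C hC).hasType⟩, hG, fun C _ => by simp [Context.tags]⟩
  have c2 : Context.hole.Compatible G G Θ :=
    ⟨rfl, ⟨hG, fun C hC => (h2 C hC).hasType⟩, hG, fun C _ => by simp [Context.tags]⟩
  obtain ⟨Δ', hΔ'⟩ := exists_dstep Δ .tau s
  obtain ⟨Θ', hΘ', hR'⟩ := hR.forth _ _ h .hole G G c1 c2 s Δ' (by rwa [e])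
  rw [e] at hΘ'
  exact ⟨Δ', Θ', ⟨R, hR, hR'⟩, hΔ'.qC_eq h1, hΘ'.qC_eq h2⟩

/-- An experiment: both sides are run next to the observer N. The outcome on each side is forced, so
the results can be computed and are again bisimilar. -/
theorem ScheduledSaturatedBisimilar.step_par {Δ Θ : SDist (Conf S)}
    (h : ScheduledSaturatedBisimilar Δ Θ) {G H : Finset ℕ} {N : Proc} (hG : G ⊆ S)
    (hN : Good S H N) (hd : Disjoint G H) (h1 : qC Δ.1 ∈ Supp (GoodOff S G N.tags))
    (h2 : qC Θ.1 ∈ Supp (GoodOff S G N.tags)) (s : Sched) :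
    ∃ Δ' Θ' : SDist (Conf S), ScheduledSaturatedBisimilar Δ' Θ' ∧
      qC Δ'.1 = stepV .tau s (mapV (fun P => .par P N) (qC Δ.1)) ∧
      qC Θ'.1 = stepV .tau s (mapV (fun P => .par P N) (qC Θ.1)) := by
  obtain ⟨R, hR, h⟩ := h
  have hsub : G ∪ H ⊆ S := Finset.union_subset hG hN.subset
  have hty : (Context.par N).HasType G (G ∪ H) :=
    ⟨Finset.subset_union_left, by rw [Finset.union_sdiff_cancel_left hd]; exact hN.hasType, hN.det⟩
  have a1 := SDist.all_iff.2 h1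
  have a2 := SDist.all_iff.2 h2
  have c1 : (Context.par N).Compatible G (G ∪ H) Δ :=
    ⟨hty, ⟨hG, fun C hC => (a1 C hC).1.hasType⟩, hsub, fun C hC => (a1 C hC).2⟩
  have c2 : (Context.par N).Compatible G (G ∪ H) Θ :=
    ⟨hty, ⟨hG, fun C hC => (a2 C hC).1.hasType⟩, hsub, fun C hC => (a2 C hC).2⟩
  obtain ⟨Δ', hΔ'⟩ := exists_dstep ((Context.par N).apply Δ) .tau s
  obtain ⟨Θ', hΘ', hR'⟩ := hR.forth _ _ h _ _ _ c1 c2 s Δ' hΔ'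
  refine ⟨Δ', Θ', ⟨R, hR, hR'⟩, ?_, ?_⟩
  · rw [hΔ'.qC_eq (G := G ∪ H), Context.qC_apply]
    · rfl
    · rw [SDist.all_iff, Context.qC_apply]
      exact mapV_par_good hN hd h1
  · rw [hΘ'.qC_eq (G := G ∪ H), Context.qC_apply]
    · rfl
    · rw [SDist.all_iff, Context.qC_apply]
      exact mapV_par_good hN hd h2

/-- `D` and `T`, in a frame, are the quantum vectors of bisimilar distributions. -/
def Framed (A : Finset ℕ) (D T : QV S) : Prop :=
  ∃ (f : Proc → Proc) (Δ Θ : SDist (Conf S)), Frame S f A ∧ ScheduledSaturatedBisimilar Δ Θ ∧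
    qC Δ.1 = mapV f D ∧ qC Θ.1 = mapV f T

theorem Framed.symm {A : Finset ℕ} {D T : QV S} (h : Framed A D T) : Framed A T D := by
  obtain ⟨f, Δ, Θ, hf, h, h1, h2⟩ := h
  exact ⟨f, Θ, Δ, hf, h.symm, h2, h1⟩

theorem Framed.trace_eq {A : Finset ℕ} {D T : QV S} (h : Framed A D T) :
    (tot D).trace = (tot T).trace := by
  obtain ⟨f, Δ, Θ, -, ⟨R, hR, h⟩, h1, h2⟩ := h
  rw [← tot_mapV f D, ← tot_mapV f T, ← h1, ← h2, trace_tot_qC, trace_tot_qC, hR.mass_eq _ _ h]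

theorem Frame.subset {f : Proc → Proc} {A : Finset ℕ} (hf : Frame S f A) : A ⊆ S := by
  induction hf with
  | id => simp
  | par _ _ hN _ ih => exact Finset.union_subset ih hN.subset

theorem Frame.mapV_par (f : Proc → Proc) (N : Proc) (D : QV S) :
    mapV (fun P => .par (f P) N) D = mapV (fun P => .par P N) (mapV f D) :=
  Finsupp.mapDomain_comp (g := fun P => Proc.par P N) (f := f)

theorem goodOff_to_good {G A : Finset ℕ} {D : QV S} (hD : D ∈ Supp (GoodOff S G A)) :
    D ∈ Supp (Good S G) := Supp.mono (fun _ h => h.1) hD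

theorem Framed.tau {G A : Finset ℕ} {D T : QV S} (h : Framed A D T) (hG : G ⊆ S)
    (hd : Disjoint G A) (hD : D ∈ Supp (Good S G)) (hT : T ∈ Supp (Good S G)) (s : Sched) :
    Framed A (stepV .tau s D) (stepV .tau s T) := by
  obtain ⟨f, Δ, Θ, hf, h, h1, h2⟩ := h
  have g1 := goodOff_to_good (hf.mapV_goodOff hd (goodOff_empty hD))
  have g2 := goodOff_to_good (hf.mapV_goodOff hd (goodOff_empty hT))
  obtain ⟨Δ', Θ', h', e1, e2⟩ := h.step (G := G ∪ A) (Finset.union_subset hG hf.subset)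
    (by rw [SDist.all_iff, h1]; exact g1) (by rw [SDist.all_iff, h2]; exact g2) s
  refine ⟨f, Δ', Θ', hf, h', ?_, ?_⟩
  · rw [e1, h1, hf.stepV_mapV hd hD _ (by simp)]
  · rw [e2, h2, hf.stepV_mapV hd hT _ (by simp)]

/-- The tags of the processes of a quantum vector. -/
noncomputable def vtags (D : QV S) : Finset ℕ := D.support.biUnion Proc.tags

theorem goodOff_of_disjoint {G A : Finset ℕ} {D : QV S} (hD : D ∈ Supp (Good S G))
    (h : ∀ t ∈ A, t ∉ vtags D) : D ∈ Supp (GoodOff S G A) := by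
  rw [mem_supp] at hD ⊢
  refine fun P hP => ⟨hD P hP, ?_⟩
  rw [Finset.disjoint_left]
  exact fun t ht htA => h t htA (Finset.mem_biUnion.2 ⟨P, Finsupp.mem_support_iff.2 hP, ht⟩)

theorem exists_fresh (A : Finset ℕ) :
    ∃ t₁ t₂ t₃ : ℕ, t₁ ∉ A ∧ t₂ ∉ A ∧ t₃ ∉ A ∧ t₁ ≠ t₂ ∧ t₁ ≠ t₃ ∧ t₂ ≠ t₃ := by
  obtain ⟨t₁, h1⟩ := Infinite.exists_notMem_finset A
  obtain ⟨t₂, h2⟩ := Infinite.exists_notMem_finset (insert t₁ A)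
  obtain ⟨t₃, h3⟩ := Infinite.exists_notMem_finset (insert t₂ (insert t₁ A))
  simp only [Finset.mem_insert, not_or] at h2 h3
  exact ⟨t₁, t₂, t₃, h1, h2.2, h3.2.2, Ne.symm h2.1, Ne.symm h3.2.1, Ne.symm h3.1⟩

/-- The observer sends v under a fresh tag. The reception becomes a τ-step, and what is left of the
observer joins the frame. -/
theorem Framed.recv {G A : Finset ℕ} {D T : QV S} (h : Framed A D T) (hG : G ⊆ S)
    (hd : Disjoint G A) (hD : D ∈ Supp (Good S G)) (hT : T ∈ Supp (Good S G)) {c : Chan} {v : Value}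
    (hv : v.ty = c.ty) (hc : c.ty ≠ .qubit) (t : ℕ) :
    Framed A (stepV (.recv c v) (.one t) D) (stepV (.recv c v) (.one t) T) := by
  obtain ⟨f, Δ, Θ, hf, h, h1, h2⟩ := h
  obtain ⟨t₁, -, -, hfr, -⟩ := exists_fresh (vtags D ∪ vtags T ∪ {t})
  simp only [Finset.mem_union, Finset.mem_singleton, not_or] at hfr
  let N : Proc := .send t₁ c v.toExpr (.nil [])
  have hN : Good S ∅ N := by
    refine ⟨Proc.Sequential.deterministic trivial, ⟨?_, ?_⟩, by simp⟩
    · simp [N, Proc.fv, Value.toExpr_fv]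
    · simpa using Typing.csend hc (hv ▸ v.toExpr_hasTy) Typing.nil_empty
  have hNt : N.tags = {t₁} := rfl
  have hstep : KStep N (.send c v) (.one t₁) [((LinearMap.id : SO S), .nil [])] :=
    .send v.toExpr_eval
  have g1 := hf.mapV_goodOff hd (goodOff_of_disjoint (A := N.tags) hD (by simpa [hNt] using hfr.1.1))
  have g2 := hf.mapV_goodOff hd (goodOff_of_disjoint (A := N.tags) hT (by simpa [hNt] using hfr.1.2))
  have hμ : ∀ c' q, Act.recv c v ≠ .recv c' (.qubit q) := by
    rintro c' q ⟨⟩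
    exact hc hv.symm
  obtain ⟨Δ', Θ', h', e1, e2⟩ := h.step_par (G := G ∪ A) (Finset.union_subset hG hf.subset) hN
    (by simp) (by rw [h1]; exact g1) (by rw [h2]; exact g2) (.two t t₁)
  have ht : t ∉ N.tags := by rw [hNt]; simpa using Ne.symm hfr.2
  refine ⟨fun P => .par (f P) (.nil []), Δ', Θ', ?_, h', ?_, ?_⟩
  · have := Frame.par hf (by simp) good_nil_empty rfl
    rwa [Finset.union_empty] at this
  · rw [e1, h1, stepV_synch_recv hN (by simp) ht hstep g1, hf.stepV_mapV hd hD _ hμ, ← Frame.mapV_par]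
  · rw [e2, h2, stepV_synch_recv hN (by simp) ht hstep g2, hf.stepV_mapV hd hT _ hμ, ← Frame.mapV_par]

theorem not_kstep_ite_ne {v v' : Value} (h : v' ≠ v) (B : Proc) (es : List Expr) (μ : Act) (s : Sched)
    (L : List (SO S × Proc)) : ¬ KStep (.ite (.eq v'.toExpr v.toExpr) B (.nil es)) μ s L := by
  intro hk
  cases hk with
  | iteT he _ => rw [eval_eq_values] at he; simp [h] at he
  | iteF _ h => exact not_kstep_nil _ _ _ _ h

theorem subst_guard (x : Var) (v v' : Value) (B C : Proc) :
    (Proc.ite (.eq (.var x) v.toExpr) B C).subst x v' =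
      .ite (.eq v'.toExpr v.toExpr) (B.subst x v') (C.subst x v') := by
  simp [Proc.subst, Expr.subst, Value.toExpr_subst]

/-- The observer receives any value and takes a second step only if it is v. The first step mixes
all values sent on the channel; the second discards all but v. -/
theorem Framed.send {G A : Finset ℕ} {D T : QV S} (h : Framed A D T) (hG : G ⊆ S)
    (hd : Disjoint G A) (hD : D ∈ Supp (Good S G)) (hT : T ∈ Supp (Good S G)) {c : Chan} {v : Value}
    (hv : v.ty = c.ty) (hc : c.ty ≠ .qubit) (t : ℕ) :
    Framed A (stepV (.send c v) (.one t) D) (stepV (.send c v) (.one t) T) := by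
  obtain ⟨f, Δ, Θ, hf, h, h1, h2⟩ := h
  obtain ⟨t₁, t₂, -, hfr, hfr₂, -⟩ := exists_fresh (vtags D ∪ vtags T ∪ {t})
  simp only [Finset.mem_union, Finset.mem_singleton, not_or] at hfr hfr₂
  let x : Var := ⟨c.ty, 0⟩
  let B : Proc := .ite (.eq (.var x) v.toExpr) (.tau t₂ (.nil [])) (.nil [])
  let N : Proc := .recv t₁ c x B
  have hN : Good S ∅ N := by
    refine ⟨Proc.Sequential.deterministic (P := N) ⟨trivial, trivial⟩, ⟨?_, ?_⟩, by simp⟩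
    · simp [N, B, Proc.fv, Expr.fv, Value.toExpr_fv]
    · simpa using Typing.crecv hc (x := x) rfl (.ite (.eq (.var x) (hv ▸ v.toExpr_hasTy : v.toExpr.HasTy c.ty))
        (.tau Typing.nil_empty) Typing.nil_empty)
  have hNt : N.tags = {t₁, t₂} := by simp [N, B, Proc.tags]
  have hA : ∀ {D : QV S}, t₁ ∉ vtags D → t₂ ∉ vtags D → ∀ t ∈ N.tags, t ∉ vtags D := by
    intro D h1 h2 t ht
    rw [hNt, Finset.mem_insert, Finset.mem_singleton] at ht
    rcases ht with rfl | rfl <;> assumption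
  have g1 := hf.mapV_goodOff hd (goodOff_of_disjoint hD (hA hfr.1.1 hfr₂.1.1))
  have g2 := hf.mapV_goodOff hd (goodOff_of_disjoint hT (hA hfr.1.2 hfr₂.1.2))
  have hvq : ∀ q, v ≠ .qubit q := by rintro q rfl; exact hc hv.symm
  have hμ : ∀ c' q, Act.send c v ≠ .recv c' (.qubit q) := by simp
  have hafter : ∀ G, (Act.send c v).after G = G := by
    intro G
    rcases v with _ | _ | q
    · rfl
    · rfl
    · exact absurd rfl (hvq q)
  have ht : t ∉ N.tags := by
    rw [hNt, Finset.mem_insert, Finset.mem_singleton, not_or]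
    exact ⟨Ne.symm hfr.2, Ne.symm hfr₂.2⟩
  have run : ∀ {Y : QV S}, Y ∈ Supp (GoodOff S (G ∪ A) N.tags) →
      stepV .tau (.one t₂) (stepV .tau (.two t t₁) (mapV (fun P => .par P N) Y)) =
        mapV (fun P => .par P (.nil [])) (stepV (.send c v) (.one t) Y) := by
    intro Y hY
    rw [stepV_select (v := v) hN ht (by simp [B, Proc.tags]) ?_ hv (fun q h => absurd h (hvq q)) hY]
    · have e : B.subst x v = .ite (.eq v.toExpr v.toExpr) (.tau t₂ (.nil [])) (.nil []) :=
        subst_guard x v v _ _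
      have hL : KStep (S := S) (B.subst x v) .tau (.one t₂) [(LinearMap.id, .nil [])] := by
        rw [e]; exact .iteT (by simp [eval_eq_values]) .tau
      have hN' : Good S ∅ (B.subst x v) := by
        rw [e]
        refine ⟨Proc.Sequential.deterministic ⟨trivial, trivial⟩, ⟨?_, ?_⟩, by simp⟩
        · simp [Proc.fv, Expr.fv, Value.toExpr_fv]
        · simpa using Typing.ite (.eq v.toExpr_hasTy v.toExpr_hasTy) (.tau Typing.nil_empty)
            Typing.nil_empty
      rw [stepV_par_right hN' (by simp) (by simp [Proc.tags_subst, B, Proc.tags, Sched.fst]) (by simp) hL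
        (goodOff_mono (by rw [Proc.tags_subst]; exact Finset.subset_insert _ _) (stepV_goodOff hY))]
      simp
    · intro v' hne L
      rw [show B.subst x v' = _ from subst_guard x v v' _ _]
      exact not_kstep_ite_ne hne _ _ _ _ _
  have hsub := Finset.union_subset hG hf.subset
  obtain ⟨Δ', Θ', h', e1, e2⟩ := h.step_par (G := G ∪ A) hsub hN
    (by simp) (by rw [h1]; exact g1) (by rw [h2]; exact g2) (.two t t₁)
  obtain ⟨Δ'', Θ'', h'', e1', e2'⟩ := h'.step (G := G ∪ A) hsub
    (by
      rw [SDist.all_iff, e1, h1]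
      have := stepV_good (μ := .tau) (s := .two t t₁) (mapV_par_good hN (by simp) g1)
      rwa [Finset.union_empty] at this)
    (by
      rw [SDist.all_iff, e2, h2]
      have := stepV_good (μ := .tau) (s := .two t t₁) (mapV_par_good hN (by simp) g2)
      rwa [Finset.union_empty] at this) (.one t₂)
  refine ⟨fun P => .par (f P) (.nil []), Δ'', Θ'', ?_, h'', ?_, ?_⟩
  · have := Frame.par hf (by simp) good_nil_empty rfl
    rwa [Finset.union_empty] at this
  · rw [e1', e1, h1, run g1, hf.stepV_mapV hd hD _ hμ, ← Frame.mapV_par]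
  · rw [e2', e2, h2, run g2, hf.stepV_mapV hd hT _ hμ, ← Frame.mapV_par]

theorem tags_measProc (t t' : ℕ) {p : Matrix (Fin 2) (Fin 2) ℂ} (hp : IsProj p) (e : Expr) :
    (measProc t t' p hp e).tags = {t, t'} := by
  simp [measProc, onZero, Proc.tags]

theorem Frame.par_nil {f : Proc → Proc} {A : Finset ℕ} (hf : Frame S f A) {q : ℕ} (hq : q ∈ S)
    (hqA : q ∉ A) : Frame S (fun P => .par (f P) (.nil [.qubit q])) (insert q A) := by
  have := Frame.par hf (by simpa using hqA) (good_nil_singleton hq) rfl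
  rwa [Finset.union_comm, ← Finset.insert_eq] at this

/-- The observer must own the qubit it measures and keeps it afterwards, so the qubit must belong
neither to the processes nor to the frame, and it is added to the frame. -/
theorem Framed.measure {G A : Finset ℕ} {D T : QV S} (h : Framed A D T) (hG : G ⊆ S)
    (hd : Disjoint G A) (hD : D ∈ Supp (Good S G)) (hT : T ∈ Supp (Good S G)) (q : S)
    (hqG : q.1 ∉ G) (hqA : q.1 ∉ A) {p : Matrix (Fin 2) (Fin 2) ℂ} (hp : IsProj p) :
    Framed (insert q.1 A) (opV (conjL (embed (qubitEmb q) (single1 p))) D)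
      (opV (conjL (embed (qubitEmb q) (single1 p))) T) := by
  obtain ⟨f, Δ, Θ, hf, h, h1, h2⟩ := h
  obtain ⟨t₁, t₂, -, hfr, hfr₂, -⟩ := exists_fresh (vtags D ∪ vtags T)
  simp only [Finset.mem_union, not_or] at hfr hfr₂
  let N : Proc := measProc t₁ t₂ p hp (.qubit q)
  have hN : Good S {q.1} N := good_measProc t₁ t₂ hp q.2
  have hNt : N.tags = {t₁, t₂} := tags_measProc _ _ _ _
  have hA : ∀ {D : QV S}, t₁ ∉ vtags D → t₂ ∉ vtags D → ∀ t ∈ N.tags, t ∉ vtags D := by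
    intro D h1 h2 t ht
    rw [hNt, Finset.mem_insert, Finset.mem_singleton] at ht
    rcases ht with rfl | rfl <;> assumption
  have g1 := hf.mapV_goodOff hd (goodOff_of_disjoint hD (hA hfr.1 hfr₂.1))
  have g2 := hf.mapV_goodOff hd (goodOff_of_disjoint hT (hA hfr.2 hfr₂.2))
  have hqGA : q.1 ∉ G ∪ A := by simp [hqG, hqA]
  have hdq : Disjoint (G ∪ A) {q.1} := by simpa using hqGA
  have hsub := Finset.union_subset hG hf.subset
  have hsub' : G ∪ A ∪ {q.1} ⊆ S := Finset.union_subset hsub hN.subset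
  obtain ⟨Δ', Θ', h', e1, e2⟩ := h.step_par hsub hN hdq (by rw [h1]; exact g1) (by rw [h2]; exact g2)
    (.one t₁)
  obtain ⟨Δ'', Θ'', h'', e1', e2'⟩ := h'.step hsub'
    (by
      rw [SDist.all_iff, e1, h1]
      exact stepV_good (μ := .tau) (mapV_par_good hN hdq g1))
    (by
      rw [SDist.all_iff, e2, h2]
      exact stepV_good (μ := .tau) (mapV_par_good hN hdq g2)) (.one t₂)
  have hk := kstep_measProc t₁ t₂ hp q
  have m1 : t₁ ∈ N.tags := by rw [hNt]; simp
  have m2 : t₂ ∈ N.tags := by rw [hNt]; simp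
  refine ⟨_, Δ'', Θ'', hf.par_nil q.2 hqA, h'', ?_, ?_⟩
  · rw [e1', e1, h1, stepV_measure hN m1 m2 hk hqGA g1, opV_mapV, ← Frame.mapV_par]
  · rw [e2', e2, h2, stepV_measure hN m1 m2 hk hqGA g2, opV_mapV, ← Frame.mapV_par]

theorem subst_measProc (t t' : ℕ) {p : Matrix (Fin 2) (Fin 2) ℂ} (hp : IsProj p) (x : Var)
    (hx : x.ty = .qubit) (v : Value) :
    (measProc t t' p hp (.var x)).subst x v = measProc t t' p hp v.toExpr := by
  have : outcome ≠ x := by rintro rfl; cases hx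
  simp [measProc, onZero, Proc.subst, Expr.subst, this]

/-- A sent qubit becomes environment, but the observer that receives it owns it from then on. No
later observer can measure it, so the same one receives it, checks its name and measures it. -/
theorem Framed.send_qubit {G A : Finset ℕ} {D T : QV S} (h : Framed A D T) (hG : G ⊆ S)
    (hd : Disjoint G A) (hD : D ∈ Supp (Good S G)) (hT : T ∈ Supp (Good S G)) {c : Chan}
    (hc : c.ty = .qubit) (q : S) (hqG : q.1 ∈ G) (t : ℕ) {p : Matrix (Fin 2) (Fin 2) ℂ}
    (hp : IsProj p) :
    Framed (insert q.1 A)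
      (opV (conjL (embed (qubitEmb q) (single1 p))) (stepV (.send c (.qubit q)) (.one t) D))
      (opV (conjL (embed (qubitEmb q) (single1 p))) (stepV (.send c (.qubit q)) (.one t) T)) := by
  obtain ⟨f, Δ, Θ, hf, h, h1, h2⟩ := h
  obtain ⟨t₁, t₂, t₃, hfr, hfr₂, hfr₃, -⟩ := exists_fresh (vtags D ∪ vtags T ∪ {t})
  simp only [Finset.mem_union, Finset.mem_singleton, not_or] at hfr hfr₂ hfr₃
  let x : Var := ⟨.qubit, 0⟩
  let v : Value := .qubit q
  let B : Proc := .ite (.eq (.var x) v.toExpr) (measProc t₂ t₃ p hp (.var x)) (.nil [.var x])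
  let N : Proc := .recv t₁ c x B
  have hx : (Expr.var x).HasTy .qubit := .var x
  have hN : Good S ∅ N := by
    refine ⟨Proc.Sequential.deterministic (P := N) ⟨sequential_measProc _ _ _ _, trivial⟩, ⟨?_, ?_⟩,
      by simp⟩
    · simp [N, B, v, Proc.fv, Expr.fv, Value.toExpr_fv, fv_measProc _ _ hp hx]
    · rw [Finset.coe_empty, Set.image_empty]
      refine Typing.qrecv hc rfl (by simp) ?_
      rw [Set.empty_union]
      exact .ite (.eq hx (.qubit q)) (typing_measProc _ _ hp hx) (.nil_singleton hx)
  have hBt : B.tags = {t₂, t₃} := by simp [B, Proc.tags, tags_measProc]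
  have hNt : N.tags = {t₁, t₂, t₃} := by simp [N, Proc.tags, hBt]
  have hA : ∀ {D : QV S}, t₁ ∉ vtags D → t₂ ∉ vtags D → t₃ ∉ vtags D → ∀ t ∈ N.tags, t ∉ vtags D := by
    intro D h1 h2 h3 t ht
    rw [hNt, Finset.mem_insert, Finset.mem_insert, Finset.mem_singleton] at ht
    rcases ht with rfl | rfl | rfl <;> assumption
  have g1 := hf.mapV_goodOff hd (goodOff_of_disjoint hD (hA hfr.1.1 hfr₂.1.1 hfr₃.1.1))
  have g2 := hf.mapV_goodOff hd (goodOff_of_disjoint hT (hA hfr.1.2 hfr₂.1.2 hfr₃.1.2))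
  have hqA : q.1 ∉ A := Finset.disjoint_left.1 hd hqG
  have hμ : ∀ c' q', Act.send c (.qubit q) ≠ .recv c' (.qubit q') := by simp
  have ht : t ∉ N.tags := by
    rw [hNt, Finset.mem_insert, Finset.mem_insert, Finset.mem_singleton, not_or, not_or]
    exact ⟨Ne.symm hfr.2, Ne.symm hfr₂.2, Ne.symm hfr₃.2⟩
  have run : ∀ {Y : QV S}, Y ∈ Supp (GoodOff S (G ∪ A) N.tags) →
      stepV .tau (.one t₃) (stepV .tau (.one t₂) (stepV .tau (.two t t₁)
        (mapV (fun P => .par P N) Y))) =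
        mapV (fun P => .par P (.nil [.qubit q])) (opV (conjL (embed (qubitEmb q) (single1 p)))
          (stepV (.send c (.qubit q)) (.one t) Y)) := by
    intro Y hY
    rw [stepV_select (v := v) hN ht (by simp [hBt]) ?_ hc.symm (fun r h => (Value.qubit.inj h : q.1 = r) ▸ q.2) hY]
    · have e : B.subst x v = .ite (.eq v.toExpr v.toExpr) (measProc t₂ t₃ p hp (.qubit q))
          (.nil [.qubit q]) := by
        rw [show B.subst x v = _ from subst_guard x v v _ _, subst_measProc _ _ _ _ rfl]
        simp [Proc.subst, Expr.subst, v, Value.toExpr]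
      have hN' : Good S {q.1} (B.subst x v) := by
        rw [e]
        refine ⟨Proc.Sequential.deterministic ⟨sequential_measProc _ _ _ _, trivial⟩, ⟨?_, ?_⟩,
          by simp⟩
        · simp [Proc.fv, Expr.fv, Value.toExpr_fv, fv_measProc _ _ hp (.qubit q.1)]
        · rw [image_qubit_singleton]
          exact .ite (.eq (.qubit q) (.qubit q)) (typing_measProc _ _ hp (.qubit q))
            (.nil_singleton (.qubit q))
      have hL := kstep_measProc t₂ t₃ hp q
      -- The vector is taken after the send, when q is owned only by the observer; hence the type
      -- with q erased.
      exact stepV_measure hN' (by rw [Proc.tags_subst]; simp [hBt]) (by rw [Proc.tags_subst]; simp [hBt])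
        (by rw [e]; exact .iteT (by simp [eval_eq_values]) hL)
        (G := (G ∪ A).erase q.1) (Finset.notMem_erase _ _)
        (goodOff_mono (by rw [Proc.tags_subst]; exact Finset.subset_insert _ _)
          (stepV_goodOff (μ := .send c (.qubit q)) hY))
    · intro v' hne L
      rw [show B.subst x v' = _ from subst_guard x v v' _ _]
      exact not_kstep_ite_ne hne _ _ _ _ _
  have hsub := Finset.union_subset hG hf.subset
  have k1 := stepV_good (μ := .tau) (s := .two t t₁) (mapV_par_good hN (by simp) g1)
  have k2 := stepV_good (μ := .tau) (s := .two t t₁) (mapV_par_good hN (by simp) g2)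
  rw [Finset.union_empty] at k1 k2
  obtain ⟨Δ', Θ', h', e1, e2⟩ := h.step_par (G := G ∪ A) hsub hN
    (by simp) (by rw [h1]; exact g1) (by rw [h2]; exact g2) (.two t t₁)
  obtain ⟨Δ'', Θ'', h'', e1', e2'⟩ := h'.step (G := G ∪ A) hsub
    (by rw [SDist.all_iff, e1, h1]; exact k1) (by rw [SDist.all_iff, e2, h2]; exact k2) (.one t₂)
  obtain ⟨Δ₃, Θ₃, h₃, e1'', e2''⟩ := h''.step (G := G ∪ A) hsub
    (by rw [SDist.all_iff, e1', e1, h1]; exact stepV_good (μ := .tau) k1)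
    (by rw [SDist.all_iff, e2', e2, h2]; exact stepV_good (μ := .tau) k2) (.one t₃)
  refine ⟨_, Δ₃, Θ₃, hf.par_nil q.2 hqA, h₃, ?_, ?_⟩
  · rw [e1'', e1', e1, h1, run g1, hf.stepV_mapV hd hD _ hμ, opV_mapV, ← Frame.mapV_par]
  · rw [e2'', e2', e2, h2, run g2, hf.stepV_mapV hd hT _ hμ, opV_mapV, ← Frame.mapV_par]

/-! ### Saturated bisimilarity implies ground bisimilarity -/

/-- All product measurements of the environment lead to framed bisimilar distributions. -/
def Probed (G : Finset ℕ) (D T : QV S) : Prop :=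
  ∀ p : S → Matrix (Fin 2) (Fin 2) ℂ, (∀ q, IsProj (p q)) → (∀ q : S, q.1 ∈ G → p q = 1) →
    ∃ A, Disjoint G A ∧ Framed A (opV (conjL (prodOp p)) D) (opV (conjL (prodOp p)) T)

theorem Probed.symm {G : Finset ℕ} {D T : QV S} (h : Probed G D T) : Probed G T D := by
  intro p hp hG
  obtain ⟨A, hA, h⟩ := h p hp hG
  exact ⟨A, hA, h.symm⟩

/-- After a probe by p the mass is the trace of pXp, which for a projection equals that of pX;
tomography recovers the environment from these numbers. -/
theorem Probed.trace_eq {G : Finset ℕ} {D T : QV S} (h : Probed G D T) :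
    partialTrace G (tot D) = partialTrace G (tot T) := by
  refine partialTrace_eq_of_isProj fun p hp hG => ?_
  obtain ⟨A, -, h⟩ := h p hp hG
  have key : ∀ D : QV S, (tot (opV (conjL (prodOp p)) D)).trace = (prodOp p * tot D).trace := by
    intro D
    rw [tot_opV, conjL_apply, Matrix.trace_mul_comm, ← mul_assoc, prodOp_conjTranspose, prodOp_mul]
    congr 3
    funext q
    rw [(hp q).1, (hp q).2]
  rw [← key, ← key]
  exact h.trace_eq

theorem opV_conjL_mul (K L : Op S) (D : QV S) :
    opV (conjL (K * L)) D = opV (conjL K) (opV (conjL L) D) :=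
  Finsupp.ext fun P => by rw [opV_apply, opV_apply, opV_apply, conjL_mul]; rfl

/-- Probing first and then stepping equals stepping and then probing. Each labelled step is imitated
by the matching experiment on the probed vectors. Only the send of a qubit enlarges the environment
and calls for a new measurement. -/
theorem Probed.step {G : Finset ℕ} {D T : QV S} (h : Probed G D T) (hG : G ⊆ S)
    (hD : D ∈ Supp (GoodIR S G)) (hT : T ∈ Supp (GoodIR S G)) {μ : Act} {s : Sched}
    (h0 : stepV μ s D ≠ 0 ∨ stepV μ s T ≠ 0) :
    Probed (μ.after G) (stepV μ s D) (stepV μ s T) := by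
  have gD : D ∈ Supp (Good S G) := Supp.mono (fun _ h => h.1) hD
  have gT : T ∈ Supp (Good S G) := Supp.mono (fun _ h => h.1) hT
  have hfit : μ.Fits S G := h0.elim (stepV_fits gD) (stepV_fits gT)
  have hs : μ = .tau ∨ ∃ t, s = .one t := by
    by_cases hμ : μ = .tau
    · exact Or.inl hμ
    · cases s with
      | one t => exact Or.inr ⟨t, rfl⟩
      | two t t' =>
        rw [stepV_two_visible hμ, stepV_two_visible hμ] at h0
        simp at h0
  intro p hp hp1
  rcases μ with _ | ⟨c, v⟩ | ⟨c, v⟩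
  · obtain ⟨A, hA, hF⟩ := h p hp hp1
    refine ⟨A, hA, ?_⟩
    have hoff := off_prodOp G p hp1
    rw [← stepV_conjL_comm gD hoff, ← stepV_conjL_comm gT hoff]
    exact hF.tau hG hA (opV_mem_supp gD) (opV_mem_supp gT) s
  · obtain ⟨t, rfl⟩ := hs.resolve_left (by simp)
    by_cases hc : c.ty = .qubit
    · obtain ⟨q, rfl⟩ : ∃ q, v = .qubit q := by
        have := hfit.1.trans hc
        cases v with
        | qubit q => exact ⟨q, rfl⟩
        | _ => cases this
      have hqG := hfit.2 q rfl
      let q' : S := ⟨q, hG hqG⟩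
      -- Before the send, q is still owned and cannot be probed, so the earlier probe has the
      -- trivial factor there; the factor of p at q is supplied by the observer that receives q.
      let p' := Function.update p q' 1
      have hp'1 : ∀ r : S, r.1 ∈ G → p' r = 1 := by
        intro r hr
        by_cases hrq : r = q'
        · subst hrq; simp [p']
        · simp only [p', Function.update_of_ne hrq]
          refine hp1 r (Finset.mem_erase.2 ⟨fun h => hrq (Subtype.ext h), hr⟩)
      have hp' : ∀ r, IsProj (p' r) := by
        intro r
        by_cases hrq : r = q'
        · subst hrq; simp [p', isProj_one]
        · simp only [p', Function.update_of_ne hrq]; exact hp r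
      have hpp : prodOp p = embed (qubitEmb q') (single1 (p q')) * prodOp p' := by
        rw [embed_single1_mul_prodOp _ _ _ (by simp [p'])]
        simp [p']
      have hoff := off_prodOp G p' hp'1
      obtain ⟨A, hA, hF⟩ := h p' hp' hp'1
      refine ⟨insert q A, ?_, ?_⟩
      · rw [Finset.disjoint_insert_right]
        exact ⟨Finset.notMem_erase _ _, hA.mono_left (Finset.erase_subset _ _)⟩
      · have := hF.send_qubit hG hA (opV_mem_supp gD) (opV_mem_supp gT) hc q' hqG t (hp q')
        rw [stepV_conjL_comm gD hoff, stepV_conjL_comm gT hoff, ← opV_conjL_mul, ← opV_conjL_mul,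
          ← hpp] at this
        exact this
    · have hafter : (Act.send c v).after G = G := by
        rcases v with _ | _ | q
        · rfl
        · rfl
        · exact absurd hfit.1.symm hc
      rw [hafter] at hp1 ⊢
      obtain ⟨A, hA, hF⟩ := h p hp hp1
      refine ⟨A, hA, ?_⟩
      have hoff := off_prodOp G p hp1
      rw [← stepV_conjL_comm gD hoff, ← stepV_conjL_comm gT hoff]
      exact hF.send hG hA (opV_mem_supp gD) (opV_mem_supp gT) hfit.1 hc t
  · obtain ⟨t, rfl⟩ := hs.resolve_left (by simp)
    by_cases hc : c.ty = .qubit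
    · obtain ⟨q, rfl⟩ : ∃ q, v = .qubit q := by
        have := hfit.1.trans hc
        cases v with
        | qubit q => exact ⟨q, rfl⟩
        | _ => cases this
      rw [stepV_recv_qubit hD, stepV_recv_qubit hT] at h0
      simp at h0
    · have hafter : (Act.recv c v).after G = G := by
        rcases v with _ | _ | q
        · rfl
        · rfl
        · exact absurd hfit.1.symm hc
      rw [hafter] at hp1 ⊢
      obtain ⟨A, hA, hF⟩ := h p hp hp1
      refine ⟨A, hA, ?_⟩
      have hoff := off_prodOp G p hp1
      rw [← stepV_conjL_comm gD hoff, ← stepV_conjL_comm gT hoff]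
      exact hF.recv hG hA (opV_mem_supp gD) (opV_mem_supp gT) hfit.1 hc t

/-- The qubits outside G are measured one after another, each by its own observer; the one-qubit
projections multiply to the product operator. -/
theorem Framed.probed {G : Finset ℕ} {D T : QV S} (h : Framed ∅ D T) (hG : G ⊆ S)
    (hD : D ∈ Supp (Good S G)) (hT : T ∈ Supp (Good S G)) : Probed G D T := by
  classical
  intro p hp hp1
  have key : ∀ A : Finset S, (∀ q ∈ A, q.1 ∉ G) →
      Framed (A.map (Function.Embedding.subtype _))
        (opV (conjL (prodOp fun q => if q ∈ A then p q else 1)) D)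
        (opV (conjL (prodOp fun q => if q ∈ A then p q else 1)) T) := by
    intro A
    induction A using Finset.induction_on with
    | empty =>
      intro _
      have e : ∀ D : QV S, opV (conjL (1 : Op S)) D = D := fun D =>
        Finsupp.ext fun P => by rw [opV_apply, conjL_one]; rfl
      simpa [prodOp_one, e] using h
    | insert q A hqA ih =>
      intro hA
      have hF := ih fun r hr => hA r (Finset.mem_insert_of_mem hr)
      have hd : Disjoint G (A.map (Function.Embedding.subtype _)) := by
        rw [Finset.disjoint_left]
        intro r hr hr'
        obtain ⟨r', h1, rfl⟩ := Finset.mem_map.1 hr'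
        exact hA r' (Finset.mem_insert_of_mem h1) hr
      have hq' : q.1 ∉ A.map (Function.Embedding.subtype _) := by
        intro h
        obtain ⟨r', h1, h2⟩ := Finset.mem_map.1 h
        exact hqA (Subtype.ext (a1 := r') (a2 := q) h2 ▸ h1)
      have := hF.measure hG hd (opV_mem_supp hD) (opV_mem_supp hT) q
        (hA q (Finset.mem_insert_self _ _)) hq' (hp q)
      have hpp : (prodOp fun r => if r ∈ insert q A then p r else 1) =
          embed (qubitEmb q) (single1 (p q)) * prodOp fun r => if r ∈ A then p r else 1 := by
        rw [embed_single1_mul_prodOp _ _ _ (by simp [hqA])]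
        congr 1
        funext r
        by_cases hr : r = q
        · subst hr; simp
        · simp [hr]
      rw [← opV_conjL_mul, ← opV_conjL_mul, ← hpp] at this
      rw [Finset.map_insert]
      exact this
  have hfin := key (Finset.univ.filter fun q => q.1 ∉ G) fun q hq => (Finset.mem_filter.1 hq).2
  have hpe : (fun q => if q ∈ Finset.univ.filter (fun q : S => q.1 ∉ G) then p q else 1) = p := by
    funext q
    by_cases hq : q.1 ∈ G
    · simp [hq, hp1 q hq]
    · simp [hq]
  rw [hpe] at hfin
  refine ⟨_, ?_, hfin⟩
  rw [Finset.disjoint_left]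
  intro r hr hr'
  obtain ⟨r', h1, rfl⟩ := Finset.mem_map.1 hr'
  exact (Finset.mem_filter.1 h1).2 hr

/-- Quantum distributions that agree in all experiments. -/
def ProbeEquiv (D T : QDist S) : Prop :=
  (D.1 = 0 ∧ T.1 = 0) ∨ ∃ G ⊆ S, D.1 ∈ Supp (GoodIR S G) ∧ T.1 ∈ Supp (GoodIR S G) ∧
    Probed G D.1 T.1

theorem ProbeEquiv.symm {D T : QDist S} (h : ProbeEquiv D T) : ProbeEquiv T D := by
  rcases h with ⟨h1, h2⟩ | ⟨G, hG, h1, h2, h⟩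
  · exact Or.inl ⟨h2, h1⟩
  · exact Or.inr ⟨G, hG, h2, h1, h.symm⟩

theorem ProbeEquiv.step {D T D' : QDist S} (h : ProbeEquiv D T) {μ : Act} {s : Sched}
    (hs : QStep D μ s D') : ∃ T', QStep T μ s T' ∧ ProbeEquiv D' T' := by
  rcases h with ⟨h1, h2⟩ | ⟨G, hG, h1, h2, h⟩
  · have g1 : D.1 ∈ Supp (Good S ∅) := by rw [h1]; exact zero_mem _
    have g2 : T.1 ∈ Supp (Good S ∅) := by rw [h2]; exact zero_mem _
    refine ⟨_, T.qstep_step g2 μ s, Or.inl ⟨?_, ?_⟩⟩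
    · rw [hs.eq_stepV g1, h1, map_zero]
    · change stepV μ s T.1 = 0
      rw [h2, map_zero]
  · have g1 : D.1 ∈ Supp (Good S G) := Supp.mono (fun _ h => h.1) h1
    have g2 : T.1 ∈ Supp (Good S G) := Supp.mono (fun _ h => h.1) h2
    refine ⟨_, T.qstep_step g2 μ s, ?_⟩
    have e1 := hs.eq_stepV g1
    have e2 : (T.step g2 μ s).1 = stepV μ s T.1 := rfl
    by_cases h0 : stepV μ s D.1 = 0 ∧ stepV μ s T.1 = 0
    -- When both sides vanish, the action need not fit the type and the type after it may leave the
    -- register; the alternative for zero vectors needs no type.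
    · exact Or.inl ⟨e1.trans h0.1, e2.trans h0.2⟩
    · rw [not_and_or] at h0
      refine Or.inr ⟨μ.after G, ?_, ?_, ?_, ?_⟩
      · exact (h0.elim (stepV_fits g1) (stepV_fits g2)).after_subset hG
      · rw [e1]; exact stepV_goodIR h1
      · rw [e2]; exact stepV_goodIR h2
      · rw [e1, e2]; exact h.step hG h1 h2 h0

theorem isGroundBisimulation_probeEquiv : IsGroundBisimulation (ProbeEquiv (S := S)) where
  wellTyped := by
    rintro D T (⟨h1, h2⟩ | ⟨G, hG, h1, h2, -⟩)
    · exact ⟨∅, .of_supp (by simp) (by rw [h1]; exact zero_mem _),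
        .of_supp (by simp) (by rw [h2]; exact zero_mem _)⟩
    · exact ⟨G, .of_supp hG (Supp.mono (fun _ h => h.1) h1),
        .of_supp hG (Supp.mono (fun _ h => h.1) h2)⟩
  forth D T h μ s D' hs := h.step hs
  back D T h μ s T' hs := by
    obtain ⟨D', h1, h2⟩ := h.symm.step hs
    exact ⟨D', h1, h2.symm⟩
  env_eq := by
    intro D T h G' hD hT
    have hz : D.1 = 0 → T.1 = 0 → D.env G' = T.env G' := by
      intro h1 h2
      rw [QDist.env, QDist.env, h1, h2]
    rcases h with ⟨h1, h2⟩ | ⟨G, hG, h1, h2, h⟩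
    · exact hz h1 h2
    -- Environments are to be compared in every common type, whereas the probes concern G. One
    -- nonempty side identifies the two; if both are empty the environments are zero.
    · have huniq : ∀ {D : QDist S}, D.1 ∈ Supp (GoodIR S G) → QTyped G' D → D.1 ≠ 0 → G = G' := by
        intro D h1 hD h0
        obtain ⟨P, hP⟩ := Finsupp.support_nonempty_iff.2 h0
        exact (mem_supp.1 h1 P (Finsupp.mem_support_iff.1 hP)).1.hasType.unique (hD.2 P hP)
      have henv : D.env G = T.env G := by
        rw [QDist.env, QDist.env, ← tot_eq_sum, ← tot_eq_sum]
        exact h.trace_eq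
      by_cases d0 : D.1 = 0
      · by_cases t0 : T.1 = 0
        · exact hz d0 t0
        · rwa [← huniq h2 hT t0]
      · rwa [← huniq h1 hD d0]

theorem groundBisimilar_of_scheduledSaturated {ρ σ : Density S} {P Q : Proc} (hP : P.Deterministic)
    (hQ : Q.Deterministic) (hPg : P.InputRestricted) (hQg : Q.InputRestricted)
    (h : ScheduledSaturatedBisimilar (SDist.point ((ρ, P) : Conf S))
      (SDist.point ((σ, Q) : Conf S))) :
    GroundBisimilar (QDist.point ρ P) (QDist.point σ Q) := by
  refine ⟨ProbeEquiv, isGroundBisimulation_probeEquiv, ?_⟩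
  obtain ⟨G, h1, h2⟩ : ∃ G, DistTyped G (SDist.point ((ρ, P) : Conf S)) ∧
      DistTyped G (SDist.point ((σ, Q) : Conf S)) := by
    obtain ⟨R, hR, h⟩ := h
    exact hR.wellTyped _ _ h
  have gP : Good S G P := ⟨hP, h1.2 (ρ, P) (by simp [SDist.point]), h1.1⟩
  have gQ : Good S G Q := ⟨hQ, h2.2 (σ, Q) (by simp [SDist.point]), h1.1⟩
  have hid : ∀ D : QV S, mapV (fun P => P) D = D := fun D => Finsupp.mapDomain_id
  have hF : Framed ∅ (QDist.point ρ P).1 (QDist.point σ Q).1 :=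
    ⟨fun P => P, _, _, .id, h, by rw [qC_point, hid]; rfl, by rw [qC_point, hid]; rfl⟩
  exact Or.inr ⟨G, h1.1, QDist.point_supp ⟨gP, hPg⟩, QDist.point_supp ⟨gQ, hQg⟩,
    hF.probed h1.1 (QDist.point_supp gP) (QDist.point_supp gQ)⟩

end LqCCS

theorem mainTheorem3 (S : Finset ℕ) (ρ σ : LqCCS.Density S) (P Q : LqCCS.Proc)
    (hP : P.Deterministic) (hQ : Q.Deterministic)
    (hPg : P.InputRestricted) (hQg : Q.InputRestricted) :
    LqCCS.ScheduledSaturatedBisimilar (LqCCS.SDist.point ((ρ, P) : LqCCS.Conf S))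
        (LqCCS.SDist.point ((σ, Q) : LqCCS.Conf S)) ↔
      LqCCS.GroundBisimilar (LqCCS.QDist.point ρ P) (LqCCS.QDist.point σ Q) :=
  ⟨LqCCS.groundBisimilar_of_scheduledSaturated hP hQ hPg hQg,
    LqCCS.scheduledSaturatedBisimilar_of_ground hP hQ hPg hQg⟩
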